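/- Let $K$ be a field of characteristic $p$ and let $N=2n$ with $n\ge 1$; assume $p=0$ or $p>N$. Index rows and columns of $N\times N$ matrices by $\{-n,\dots,-1,1,\dots,n\}$, and let $G=[g_{ij}]$ with $g_{ij}=\delta_{i,-j}$ (orthogonal case, $\mathfrak g_n=\mathfrak o_N$) or $g_{ij}=\delta_{i,-j}\,\mathrm{sgn}\,i$ (symplectic case, $\mathfrak g_n=\mathfrak{sp}_N$). Put $A'=G^{-1}A^tG$ and $V=K^N$; let $P$ be the flip of $V\otimes V$, $R(u)=1-P/u$ and $R'(u)=G_1^{-1}R^{t_1}(u)G_1$, where subscripts denote tensor factors and $t_1$ is the transposition in the first factor. The Yangian $Y(\mathfrak{gl}_N)$ is the unital associative $K$-algebra with generators $t_{ij}^{(r)}$, $r\ge1$, and defining relations $$R(u-v)T_1(u)T_2(v)=T_2(v)T_1(u)R(u-v),$$ where $T(u)=[t_{ij}(u)]$ and $t_{ij}(u)=\delta_{ij}+\sum_{r\ge1}t_{ij}^{(r)}u^{-r}$. The twisted Yangian $Y(\mathfrak g_n)$ is the unital associative $K$-algebra with generators $s_{ij}^{(r)}$, $r\ge1$, and, with $S(u)=[s_{ij}(u)]$,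 $s_{ij}(u)=\delta_{ij}+\sum_{r\ge1}s_{ij}^{(r)}u^{-r}$, defining relations $$R(u-v)S_1(u)R'(-u-v)S_2(v)=S_2(v)R'(-u-v)S_1(u)R(u-v),\qquad S'(-u)=S(u)\pm\frac{S(u)-S(-u)}{2u},$$ with sign $+$ in the orthogonal and $-$ in the symplectic case. Let $A_N=\sum_{\sigma\in\mathfrak S_N}\mathrm{sgn}(\sigma)\,\sigma$ act on $V^{\otimes N}$, let $u_i=u-i+1$, $T_i=T_i(u_i)$, $S_i=S_i(u_i)$, $R'_{ij}=R'_{ij}(-u_i-u_j)$, and $$\langle S_1,\dots,S_N\rangle=S_1(R'_{12}\cdots R'_{1N})\,S_2(R'_{23}\cdots R'_{2N})\cdots S_N .$$ Then there are unique series $\mathrm{qdet}\,T(u)\in Y(\mathfrak{gl}_N)[[u^{-1}]]$ and $\mathrm{sdet}\,S(u)\in Y(\mathfrak g_n)[[u^{-1}]]$ with $$A_N T_1\cdots T_N=A_N\,\mathrm{qdet}\,T(u),\qquad A_N\langle S_1,\dots,S_N\rangle=A_N\,\mathrm{sdet}\,S(u).$$ There is a unique algebra homomorphism $Y(\mathfrak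 g_n)\to Y(\mathfrak{gl}_N)$ with $S(u)\mapsto T(u)T'(-u)$; it is injective, and under this embedding $$\mathrm{sdet}\,S(u)=\alpha_N(u)\,\mathrm{qdet}\,T(u)\,\mathrm{qdet}\,T(-u+N-1),$$ where $\alpha_N(u)=1$ in the orthogonal case and $\alpha_N(u)=\dfrac{2u+1}{2u-N+1}$ in the symplectic case, rational functions being expanded in $u^{-1}$. -/

import Mathlib

open scoped PowerSeries

namespace YangianDet

noncomputable section

/-! Conventions.  A formal series `a₀ + a₁ u⁻¹ + a₂ u⁻² + ⋯` over a (noncommutative) ring `A` is the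
power series over `A` whose variable `X` stands for `u⁻¹`.  A series in `u⁻¹` and `v⁻¹` is an element
of `A⟦X⟧⟦X⟧`, where the inner variable is `u⁻¹` and the outer variable is `v⁻¹`.
With `V = K ^ N`, elements of `(End V)^{⊗ m} ⊗ B` are matrices over `B` whose rows and columns
are indexed by `Fin m → Fin N`, the index `f` standing for `e_{f 0} ⊗ ⋯ ⊗ e_{f (m-1)}`. -/

/-- The two families of classical Lie algebras `𝔬_{2n}` and `𝔰𝔭_{2n}`. -/
inductive FormType : Type
  | orthogonal
  | symplectic

/-! ### Operators on tensor powers -/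

section Tensor

/-- `M_a`: the matrix `M` acting on the `a`-th tensor factor. -/
def atPos {N m : ℕ} {B : Type*} [Ring B] (a : Fin m) (M : Matrix (Fin N) (Fin N) B) :
    Matrix (Fin m → Fin N) (Fin m → Fin N) B :=
  Matrix.of fun f g => if ∀ b, b ≠ a → f b = g b then M (f a) (g a) else 0

/-- `P_{ab}`: the operator exchanging the tensor factors `a` and `b`. -/
def flip (N : ℕ) {m : ℕ} (B : Type*) [Ring B] (a b : Fin m) :
    Matrix (Fin m → Fin N) (Fin m → Fin N) B :=
  Matrix.of fun f g => if f = g ∘ Equiv.swap a b then 1 else 0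

/-- The antisymmetrizer `A_m`, `e_{g 0} ⊗ ⋯ ⊗ e_{g (m-1)} ↦ ∑_σ sgn σ • e_{g (σ 0)} ⊗ ⋯`. -/
def antisymmetrizer (N m : ℕ) (B : Type*) [Ring B] :
    Matrix (Fin m → Fin N) (Fin m → Fin N) B :=
  Matrix.of fun f g => ∑ σ : Equiv.Perm (Fin m),
    if f = g ∘ σ then (((Equiv.Perm.sign σ : ℤˣ) : ℤ) : B) else 0

/-- Transposition in the `a`-th tensor factor. -/
def partialTranspose {N m : ℕ} {B : Type*} (a : Fin m)
    (M : Matrix (Fin m → Fin N) (Fin m → Fin N) B) :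
    Matrix (Fin m → Fin N) (Fin m → Fin N) B :=
  Matrix.of fun f g => M (Function.update f a (g a)) (Function.update g a (f a))

/-- The operator `d - c P_{ab}`, that is, `d * R_{ab}(d / c)` where `R(z) = 1 - P / z`
(`c` and `d` will be central). -/
def rMatrix (N : ℕ) {m : ℕ} {B : Type*} [Ring B] (c d : B) (a b : Fin m) :
    Matrix (Fin m → Fin N) (Fin m → Fin N) B :=
  d • (1 : Matrix (Fin m → Fin N) (Fin m → Fin N) B) - c • flip N B a b

end Tensor

/-! ### The form and the transposition it defines.
The index `k : Fin (2 * n)` stands for the `k`-th element (from `0`, in increasing order) of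
`{-n, …, -1, 1, …, n}`; thus `i ↦ -i` is `Fin.rev`, and the index is negative iff `k < n`. -/

section Form

/-- The sign of an index. -/
def idxSign (K : Type*) [Ring K] {n : ℕ} (i : Fin (2 * n)) : K := if (i : ℕ) < n then -1 else 1

/-- The matrix `G`: `g_{ij} = δ_{i,-j}` in the orthogonal case, `g_{ij} = δ_{i,-j} sgn i` in the
symplectic case. -/
def formMatrix (K : Type*) [Field K] (n : ℕ) (κ : FormType) :
    Matrix (Fin (2 * n)) (Fin (2 * n)) K :=
  Matrix.of fun i j =>
    if i = Fin.rev j then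
      match κ with
      | FormType.orthogonal => 1
      | FormType.symplectic => idxSign K i
    else 0

/-- `M' = G⁻¹ Mᵗ G`. -/
def formTranspose (K : Type*) [Field K] {n : ℕ} (κ : FormType) {B : Type*} [Ring B] [Algebra K B]
    (M : Matrix (Fin (2 * n)) (Fin (2 * n)) B) : Matrix (Fin (2 * n)) (Fin (2 * n)) B :=
  ((formMatrix K n κ)⁻¹).map (algebraMap K B) * M.transpose *
    (formMatrix K n κ).map (algebraMap K B)

/-- The transpose with respect to `G` in the `a`-th factor of `d * R_{ab}(d / c)`, that is,
`d * R'_{ab}(d / c)` where `R'_{ab}(z) = G_a⁻¹ R_{ab}(z)^{t_a} G_a`. -/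
def rMatrixPrime (K : Type*) [Field K] (n : ℕ) (κ : FormType) {m : ℕ} {B : Type*} [Ring B]
    [Algebra K B] (c d : B) (a b : Fin m) :
    Matrix (Fin m → Fin (2 * n)) (Fin m → Fin (2 * n)) B :=
  atPos a (((formMatrix K n κ)⁻¹).map (algebraMap K B)) *
    partialTranspose a (rMatrix (2 * n) c d a b) *
    atPos a ((formMatrix K n κ).map (algebraMap K B))

end Form

/-! ### Substitutions in series in `u⁻¹` -/

section Series

/-- `(a u + b)⁻¹` as a series in `u⁻¹`, for `a ≠ 0`. -/
def affineInv {K : Type*} [Field K] (a b : K) : K⟦X⟧ :=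
  PowerSeries.X * (PowerSeries.C a + PowerSeries.C b * PowerSeries.X)⁻¹

/-- The series `f(a u + b)` for `a ≠ 0`, obtained from `f(u) = ∑ f_k u⁻ᵏ`
by replacing `u⁻¹` with `(a u + b)⁻¹`. -/
def affineSubst {K : Type*} [Field K] {A : Type*} [Ring A] [Algebra K A] (a b : K) (f : A⟦X⟧) :
    A⟦X⟧ :=
  PowerSeries.mk fun r => ∑ k ∈ Finset.range (r + 1),
    PowerSeries.coeff r (affineInv a b ^ k) • PowerSeries.coeff k f

/-- A scalar series regarded as a series over a `K`-algebra. -/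
def scalarSeries {K : Type*} [Field K] (A : Type*) [Ring A] [Algebra K A] (f : K⟦X⟧) : A⟦X⟧ :=
  PowerSeries.map (algebraMap K A) f

/-- `f(u)` as a series in `u⁻¹`, `v⁻¹`. -/
def inU {A : Type*} [Ring A] : A⟦X⟧ →+* A⟦X⟧⟦X⟧ := PowerSeries.C

/-- `f(v)` as a series in `u⁻¹`, `v⁻¹`. -/
def inV {A : Type*} [Ring A] : A⟦X⟧ →+* A⟦X⟧⟦X⟧ := PowerSeries.map PowerSeries.C

/-- `u⁻¹`. -/
def uInv {A : Type*} [Ring A] : A⟦X⟧⟦X⟧ := inU PowerSeries.X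

/-- `v⁻¹`. -/
def vInv {A : Type*} [Ring A] : A⟦X⟧⟦X⟧ := inV PowerSeries.X

/-- The matrix of series `δ_{ij} + t_{ij}^{(1)} u⁻¹ + t_{ij}^{(2)} u⁻² + ⋯`, where `t i j r` is
`t_{ij}^{(r+1)}`. -/
def genMatrix {N : ℕ} {A : Type*} [Ring A] (t : Fin N → Fin N → ℕ → A) :
    Matrix (Fin N) (Fin N) A⟦X⟧ :=
  Matrix.of fun i j => PowerSeries.mk fun r =>
    match r with
    | 0 => if i = j then 1 else 0
    | s + 1 => t i j s

end Series

/-! ### The Yangian of `𝔤𝔩_N` -/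

section Yangian

/-- Left side of the ternary relation `R(u-v) T₁(u) T₂(v) = T₂(v) T₁(u) R(u-v)`, multiplied by
the central factor `u⁻¹v⁻¹(u - v) = v⁻¹ - u⁻¹`. -/
def ternaryLeft {N : ℕ} {A : Type*} [Ring A] (T : Matrix (Fin N) (Fin N) A⟦X⟧) :
    Matrix (Fin 2 → Fin N) (Fin 2 → Fin N) A⟦X⟧⟦X⟧ :=
  rMatrix N (uInv * vInv) (vInv - uInv) 0 1 * atPos 0 (T.map inU) * atPos 1 (T.map inV)

/-- Right side of the ternary relation, multiplied by the same factor. -/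
def ternaryRight {N : ℕ} {A : Type*} [Ring A] (T : Matrix (Fin N) (Fin N) A⟦X⟧) :
    Matrix (Fin 2 → Fin N) (Fin 2 → Fin N) A⟦X⟧⟦X⟧ :=
  atPos 1 (T.map inV) * atPos 0 (T.map inU) * rMatrix N (uInv * vInv) (vInv - uInv) 0 1

/-- The free algebra on symbols `(i, j, r)`, standing for the generators with superscript
`r + 1 ≥ 1`. -/
abbrev FreeGen (K : Type*) [Field K] (N : ℕ) : Type _ := FreeAlgebra K (Fin N × Fin N × ℕ)

/-- The generating matrix over the free algebra. -/
def freeMatrix (K : Type*) [Field K] (N : ℕ) : Matrix (Fin N) (Fin N) (FreeGen K N)⟦X⟧ :=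
  genMatrix fun i j r => FreeAlgebra.ι K (i, j, r)

/-- The coefficients of the entries of the ternary relation. -/
inductive YangianRel (K : Type*) [Field K] (N : ℕ) : FreeGen K N → FreeGen K N → Prop
  | ternary (f g : Fin 2 → Fin N) (r s : ℕ) : YangianRel K N
      (PowerSeries.coeff r (PowerSeries.coeff s (ternaryLeft (freeMatrix K N) f g)))
      (PowerSeries.coeff r (PowerSeries.coeff s (ternaryRight (freeMatrix K N) f g)))

/-- The Yangian `Y(𝔤𝔩_N)`. -/
abbrev Yangian (K : Type*) [Field K] (N : ℕ) : Type _ := RingQuot (YangianRel K N)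

/-- The matrix `T(u)` over `Y(𝔤𝔩_N)⟦u⁻¹⟧`. -/
def matT (K : Type*) [Field K] (N : ℕ) : Matrix (Fin N) (Fin N) (Yangian K N)⟦X⟧ :=
  genMatrix fun i j r => RingQuot.mkAlgHom K (YangianRel K N) (FreeAlgebra.ι K (i, j, r))

end Yangian

/-! ### The twisted Yangians -/

section Twisted

/-- Left side of the quaternary relation
`R(u-v) S₁(u) R'(-u-v) S₂(v) = S₂(v) R'(-u-v) S₁(u) R(u-v)`, multiplied by the central factor
`u⁻¹v⁻¹(u - v) * u⁻¹v⁻¹(-u - v)`. -/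
def quaternaryLeft (K : Type*) [Field K] {n : ℕ} (κ : FormType) {A : Type*} [Ring A] [Algebra K A]
    (S : Matrix (Fin (2 * n)) (Fin (2 * n)) A⟦X⟧) :
    Matrix (Fin 2 → Fin (2 * n)) (Fin 2 → Fin (2 * n)) A⟦X⟧⟦X⟧ :=
  rMatrix (2 * n) (uInv * vInv) (vInv - uInv) 0 1 * atPos 0 (S.map inU) *
    rMatrixPrime K n κ (uInv * vInv) (-vInv - uInv) 0 1 * atPos 1 (S.map inV)

/-- Right side of the quaternary relation, multiplied by the same factor. -/
def quaternaryRight (K : Type*) [Field K] {n : ℕ} (κ : FormType) {A : Type*} [Ring A] [Algebra K A]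
    (S : Matrix (Fin (2 * n)) (Fin (2 * n)) A⟦X⟧) :
    Matrix (Fin 2 → Fin (2 * n)) (Fin 2 → Fin (2 * n)) A⟦X⟧⟦X⟧ :=
  atPos 1 (S.map inV) * rMatrixPrime K n κ (uInv * vInv) (-vInv - uInv) 0 1 *
    atPos 0 (S.map inU) * rMatrix (2 * n) (uInv * vInv) (vInv - uInv) 0 1

/-- The sign `+1` in the orthogonal and `-1` in the symplectic case. -/
def formSign (K : Type*) [Field K] : FormType → K
  | FormType.orthogonal => 1
  | FormType.symplectic => -1

/-- `M'(-u)`. -/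
def primeNeg (K : Type*) [Field K] {n : ℕ} (κ : FormType) {A : Type*} [Ring A] [Algebra K A]
    (M : Matrix (Fin (2 * n)) (Fin (2 * n)) A⟦X⟧) :
    Matrix (Fin (2 * n)) (Fin (2 * n)) A⟦X⟧ :=
  (formTranspose K κ M).map (affineSubst (-1 : K) 0)

/-- The right side `S(u) ± (S(u) - S(-u)) / (2u)` of the symmetry relation. -/
def symmetryRight (K : Type*) [Field K] {n : ℕ} (κ : FormType) {A : Type*} [Ring A] [Algebra K A]
    (S : Matrix (Fin (2 * n)) (Fin (2 * n)) A⟦X⟧) :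
    Matrix (Fin (2 * n)) (Fin (2 * n)) A⟦X⟧ :=
  S + formSign K κ • (scalarSeries A (affineInv (2 : K) 0) • (S - S.map (affineSubst (-1 : K) 0)))

/-- The coefficients of the entries of the quaternary and of the symmetry relation. -/
inductive TwistedRel (K : Type*) [Field K] (n : ℕ) (κ : FormType) :
    FreeGen K (2 * n) → FreeGen K (2 * n) → Prop
  | quaternary (f g : Fin 2 → Fin (2 * n)) (r s : ℕ) : TwistedRel K n κ
      (PowerSeries.coeff r (PowerSeries.coeff s
        (quaternaryLeft K κ (freeMatrix K (2 * n)) f g)))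
      (PowerSeries.coeff r (PowerSeries.coeff s
        (quaternaryRight K κ (freeMatrix K (2 * n)) f g)))
  | symmetry (i j : Fin (2 * n)) (r : ℕ) : TwistedRel K n κ
      (PowerSeries.coeff r (primeNeg K κ (freeMatrix K (2 * n)) i j))
      (PowerSeries.coeff r (symmetryRight K κ (freeMatrix K (2 * n)) i j))

/-- The twisted Yangian `Y(𝔤_n)`, where `𝔤_n` is `𝔬_{2n}` or `𝔰𝔭_{2n}`. -/
abbrev TwistedYangian (K : Type*) [Field K] (n : ℕ) (κ : FormType) : Type _ :=
  RingQuot (TwistedRel K n κ)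

/-- The matrix `S(u)` over `Y(𝔤_n)⟦u⁻¹⟧`. -/
def matS (K : Type*) [Field K] (n : ℕ) (κ : FormType) :
    Matrix (Fin (2 * n)) (Fin (2 * n)) (TwistedYangian K n κ)⟦X⟧ :=
  genMatrix fun i j r => RingQuot.mkAlgHom K (TwistedRel K n κ) (FreeAlgebra.ι K (i, j, r))

end Twisted

/-! ### Quantum and Sklyanin determinants -/

section Determinants

/-- `T_1(u) T_2(u-1) ⋯ T_N(u-N+1)` in `(End V)^{⊗ N} ⊗ A⟦u⁻¹⟧`. -/
def tensorProduct (K : Type*) [Field K] {N : ℕ} {A : Type*} [Ring A] [Algebra K A]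
    (T : Matrix (Fin N) (Fin N) A⟦X⟧) : Matrix (Fin N → Fin N) (Fin N → Fin N) A⟦X⟧ :=
  ((List.finRange N).map fun a => atPos a (T.map (affineSubst (1 : K) (-((a : ℕ) : K))))).prod

/-- `⟨S_1, …, S_N⟩ = S_1 (R'_{12} ⋯ R'_{1N}) S_2 (R'_{23} ⋯ R'_{2N}) ⋯ S_N`, where
`S_a = S_a(u_a)`, `R'_{ab} = R'_{ab}(-u_a - u_b)` and the spectral parameters are
`u, u - 1, …, u - N + 1`, so `-u_a - u_b = -2u + (a + b)` when `a`, `b` are counted from `0`. -/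
def bracket (K : Type*) [Field K] {n : ℕ} (κ : FormType) {A : Type*} [Ring A] [Algebra K A]
    (S : Matrix (Fin (2 * n)) (Fin (2 * n)) A⟦X⟧) :
    Matrix (Fin (2 * n) → Fin (2 * n)) (Fin (2 * n) → Fin (2 * n)) A⟦X⟧ :=
  ((List.finRange (2 * n)).map fun a =>
    atPos a (S.map (affineSubst (1 : K) (-((a : ℕ) : K)))) *
      (((List.finRange (2 * n)).filter fun (b : Fin (2 * n)) => a < b).map fun (b : Fin (2 * n)) =>
        rMatrixPrime K n κ
          (scalarSeries A (affineInv (-2 : K) (((a : ℕ) : K) + ((b : ℕ) : K)))) 1 a b).prod).prod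

/-- The coefficient of `e_1 ⊗ ⋯ ⊗ e_N` in the image of `e_1 ⊗ ⋯ ⊗ e_N`.  For a matrix of the form
`s • A_N` this is `s`. -/
def diagCoeff {N : ℕ} {B : Type*} (M : Matrix (Fin N → Fin N) (Fin N → Fin N) B) : B := M id id

/-- `qdet T(u)`, the series with `A_N T_1(u) ⋯ T_N(u-N+1) = A_N qdet T(u)`. -/
def qdet (K : Type*) [Field K] (N : ℕ) : (Yangian K N)⟦X⟧ :=
  diagCoeff (antisymmetrizer N N (Yangian K N)⟦X⟧ * tensorProduct K (matT K N))

/-- `sdet S(u)`, the series with `A_N ⟨S_1, …, S_N⟩ = A_N sdet S(u)`. -/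
def sdet (K : Type*) [Field K] (n : ℕ) (κ : FormType) : (TwistedYangian K n κ)⟦X⟧ :=
  diagCoeff (antisymmetrizer (2 * n) (2 * n) (TwistedYangian K n κ)⟦X⟧ *
    bracket K κ (matS K n κ))

/-- `α_q(u)`: `1` in the orthogonal case, `(2u+1)/(2u-q+1)` in the symplectic case, expanded in
`u⁻¹`. -/
def alpha (K : Type*) [Field K] (q : ℕ) : FormType → K⟦X⟧
  | FormType.orthogonal => 1
  | FormType.symplectic =>
      (PowerSeries.C (2 : K) + PowerSeries.X) *
        (PowerSeries.C (2 : K) + PowerSeries.C (1 - (q : K)) * PowerSeries.X)⁻¹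

end Determinants

end

end YangianDet

namespace YangianDet

noncomputable section

/-! ### Substitution in power series over a noncommutative algebra -/

section Evaluation

variable {A : Type*} [Ring A]

/-! At spectral parameters differing by one, R degenerates to 1 - P. The ternary relation, or for
the bracket the quaternary relation together with a Yang–Baxter identity for R', then says that 1 -
P for two neighbouring positions can be moved through T_1⋯T_N or ⟨S_1,…,S_N⟩ (`Intertwines`). Since
A_N(1 - P) = 2A_N and 2 is invertible, multiplying on the left by A_N produces an operator
antisymmetric on the right as well (`mul_flip_of_intertwines`). As dim V = N, an operator
antisymmetric on both sides is a multiple of A_N (`eq_smul_antisymmetrizer`); the multiples are qdet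
and sdet.

The homomorphism exists because T(u)T'(-u) solves both defining relations
(`quaternary_mul_primeNeg`, `symmetry_mul_primeNeg`), all consequences of the ternary relation at
(±u, ±v) and at (u, -u).

For the formula, substitute S = T T'(-u) into the bracket. The ternary relation transposed in one
factor moves every T'_a(-u_a) to the right of every T_b(u_b), so the bracket becomes
(T_1⋯T_N)(∏R'_ab)(T'_1⋯T'_N) (`bracketList_mul`). Then A_N is passed through from left to right. The
first block gives qdet T(u). The middle one gives α_N(u): behind an antisymmetrizer each product ∏_c
R'_ac becomes linear in ∑_c Q_ac, this sum acts by a scalar, and the resulting product telescopes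
(`antisymmetrizer_mul_contractionProd`, `prod_eq_alpha`). The last gives qdet T(-u+N-1): between two
antisymmetrizers the factors may be permuted (`doubleAnti_perm`) and transposed
(`doubleAnti_formTranspose`), and A_N² = N! A_N with N! invertible.

Injectivity is proved without a PBW theorem. Filter the twisted Yangian by giving s_ij^(r) weight r.
Modulo lower weight the generators commute and satisfy a linear symmetry, so every element of weight
at most d has as symbol a polynomial in symmetrized variables, and a zero symbol means lower weight
(`injective_of_symbols`). If the image of an element vanishes, so does its symbol: the Yangian acts
by differential operators through T(u) ↦ ∏(1 + E^(k)u⁻¹) with E_ij = a_i b_j. Translating the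
variables by a large parameter and the derivations by constants, the leading term in the parameter
evaluates the symbol at g(u)g'(-u), where g is a product of matrices 1 + x pᵗ u⁻¹
(`aeval_eq_zero_of_map_eq_zero`). Over an algebraic closure such points approximate every symmetric
series to any order (`exists_mul_primeNeg_eq`), so the symbol is zero. -/

theorem coeff_pow_mul_eq_zero {q : A⟦X⟧} (hq : PowerSeries.constantCoeff q = 0) {r k : ℕ}
    (h : r < k) (g : A⟦X⟧) : PowerSeries.coeff r (q ^ k * g) = 0 := by
  obtain ⟨c, rfl⟩ := PowerSeries.X_dvd_iff.2 hq
  rw [((PowerSeries.commute_X c).symm).mul_pow, mul_assoc, PowerSeries.coeff_X_pow_mul',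
    if_neg (by omega)]

/-- The substitution `v⁻¹ ↦ q` in a series with coefficients in `A⟦u⁻¹⟧`. -/
def evalFun (q : A⟦X⟧) (F : A⟦X⟧⟦X⟧) : A⟦X⟧ :=
  PowerSeries.mk fun r => ∑ k ∈ Finset.range (r + 1),
    PowerSeries.coeff r (q ^ k * PowerSeries.coeff k F)

/-- Powers of q beyond r do not reach the coefficient r, so the truncation may be enlarged at will.
This permits one common truncation for two factors and their product. -/
theorem coeff_evalFun {q : A⟦X⟧} (hq : PowerSeries.constantCoeff q = 0) (F : A⟦X⟧⟦X⟧) {r n : ℕ}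
    (h : r < n) : PowerSeries.coeff r (evalFun q F) =
      PowerSeries.coeff r (∑ k ∈ Finset.range n, q ^ k * PowerSeries.coeff k F) := by
  rw [evalFun, PowerSeries.coeff_mk, map_sum]
  apply Finset.sum_subset
  · intro k hk
    simp only [Finset.mem_range] at hk ⊢
    omega
  · intro k _ hk
    exact coeff_pow_mul_eq_zero hq (by simpa using hk) _

theorem evalFun_mul {q : A⟦X⟧} (hq : PowerSeries.constantCoeff q = 0) (hc : ∀ g, Commute q g)
    (F G : A⟦X⟧⟦X⟧) : evalFun q (F * G) = evalFun q F * evalFun q G := by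
  ext r
  have h1 : PowerSeries.coeff r (evalFun q F * evalFun q G) =
      PowerSeries.coeff r ((∑ k ∈ Finset.range (r + 1), q ^ k * PowerSeries.coeff k F) *
        ∑ k ∈ Finset.range (r + 1), q ^ k * PowerSeries.coeff k G) := by
    rw [PowerSeries.coeff_mul, PowerSeries.coeff_mul]
    refine Finset.sum_congr rfl fun ij hij => ?_
    have : ij.1 + ij.2 = r := by simpa using hij
    rw [coeff_evalFun hq F (n := r + 1) (by omega), coeff_evalFun hq G (n := r + 1) (by omega)]
  rw [h1, coeff_evalFun hq _ (Nat.lt_succ_self r), Finset.sum_mul_sum, ← Finset.sum_product',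
    map_sum, map_sum]
  have h2 : ∀ k l : ℕ, q ^ k * PowerSeries.coeff k F * (q ^ l * PowerSeries.coeff l G) =
      q ^ (k + l) * (PowerSeries.coeff k F * PowerSeries.coeff l G) := by
    intro k l
    rw [pow_add, mul_assoc, ← mul_assoc (PowerSeries.coeff k F), ← ((hc _).pow_left l).eq]
    simp only [mul_assoc]
  simp only [h2, PowerSeries.coeff_mul _ F G, Finset.mul_sum, map_sum]
  rw [Finset.sum_sigma']
  symm
  -- The square of pairs (k, l) is cut along its antidiagonal: below it the terms match the Cauchy
  -- product, above it q^(k+l) has order larger than r.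
  rw [← Finset.sum_filter_add_sum_filter_not _ (fun x : ℕ × ℕ => x.1 + x.2 < r + 1)]
  rw [Finset.sum_eq_zero (s := Finset.filter (fun x : ℕ × ℕ => ¬ x.1 + x.2 < r + 1) _), add_zero]
  · refine Finset.sum_bij' (fun x _ => ⟨x.1 + x.2, x⟩) (fun x _ => x.2) ?_ ?_ ?_ ?_ ?_
    · intro x hx
      simp at hx ⊢
      omega
    · rintro ⟨m, x⟩ hx
      simp at hx ⊢
      omega
    · intro x _
      rfl
    · rintro ⟨m, x⟩ hx
      simp at hx ⊢
      omega
    · intro x _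
      rfl
  · intro x hx
    simp at hx
    exact coeff_pow_mul_eq_zero hq (by omega) _

/-- `evalFun` as a ring homomorphism. -/
def evalHom (q : A⟦X⟧) (hq : PowerSeries.constantCoeff q = 0) (hc : ∀ g, Commute q g) :
    A⟦X⟧⟦X⟧ →+* A⟦X⟧ where
  toFun := evalFun q
  map_one' := by
    ext r
    rw [coeff_evalFun hq _ (Nat.lt_succ_self r), Finset.sum_eq_single 0] <;>
      simp +contextual [PowerSeries.coeff_one]
  map_mul' := evalFun_mul hq hc
  map_zero' := by
    ext r
    simp [evalFun]
  map_add' F G := by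
    ext r
    simp [evalFun, mul_add, Finset.sum_add_distrib]

theorem evalHom_apply (q : A⟦X⟧) (hq : PowerSeries.constantCoeff q = 0) (hc : ∀ g, Commute q g)
    (F : A⟦X⟧⟦X⟧) : evalHom q hq hc F = evalFun q F := rfl

theorem evalHom_inU (q : A⟦X⟧) (hq : PowerSeries.constantCoeff q = 0) (hc : ∀ g, Commute q g)
    (f : A⟦X⟧) : evalHom q hq hc (inU f) = f := by
  ext r
  rw [evalHom_apply, coeff_evalFun hq _ (Nat.lt_succ_self r), Finset.sum_eq_single 0]
  · simp [inU]
  · intro k _ hk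
    simp [inU, PowerSeries.coeff_C, hk]
  · simp

theorem evalHom_X (q : A⟦X⟧) (hq : PowerSeries.constantCoeff q = 0) (hc : ∀ g, Commute q g) :
    evalHom q hq hc PowerSeries.X = q := by
  ext r
  -- The truncation r + 2 keeps the index 1 in range even for r = 0.
  rw [evalHom_apply, coeff_evalFun hq _ (n := r + 2) (by omega), Finset.sum_eq_single 1]
  · simp
  · intro k _ hk
    simp [PowerSeries.coeff_X, hk]
  · simp

end Evaluation

/-! ### Affine changes of the spectral parameter. -/

section Affine

variable {K : Type*} [Field K] {A : Type*} [Ring A] [Algebra K A]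

theorem scalarSeries_commute (f : K⟦X⟧) (g : A⟦X⟧) : Commute (scalarSeries A f) g := by
  ext r
  rw [PowerSeries.coeff_mul, PowerSeries.coeff_mul, ← Finset.Nat.sum_antidiagonal_swap]
  refine Finset.sum_congr rfl fun x _ => ?_
  simp [scalarSeries, Algebra.commutes]

theorem scalarSeries_self (f : K⟦X⟧) : scalarSeries K f = f := by
  ext r
  simp [scalarSeries]

theorem constantCoeff_affineInv (a b : K) : PowerSeries.constantCoeff (affineInv a b) = 0 := by
  simp [affineInv]

theorem affineInv_mul {a : K} (ha : a ≠ 0) (b : K) :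
    (PowerSeries.C a + PowerSeries.C b * PowerSeries.X) * affineInv a b = PowerSeries.X := by
  have h : PowerSeries.constantCoeff (PowerSeries.C a + PowerSeries.C b * PowerSeries.X) ≠ 0 := by
    simpa using ha
  rw [affineInv, mul_left_comm, PowerSeries.mul_inv_cancel _ h, mul_one]

theorem affineInv_one_zero : affineInv (1 : K) 0 = PowerSeries.X := by
  simpa using affineInv_mul (one_ne_zero : (1 : K) ≠ 0) 0

theorem affineInv_neg_one_zero : affineInv (-1 : K) 0 = -PowerSeries.X := by
  have := affineInv_mul (neg_ne_zero.2 one_ne_zero : (-1 : K) ≠ 0) 0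
  simp only [map_neg, map_one, map_zero, zero_mul, add_zero, neg_mul, one_mul] at this
  rw [← this, neg_neg]

/-- The substitution `u ↦ a u + b` as a ring homomorphism. -/
def affineHom (A : Type*) [Ring A] [Algebra K A] (a b : K) : A⟦X⟧ →+* A⟦X⟧ :=
  (evalHom (scalarSeries A (affineInv a b)) (by simp [scalarSeries, affineInv])
    (scalarSeries_commute _)).comp inV

/-- The termwise formula does not exhibit multiplicativity; from here on the substitution is handled
as a ring homomorphism. -/
theorem affineSubst_eq (a b : K) (f : A⟦X⟧) : affineSubst a b f = affineHom A a b f := by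
  ext r
  rw [affineHom, RingHom.comp_apply, evalHom_apply, evalFun, affineSubst, PowerSeries.coeff_mk,
    PowerSeries.coeff_mk]
  refine Finset.sum_congr rfl fun k _ => ?_
  rw [inV, PowerSeries.coeff_map, PowerSeries.coeff_mul_C, scalarSeries, ← map_pow,
    PowerSeries.coeff_map, Algebra.smul_def]

theorem affineHom_X (a b : K) :
    affineHom A a b PowerSeries.X = scalarSeries A (affineInv a b) := by
  simp [affineHom, inV, evalHom_X]

theorem affineHom_C (a b : K) (c : A) : affineHom A a b (PowerSeries.C c) = PowerSeries.C c := by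
  simpa [affineHom, inV, inU] using evalHom_inU (scalarSeries A (affineInv a b))
    (by simp [scalarSeries, affineInv]) (scalarSeries_commute _) (PowerSeries.C c)

theorem coeff_zero_affineHom (a b : K) (f : A⟦X⟧) :
    PowerSeries.coeff 0 (affineHom A a b f) = PowerSeries.coeff 0 f := by
  rw [← affineSubst_eq, affineSubst, PowerSeries.coeff_mk]
  simp

theorem coeff_affineHom_neg (f : A⟦X⟧) (r : ℕ) :
    PowerSeries.coeff r (affineHom A (-1 : K) 0 f) = (-1 : K) ^ r • PowerSeries.coeff r f := by
  rw [← affineSubst_eq, affineSubst, PowerSeries.coeff_mk, affineInv_neg_one_zero]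
  rw [Finset.sum_eq_single r]
  · rw [neg_pow, ← map_one PowerSeries.C, ← map_neg, ← map_pow, PowerSeries.coeff_C_mul,
      PowerSeries.coeff_X_pow_self, mul_one]
  · intro k _ hk
    rw [neg_pow, ← map_one PowerSeries.C, ← map_neg, ← map_pow, PowerSeries.coeff_C_mul,
      PowerSeries.coeff_X_pow, if_neg (Ne.symm hk), mul_zero, zero_smul]
  · simp

theorem affineHom_map {A' : Type*} [Ring A'] [Algebra K A'] (φ : A →ₐ[K] A') (a b : K)
    (f : A⟦X⟧) : affineHom A' a b (PowerSeries.map φ.toRingHom f) =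
      PowerSeries.map φ.toRingHom (affineHom A a b f) := by
  ext r
  simp [← affineSubst_eq, affineSubst]

theorem scalarSeries_eq_map (f : K⟦X⟧) :
    scalarSeries A f = PowerSeries.map (Algebra.ofId K A).toRingHom f := rfl

theorem affineHom_scalarSeries (a b : K) (f : K⟦X⟧) :
    affineHom A a b (scalarSeries A f) = scalarSeries A (affineHom K a b f) := by
  rw [scalarSeries_eq_map, affineHom_map]
  rfl

/-- Both sides become X when multiplied by the same linear polynomial, which is nonzero in the
domain K⟦X⟧ and can be cancelled. -/
theorem affineHom_affineInv {a a' : K} (ha : a ≠ 0) (ha' : a' ≠ 0) (b b' : K) :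
    affineHom K a b (affineInv a' b') = affineInv (a' * a) (a' * b + b') := by
  have h1 := congrArg (affineHom K a b) (affineInv_mul ha' b')
  rw [map_mul, map_add, map_mul, affineHom_C, affineHom_C, affineHom_X, scalarSeries_self] at h1
  have h2 := affineInv_mul ha b
  have h3 := affineInv_mul (mul_ne_zero ha' ha) (a' * b + b')
  have h4 : (PowerSeries.C a + PowerSeries.C b * PowerSeries.X : K⟦X⟧) ≠ 0 := by
    intro h
    rw [h, zero_mul] at h2
    exact PowerSeries.X_ne_zero h2.symm
  have h5 : (PowerSeries.C (a' * a) + PowerSeries.C (a' * b + b') * PowerSeries.X : K⟦X⟧) ≠ 0 := by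
    intro h
    rw [h, zero_mul] at h3
    exact PowerSeries.X_ne_zero h3.symm
  apply mul_left_cancel₀ h5
  rw [h3]
  simp only [map_mul, map_add] at h1 h2 h3 ⊢
  linear_combination (PowerSeries.C a + PowerSeries.C b * PowerSeries.X) * h1 +
    (1 - PowerSeries.C b' * affineHom K a b (affineInv a' b')) * h2

/-- The composition law holds on constants and on X, hence on polynomials; a series differs from a
polynomial by a multiple of X^n, and substitution does not lower the order in X. -/
theorem affineHom_affineHom {a a' : K} (ha : a ≠ 0) (ha' : a' ≠ 0) (b b' : K) (f : A⟦X⟧) :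
    affineHom A a b (affineHom A a' b' f) = affineHom A (a' * a) (a' * b + b') f := by
  have key : ∀ n (f : A⟦X⟧), ∃ p : A⟦X⟧, ∃ g : A⟦X⟧, f = p + PowerSeries.X ^ n * g ∧
      affineHom A a b (affineHom A a' b' p) = affineHom A (a' * a) (a' * b + b') p := by
    intro n
    induction n with
    | zero => exact fun f => ⟨0, f, by simp, by simp⟩
    | succ n ih =>
      intro f
      obtain ⟨p, g, h1, h2⟩ := ih f
      refine ⟨p + PowerSeries.X ^ n * PowerSeries.C (PowerSeries.constantCoeff g),
        PowerSeries.mk fun i => PowerSeries.coeff (i + 1) g, ?_, ?_⟩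
      · rw [h1, add_assoc, pow_succ, mul_assoc, ← mul_add, add_comm (PowerSeries.C _)]
        congr 2
        exact PowerSeries.eq_X_mul_shift_add_const g
      · simp only [map_add, map_mul, map_pow, affineHom_C, affineHom_X, h2,
          affineHom_scalarSeries, affineHom_affineInv ha ha']
  ext r
  obtain ⟨p, g, h1, h2⟩ := key (r + 1) f
  rw [h1]
  simp only [map_add, map_mul, map_pow, affineHom_X, h2, affineHom_scalarSeries,
    affineHom_affineInv ha ha']
  rw [coeff_pow_mul_eq_zero (by simp [scalarSeries, affineInv]) (Nat.lt_succ_self r),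
    coeff_pow_mul_eq_zero (by simp [scalarSeries, affineInv]) (Nat.lt_succ_self r)]

/-- The substitution `u ↦ a u + b`, `v ↦ a' u + b'`. -/
def affineHom₂ (A : Type*) [Ring A] [Algebra K A] (a b a' b' : K) : A⟦X⟧⟦X⟧ →+* A⟦X⟧ :=
  (evalHom (scalarSeries A (affineInv a' b')) (by simp [scalarSeries, affineInv])
    (scalarSeries_commute _)).comp (PowerSeries.map (affineHom A a b))

theorem affineHom₂_inU (a b a' b' : K) (f : A⟦X⟧) :
    affineHom₂ A a b a' b' (inU f) = affineHom A a b f := by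
  rw [affineHom₂, RingHom.comp_apply, inU, PowerSeries.map_C]
  exact evalHom_inU _ _ _ _

theorem map_affineHom_inV (a b : K) (f : A⟦X⟧) :
    PowerSeries.map (affineHom A a b) (inV f) = inV f := by
  ext r : 1
  simp [inV, affineHom_C]

theorem affineHom₂_inV (a b a' b' : K) (f : A⟦X⟧) :
    affineHom₂ A a b a' b' (inV f) = affineHom A a' b' f := by
  rw [affineHom₂, RingHom.comp_apply, map_affineHom_inV]
  rfl

theorem affineHom₂_uInv (a b a' b' : K) :
    affineHom₂ A a b a' b' uInv = scalarSeries A (affineInv a b) := by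
  rw [uInv, affineHom₂_inU, affineHom_X]

theorem affineHom₂_vInv (a b a' b' : K) :
    affineHom₂ A a b a' b' vInv = scalarSeries A (affineInv a' b') := by
  rw [vInv, affineHom₂_inV, affineHom_X]

/-- The substitution `u ↦ a u`, `v ↦ a' v`, for `a = ±1`, `a' = ±1`. -/
def scaleHom (A : Type*) [Ring A] [Algebra K A] (a a' : K) : A⟦X⟧⟦X⟧ →+* A⟦X⟧⟦X⟧ :=
  (affineHom A⟦X⟧ a' 0).comp (PowerSeries.map (affineHom A a 0))

theorem scaleHom_inU (a a' : K) (f : A⟦X⟧) :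
    scaleHom A a a' (inU f) = inU (affineHom A a 0 f) := by
  rw [scaleHom, RingHom.comp_apply, inU, PowerSeries.map_C, affineHom_C]

theorem scaleHom_inV (a a' : K) (f : A⟦X⟧) :
    scaleHom A a a' (inV f) = inV (affineHom A a' 0 f) := by
  rw [scaleHom, RingHom.comp_apply, map_affineHom_inV]
  ext s r
  simp only [← affineSubst_eq, affineSubst, inV, PowerSeries.coeff_mk, PowerSeries.coeff_map,
    map_sum]
  refine Finset.sum_congr rfl fun k _ => ?_
  rw [PowerSeries.coeff_smul]
  simp [PowerSeries.coeff_C]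

theorem affineHom_one_zero (f : A⟦X⟧) : affineHom A (1 : K) 0 f = f := by
  ext r
  rw [← affineSubst_eq, affineSubst, PowerSeries.coeff_mk, affineInv_one_zero,
    Finset.sum_eq_single r]
  · simp
  · intro k _ hk
    rw [PowerSeries.coeff_X_pow, if_neg (Ne.symm hk), zero_smul]
  · simp

theorem affineHom_neg_X : affineHom A (-1 : K) 0 PowerSeries.X = -PowerSeries.X := by
  rw [affineHom_X, affineInv_neg_one_zero, scalarSeries, map_neg, PowerSeries.map_X]

end Affine

end

end YangianDet

namespace YangianDet

noncomputable section

/-! ### Calculus of operators on tensor powers -/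

section TensorCalculus

variable {N m : ℕ} {B : Type*} [Ring B]

/-- The operator permuting the tensor factors by `σ`. -/
def permMat (N : ℕ) {m : ℕ} (B : Type*) [Ring B] (σ : Equiv.Perm (Fin m)) :
    Matrix (Fin m → Fin N) (Fin m → Fin N) B :=
  Matrix.of fun f g => if f = g ∘ σ then 1 else 0

theorem flip_eq_permMat (a b : Fin m) : flip N B a b = permMat N B (Equiv.swap a b) := rfl

theorem permMat_mul_apply (σ : Equiv.Perm (Fin m)) (M : Matrix (Fin m → Fin N) (Fin m → Fin N) B)
    (f g : Fin m → Fin N) : (permMat N B σ * M) f g = M (f ∘ σ.symm) g := by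
  rw [Matrix.mul_apply, Finset.sum_eq_single (f ∘ σ.symm)]
  · simp [permMat, Function.comp_assoc]
  · intro h _ hne
    have : f ≠ h ∘ σ := by
      rintro rfl
      exact hne (by simp [Function.comp_assoc])
    simp [permMat, this]
  · simp

theorem mul_permMat_apply (σ : Equiv.Perm (Fin m)) (M : Matrix (Fin m → Fin N) (Fin m → Fin N) B)
    (f g : Fin m → Fin N) : (M * permMat N B σ) f g = M f (g ∘ σ) := by
  rw [Matrix.mul_apply, Finset.sum_eq_single (g ∘ σ)]
  · simp [permMat]
  · intro h _ hne
    simp [permMat, hne]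
  · simp

/-- Permutations act on index functions by precomposition, whence the reversed order. -/
theorem permMat_mul (σ τ : Equiv.Perm (Fin m)) :
    permMat N B σ * permMat N B τ = permMat N B (τ * σ) := by
  ext f g
  rw [mul_permMat_apply]
  rfl

theorem permMat_one : permMat N B (1 : Equiv.Perm (Fin m)) = 1 := by
  ext f g
  simp [permMat, Matrix.one_apply]

theorem flip_mul_flip (a b : Fin m) : flip N B a b * flip N B a b = 1 := by
  rw [flip_eq_permMat, permMat_mul, Equiv.swap_mul_self, permMat_one]

theorem flip_comm (a b : Fin m) : flip N B a b = flip N B b a := by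
  rw [flip_eq_permMat, flip_eq_permMat, Equiv.swap_comm]

theorem atPos_mul_apply (a : Fin m) (M : Matrix (Fin N) (Fin N) B)
    (X : Matrix (Fin m → Fin N) (Fin m → Fin N) B) (f g : Fin m → Fin N) :
    (atPos a M * X) f g = ∑ k, M (f a) k * X (Function.update f a k) g := by
  rw [Matrix.mul_apply]
  symm
  apply Finset.sum_of_injOn (fun k => Function.update f a k)
  · intro k _ l _ h
    simpa using congrFun h a
  · simp
  · intro h _ hh
    have : ¬ ∀ b, b ≠ a → f b = h b := by
      intro hf
      apply hh
      refine ⟨h a, by simp, ?_⟩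
      funext b
      by_cases hb : b = a
      · subst hb; simp
      · simp [hb, hf b hb]
    simp [atPos, this]
  · intro k _
    have : ∀ b, b ≠ a → f b = Function.update f a k b := by
      intro b hb
      simp [hb]
    simp only [atPos, Matrix.of_apply, if_pos this, Function.update_self]

theorem mul_atPos_apply (a : Fin m) (M : Matrix (Fin N) (Fin N) B)
    (X : Matrix (Fin m → Fin N) (Fin m → Fin N) B) (f g : Fin m → Fin N) :
    (X * atPos a M) f g = ∑ k, X f (Function.update g a k) * M k (g a) := by
  rw [Matrix.mul_apply]
  symm
  apply Finset.sum_of_injOn (fun k => Function.update g a k)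
  · intro k _ l _ h
    simpa using congrFun h a
  · simp
  · intro h _ hh
    have : ¬ ∀ b, b ≠ a → h b = g b := by
      intro hf
      apply hh
      refine ⟨h a, by simp, ?_⟩
      funext b
      by_cases hb : b = a
      · subst hb; simp
      · simp [hb, hf b hb]
    simp [atPos, this]
  · intro k _
    have : ∀ b, b ≠ a → Function.update g a k b = g b := by
      intro b hb
      simp [hb]
    simp only [atPos, Matrix.of_apply, if_pos this, Function.update_self]

theorem atPos_mul (a : Fin m) (M M' : Matrix (Fin N) (Fin N) B) :
    atPos a M * atPos a M' = atPos a (M * M') := by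
  ext f g
  rw [atPos_mul_apply]
  have : ∀ k, (∀ b, b ≠ a → Function.update f a k b = g b) ↔ (∀ b, b ≠ a → f b = g b) := by
    intro k
    refine forall_congr' fun b => forall_congr' fun hb => ?_
    rw [Function.update_of_ne hb]
  simp only [atPos, Matrix.of_apply, this, Function.update_self, Matrix.mul_apply]
  split_ifs <;> simp

theorem atPos_one (a : Fin m) : atPos a (1 : Matrix (Fin N) (Fin N) B) = 1 := by
  ext f g
  simp only [atPos, Matrix.of_apply, Matrix.one_apply, ← ite_and]
  congr 1
  simp only [eq_iff_iff]
  constructor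
  · rintro ⟨h1, h2⟩
    funext b
    by_cases hb : b = a
    · subst hb; exact h2
    · exact h1 b hb
  · rintro rfl
    simp

theorem atPos_sum {ι : Type*} (s : Finset ι) (a : Fin m) (M : ι → Matrix (Fin N) (Fin N) B) :
    atPos a (∑ i ∈ s, M i) = ∑ i ∈ s, atPos a (M i) := by
  ext f g
  simp only [atPos, Matrix.of_apply, Matrix.sum_apply]
  split_ifs <;> simp

theorem atPos_smul {R : Type*} [Semiring R] [Module R B] (a : Fin m) (c : R)
    (M : Matrix (Fin N) (Fin N) B) : atPos a (c • M) = c • atPos a M := by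
  ext f g
  simp only [atPos, Matrix.of_apply, Matrix.smul_apply]
  split_ifs <;> simp

/-- `f` and `g` agree outside of `a` and `b`. -/
def AgreeOff (a b : Fin m) (f g : Fin m → Fin N) : Prop := ∀ c, c ≠ a → c ≠ b → f c = g c

instance (a b : Fin m) (f g : Fin m → Fin N) : Decidable (AgreeOff a b f g) := by
  unfold AgreeOff
  infer_instance

theorem agreeOff_update_left (a b : Fin m) (f g : Fin m → Fin N) (k : Fin N) :
    AgreeOff a b (Function.update f a k) g ↔ AgreeOff a b f g := by
  refine forall_congr' fun c => forall_congr' fun ha => forall_congr' fun hb => ?_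
  rw [Function.update_of_ne ha]

theorem agreeOff_update_left' (a b : Fin m) (f g : Fin m → Fin N) (k : Fin N) :
    AgreeOff a b (Function.update f b k) g ↔ AgreeOff a b f g := by
  refine forall_congr' fun c => forall_congr' fun ha => forall_congr' fun hb => ?_
  rw [Function.update_of_ne hb]

theorem agreeOff_update_right (a b : Fin m) (f g : Fin m → Fin N) (k : Fin N) :
    AgreeOff a b f (Function.update g a k) ↔ AgreeOff a b f g := by
  refine forall_congr' fun c => forall_congr' fun ha => forall_congr' fun hb => ?_
  rw [Function.update_of_ne ha]

theorem agreeOff_update_right' (a b : Fin m) (f g : Fin m → Fin N) (k : Fin N) :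
    AgreeOff a b f (Function.update g b k) ↔ AgreeOff a b f g := by
  refine forall_congr' fun c => forall_congr' fun ha => forall_congr' fun hb => ?_
  rw [Function.update_of_ne hb]

theorem agreeOff_comm (a b : Fin m) (f g : Fin m → Fin N) :
    AgreeOff a b f g ↔ AgreeOff b a f g :=
  forall_congr' fun _ => ⟨fun h x y => h y x, fun h x y => h y x⟩

theorem agreeOff_swap_left (a b : Fin m) (f g : Fin m → Fin N) :
    AgreeOff a b (f ∘ Equiv.swap a b) g ↔ AgreeOff a b f g := by
  refine forall_congr' fun c => forall_congr' fun ha => forall_congr' fun hb => ?_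
  rw [Function.comp_apply, Equiv.swap_apply_of_ne_of_ne ha hb]

theorem agreeOff_swap_right (a b : Fin m) (f g : Fin m → Fin N) :
    AgreeOff a b f (g ∘ Equiv.swap a b) ↔ AgreeOff a b f g := by
  refine forall_congr' fun c => forall_congr' fun ha => forall_congr' fun hb => ?_
  rw [Function.comp_apply, Equiv.swap_apply_of_ne_of_ne ha hb]

theorem eq_iff_agreeOff (a b : Fin m) (f g : Fin m → Fin N) :
    f = g ↔ AgreeOff a b f g ∧ f a = g a ∧ f b = g b := by
  constructor
  · rintro rfl
    exact ⟨fun _ _ _ => rfl, rfl, rfl⟩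
  · rintro ⟨h, ha, hb⟩
    funext c
    by_cases hca : c = a
    · rw [hca, ha]
    by_cases hcb : c = b
    · rw [hcb, hb]
    exact h c hca hcb

theorem atPos_mul_atPos_apply {a b : Fin m} (hab : a ≠ b) (M M' : Matrix (Fin N) (Fin N) B)
    (f g : Fin m → Fin N) : (atPos a M * atPos b M') f g =
      if AgreeOff a b f g then M (f a) (g a) * M' (f b) (g b) else 0 := by
  rw [atPos_mul_apply, Finset.sum_eq_single (g a)]
  · have : (∀ c, c ≠ b → Function.update f a (g a) c = g c) ↔ AgreeOff a b f g := by
      constructor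
      · intro h c hca hcb
        rw [← h c hcb, Function.update_of_ne hca]
      · intro h c hcb
        by_cases hca : c = a
        · subst hca; simp
        · rw [Function.update_of_ne hca, h c hca hcb]
    simp only [atPos, Matrix.of_apply, this, Function.update_of_ne hab.symm]
    split_ifs <;> simp
  · intro k _ hk
    have : ¬ ∀ c, c ≠ b → Function.update f a k c = g c := by
      intro h
      exact hk (by simpa using h a hab)
    simp [atPos, this]
  · simp

/-- Acting on different factors is not enough over a noncommutative ring; the entries have to
commute as well. -/
theorem atPos_commute {a b : Fin m} (hab : a ≠ b) {M M' : Matrix (Fin N) (Fin N) B}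
    (h : ∀ i j k l, Commute (M i j) (M' k l)) : Commute (atPos a M) (atPos b M') := by
  ext f g
  rw [atPos_mul_atPos_apply hab, atPos_mul_atPos_apply hab.symm]
  simp only [agreeOff_comm b a]
  split_ifs
  · exact h _ _ _ _
  · rfl

theorem permMat_mul_atPos (σ : Equiv.Perm (Fin m)) (a : Fin m) (M : Matrix (Fin N) (Fin N) B) :
    permMat N B σ * atPos a M = atPos (σ.symm a) M * permMat N B σ := by
  ext f g
  rw [permMat_mul_apply, mul_permMat_apply]
  simp only [atPos, Matrix.of_apply, Function.comp_apply, Equiv.apply_symm_apply]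
  congr 1
  simp only [eq_iff_iff]
  constructor
  · intro h b hb
    have := h (σ b) (by rintro rfl; simp at hb)
    simpa using this
  · intro h b hb
    have := h (σ.symm b) (by simpa using hb)
    simpa using this

theorem flip_mul_atPos (a b : Fin m) (M : Matrix (Fin N) (Fin N) B) :
    flip N B a b * atPos a M = atPos b M * flip N B a b := by
  rw [flip_eq_permMat, permMat_mul_atPos]
  simp

theorem flip_mul_atPos' (a b : Fin m) (M : Matrix (Fin N) (Fin N) B) :
    flip N B a b * atPos b M = atPos a M * flip N B a b := by
  rw [flip_eq_permMat, permMat_mul_atPos]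
  simp

theorem flip_commute_atPos {a b c : Fin m} (ha : c ≠ a) (hb : c ≠ b)
    (M : Matrix (Fin N) (Fin N) B) : Commute (flip N B a b) (atPos c M) := by
  rw [Commute, SemiconjBy, flip_eq_permMat, permMat_mul_atPos, Equiv.symm_swap,
    Equiv.swap_apply_of_ne_of_ne ha hb]

/-- The operator on two tensor factors, acting on the factors `a` and `b` of a tensor power. -/
def emb (a b : Fin m) (M : Matrix (Fin 2 → Fin N) (Fin 2 → Fin N) B) :
    Matrix (Fin m → Fin N) (Fin m → Fin N) B :=
  Matrix.of fun f g => if AgreeOff a b f g then M ![f a, f b] ![g a, g b] else 0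

/-- Multiplicativity transports identities on V ⊗ V, such as the quaternary relation, to any two
positions of a tensor power. -/
theorem emb_mul {a b : Fin m} (hab : a ≠ b) (M M' : Matrix (Fin 2 → Fin N) (Fin 2 → Fin N) B) :
    emb a b (M * M') = emb a b M * emb a b M' := by
  ext f g
  rw [Matrix.mul_apply]
  by_cases hfg : AgreeOff a b f g
  · simp only [emb, Matrix.of_apply, if_pos hfg, Matrix.mul_apply]
    -- The intermediate indices that contribute agree with f off a and b, so they are parametrized
    -- by their two values there.
    apply Finset.sum_of_injOn
      (fun x : Fin 2 → Fin N => Function.update (Function.update f a (x 0)) b (x 1))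
    · intro x _ y _ h
      have h0 := congrFun h a
      have h1 := congrFun h b
      simp [hab] at h0 h1
      funext i
      fin_cases i
      · exact h0
      · exact h1
    · simp
    · intro h _ hh
      have : ¬ AgreeOff a b f h := by
        intro hf
        apply hh
        refine ⟨![h a, h b], by simp, ?_⟩
        rw [eq_iff_agreeOff a b]
        simp only [agreeOff_update_left, agreeOff_update_left']
        simp [hab, hf]
      simp [this]
    · intro x _
      have hx : ![x 0, x 1] = x := by
        funext i
        fin_cases i <;> rfl
      simp only [agreeOff_update_left, agreeOff_update_left', agreeOff_update_right,
        agreeOff_update_right']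
      have hff : AgreeOff a b f f := fun _ _ _ => rfl
      simp [hab, hx, hff, hfg]
  · simp only [emb, Matrix.of_apply, if_neg hfg]
    symm
    apply Finset.sum_eq_zero
    intro h _
    by_cases h1 : AgreeOff a b f h
    · have : ¬ AgreeOff a b h g := fun h2 => hfg fun c hc hc' => (h1 c hc hc').trans (h2 c hc hc')
      simp [this]
    · simp [h1]

theorem emb_sub (a b : Fin m) (M M' : Matrix (Fin 2 → Fin N) (Fin 2 → Fin N) B) :
    emb a b (M - M') = emb a b M - emb a b M' := by
  ext f g
  simp only [emb, Matrix.of_apply, Matrix.sub_apply]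
  split_ifs <;> simp

theorem emb_smul (a b : Fin m) (c : B) (M : Matrix (Fin 2 → Fin N) (Fin 2 → Fin N) B) :
    emb a b (c • M) = c • emb a b M := by
  ext f g
  simp only [emb, Matrix.of_apply, Matrix.smul_apply]
  split_ifs <;> simp

theorem vec_two_eq (x y : Fin 2 → Fin N) : x = y ↔ x 0 = y 0 ∧ x 1 = y 1 := by
  rw [funext_iff, Fin.forall_fin_two]

theorem emb_one (a b : Fin m) :
    emb a b (1 : Matrix (Fin 2 → Fin N) (Fin 2 → Fin N) B) = 1 := by
  ext f g
  simp only [emb, Matrix.of_apply, Matrix.one_apply, ← ite_and, vec_two_eq, eq_iff_agreeOff a b f g]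
  simp

theorem emb_atPos_zero {a b : Fin m} (hab : a ≠ b) (M : Matrix (Fin N) (Fin N) B) :
    emb a b (atPos 0 M) = atPos a M := by
  have h := atPos_mul_atPos_apply (m := m) hab M 1
  have h' := atPos_mul_atPos_apply (m := 2) zero_ne_one M 1
  rw [atPos_one, mul_one] at h h'
  ext f g
  simp only [emb, Matrix.of_apply, h, h']
  have : AgreeOff 0 1 ![f a, f b] ![g a, g b] := by
    intro c h0 h1
    fin_cases c
    · exact absurd rfl h0
    · exact absurd rfl h1
  simp [this]
  rfl

theorem emb_atPos_one {a b : Fin m} (hab : a ≠ b) (M : Matrix (Fin N) (Fin N) B) :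
    emb a b (atPos 1 M) = atPos b M := by
  have h := atPos_mul_atPos_apply (m := m) hab 1 M
  have h' := atPos_mul_atPos_apply (m := 2) zero_ne_one 1 M
  rw [atPos_one, one_mul] at h h'
  ext f g
  simp only [emb, Matrix.of_apply, h, h']
  have : AgreeOff 0 1 ![f a, f b] ![g a, g b] := by
    intro c h0 h1
    fin_cases c
    · exact absurd rfl h0
    · exact absurd rfl h1
  simp [this]
  rfl

theorem emb_flip (a b : Fin m) : emb a b (flip N B 0 1) = flip N B a b := by
  ext f g
  simp only [emb, flip, Matrix.of_apply, ← ite_and, vec_two_eq,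
    eq_iff_agreeOff a b f (g ∘ Equiv.swap a b), agreeOff_swap_right]
  simp

end TensorCalculus

/-! ### The contraction operators -/

section Contraction

variable {n m : ℕ} {K : Type*} [Field K] {B : Type*} [Ring B] [Algebra K B]

/-- The sign attached to an index by the form: `1` in the orthogonal case. -/
def formSgn (K : Type*) [Field K] {n : ℕ} (κ : FormType) (i : Fin (2 * n)) : K :=
  match κ with
  | FormType.orthogonal => 1
  | FormType.symplectic => idxSign K i

variable (κ : FormType)

theorem formSgn_mul_self (i : Fin (2 * n)) : formSgn K κ i * formSgn K κ i = 1 := by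
  cases κ
  · simp [formSgn]
  · simp only [formSgn, idxSign]
    split_ifs <;> simp

/-- This is Gᵗ = ±G, the source of every sign distinguishing the orthogonal from the symplectic
case. -/
theorem formSgn_rev (i : Fin (2 * n)) :
    formSgn K κ (Fin.rev i) = formSign K κ * formSgn K κ i := by
  cases κ
  · simp [formSgn, formSign]
  · simp only [formSgn, idxSign, formSign, Fin.val_rev]
    have := i.isLt
    split_ifs <;> first | omega | simp

theorem formSign_mul_self : formSign K κ * formSign K κ = 1 := by
  cases κ <;> simp [formSign]

theorem formSgn_rev_mul_rev (i j : Fin (2 * n)) :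
    formSgn K κ (Fin.rev i) * formSgn K κ (Fin.rev j) = formSgn K κ i * formSgn K κ j := by
  rw [formSgn_rev, formSgn_rev]
  linear_combination (formSgn K κ i * formSgn K κ j) * formSign_mul_self (K := K) κ

theorem eq_rev_comm {N : ℕ} (x y : Fin N) : x = Fin.rev y ↔ y = Fin.rev x := by
  rw [eq_comm, Fin.rev_eq_iff]

theorem formMatrix_apply (i j : Fin (2 * n)) :
    formMatrix K n κ i j = if i = Fin.rev j then formSgn K κ i else 0 := by
  cases κ <;> rfl

theorem formMatrix_inv : (formMatrix K n κ)⁻¹ =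
    Matrix.of fun i j => if i = Fin.rev j then formSgn K κ j else 0 := by
  apply Matrix.inv_eq_right_inv
  ext i j
  rw [Matrix.mul_apply, Finset.sum_eq_single (Fin.rev i)]
  · simp only [formMatrix_apply, Matrix.of_apply, Fin.rev_rev, if_true, Matrix.one_apply,
      Fin.rev_inj]
    split_ifs with h
    · rw [h, formSgn_mul_self]
    · simp
  · intro k _ hk
    have : i ≠ Fin.rev k := by
      rintro rfl
      simp at hk
    simp [formMatrix_apply, this]
  · simp

theorem formTranspose_apply (M : Matrix (Fin (2 * n)) (Fin (2 * n)) B) (i j : Fin (2 * n)) :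
    formTranspose K κ M i j =
      (formSgn K κ i * formSgn K κ j) • M (Fin.rev j) (Fin.rev i) := by
  rw [formTranspose, formMatrix_inv, Matrix.mul_apply, Finset.sum_eq_single (Fin.rev j)]
  · rw [Matrix.mul_apply, Finset.sum_eq_single (Fin.rev i)]
    · simp only [Matrix.map_apply, Matrix.of_apply, Fin.rev_rev, if_true, Matrix.transpose_apply,
        formMatrix_apply]
      rw [← formSgn_rev_mul_rev κ i j, Algebra.smul_def, map_mul, mul_assoc, mul_assoc,
        Algebra.commutes (formSgn K κ j.rev)]
    · intro k _ hk
      have : i ≠ Fin.rev k := by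
        rintro rfl
        simp at hk
      simp [this]
    · simp
  · intro k _ hk
    simp [formMatrix_apply, hk]
  · simp

/-- `Q_{ab}`, the operator `P_{ab}` transposed in the factor `a`. -/
def qOp (K : Type*) [Field K] {n : ℕ} (κ : FormType) {m : ℕ} (B : Type*) [Ring B] [Algebra K B]
    (a b : Fin m) : Matrix (Fin m → Fin (2 * n)) (Fin m → Fin (2 * n)) B :=
  Matrix.of fun f g => if AgreeOff a b f g ∧ f a = Fin.rev (f b) ∧ g a = Fin.rev (g b) then
    algebraMap K B (formSgn K κ (f a) * formSgn K κ (g a)) else 0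

/-- Transposition in one factor fixes the identity and turns P into Q, so R'(z) = 1 - Q/z. -/
theorem rMatrixPrime_eq {a b : Fin m} (hab : a ≠ b) (c d : B) :
    rMatrixPrime K n κ c d a b = d • (1 : Matrix _ _ B) - c • qOp K κ B a b := by
  ext f g
  rw [rMatrixPrime, mul_atPos_apply, Finset.sum_eq_single (Fin.rev (g a)), atPos_mul_apply,
    Finset.sum_eq_single (Fin.rev (f a))]
  · simp only [formMatrix_inv, formMatrix_apply, Matrix.map_apply, Matrix.of_apply, Fin.rev_rev,
      if_true, partialTranspose, rMatrix, Matrix.sub_apply, Matrix.smul_apply, Matrix.one_apply,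
      Function.update_self, Function.update_idem, flip, qOp, smul_eq_mul]
    rw [mul_assoc, ← Algebra.commutes (formSgn K κ (g a).rev), ← mul_assoc, ← map_mul,
      formSgn_rev_mul_rev, mul_sub]
    congr 1
    · have : (Function.update f a (g a).rev = Function.update g a (f a).rev) ↔ f = g := by
        constructor
        · intro h
          funext c
          by_cases hc : c = a
          · subst hc
            have := congrFun h c
            simp only [Function.update_self, Fin.rev_inj] at this
            exact this.symm
          · simpa [hc] using congrFun h c
        · rintro rfl
          rfl
      simp only [this]
      split_ifs with h
      · rw [h, formSgn_mul_self, map_one, one_mul]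
      · simp
    · have : (Function.update f a (g a).rev = Function.update g a (f a).rev ∘ Equiv.swap a b) ↔
          AgreeOff a b f g ∧ f a = Fin.rev (f b) ∧ g a = Fin.rev (g b) := by
        rw [eq_iff_agreeOff a b, agreeOff_swap_right, agreeOff_update_left, agreeOff_update_right]
        simp only [Function.update_self, Function.comp_apply, Equiv.swap_apply_left,
          Equiv.swap_apply_right, Function.update_of_ne hab.symm]
        rw [eq_rev_comm (f a), eq_comm (a := (g a).rev), eq_rev_comm (g a), and_comm (a := f b = _)]
      simp only [this]
      split_ifs
      · rw [mul_one, Algebra.commutes]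
      · simp
  · intro k _ hk
    have : f a ≠ Fin.rev k := by
      intro h
      rw [h] at hk
      simp at hk
    simp [formMatrix_inv, this]
  · simp
  · intro k _ hk
    simp [formMatrix_apply, hk]
  · simp

theorem qOp_comm (a b : Fin m) : qOp K (n := n) κ B a b = qOp K κ B b a := by
  ext f g
  simp only [qOp, Matrix.of_apply]
  simp only [agreeOff_comm b a, eq_rev_comm (f b), eq_rev_comm (g b)]
  split_ifs with h1
  · rw [h1.2.1, h1.2.2, formSgn_rev_mul_rev]
  · rfl

/-- Q is a vector times the bilinear form itself, and under the form an operator in one argument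
moves to the other as its adjoint. -/
theorem qOp_mul_atPos_right {a b : Fin m} (hab : a ≠ b) (M : Matrix (Fin (2 * n)) (Fin (2 * n)) B) :
    qOp K κ B a b * atPos b M = qOp K κ B a b * atPos a (formTranspose K κ M) := by
  ext f g
  rw [mul_atPos_apply, mul_atPos_apply, Finset.sum_eq_single (Fin.rev (g a)),
    Finset.sum_eq_single (Fin.rev (g b))]
  · simp only [qOp, Matrix.of_apply, agreeOff_update_right, agreeOff_update_right',
      Function.update_self, Function.update_of_ne hab, Function.update_of_ne hab.symm,
      Fin.rev_rev, and_true]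
    split_ifs
    · rw [formTranspose_apply, Fin.rev_rev, mul_smul_comm, Algebra.smul_def, ← mul_assoc,
        ← map_mul]
      congr 2
      linear_combination (- formSgn K κ (f a) * formSgn K κ (g a)) *
        formSgn_mul_self (K := K) κ (Fin.rev (g b))
    · simp
  · intro k _ hk
    simp [qOp, hk, hab.symm]
  · simp
  · intro k _ hk
    have : g a ≠ Fin.rev k := by
      intro h
      rw [h] at hk
      simp at hk
    simp [qOp, this, hab]
  · simp

theorem flip_mul_qOp (a b : Fin m) :
    flip (2 * n) B a b * qOp K κ B a b = formSign K κ • qOp K κ B a b := by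
  ext f g
  rw [flip_eq_permMat, permMat_mul_apply, Equiv.symm_swap]
  simp only [qOp, Matrix.of_apply, agreeOff_swap_left, Matrix.smul_apply, Function.comp_apply,
    Equiv.swap_apply_left, Equiv.swap_apply_right]
  simp only [eq_rev_comm (f b)]
  split_ifs with h1
  · rw [(eq_rev_comm _ _).1 h1.2.1, formSgn_rev, Algebra.smul_def, ← map_mul, mul_assoc]
  · simp

theorem qOp_mul_flip (a b : Fin m) :
    qOp K κ B a b * flip (2 * n) B a b = formSign K κ • qOp K κ B a b := by
  ext f g
  rw [flip_eq_permMat, mul_permMat_apply]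
  simp only [qOp, Matrix.of_apply, agreeOff_swap_right, Matrix.smul_apply, Function.comp_apply,
    Equiv.swap_apply_left, Equiv.swap_apply_right]
  simp only [eq_rev_comm (g b)]
  split_ifs with h1
  · rw [(eq_rev_comm _ _).1 h1.2.2, formSgn_rev, Algebra.smul_def, ← map_mul]
    congr 1
    ring
  · simp

/-- The matrix unit `E_{kl}` over `B`. -/
abbrev unitMat {N : ℕ} (B : Type*) [Ring B] (k l : Fin N) : Matrix (Fin N) (Fin N) B :=
  Matrix.single k l 1

theorem unitMat_commute {N : ℕ} (k l i j : Fin N) (x : B) : Commute (unitMat B k l i j) x := by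
  simp only [Matrix.single, Matrix.of_apply]
  split_ifs
  · exact Commute.one_left _
  · exact Commute.zero_left _

theorem formTranspose_unitMat_commute (k l i j : Fin (2 * n)) (x : B) :
    Commute (formTranspose K κ (unitMat B k l) i j) x := by
  rw [formTranspose_apply]
  exact (unitMat_commute k l _ _ x).smul_left _

/-- This is P = ∑ E_kl ⊗ E_lk transposed in the first factor. Commutation of Q with distant
operators and its conjugation by permutations are then inherited from `atPos`. -/
theorem qOp_eq_sum {a b : Fin m} (hab : a ≠ b) :
    qOp K (n := n) κ B a b = ∑ k, ∑ l,
      atPos a (formTranspose K κ (unitMat B k l)) * atPos b (unitMat B l k) := by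
  ext f g
  simp only [Matrix.sum_apply, atPos_mul_atPos_apply hab]
  rw [Finset.sum_eq_single (g b), Finset.sum_eq_single (f b)]
  · simp only [formTranspose_apply, Matrix.single, Matrix.of_apply, and_self, if_true, mul_one,
      qOp]
    by_cases h : AgreeOff a b f g
    · have h' : (g b = (g a).rev ∧ f b = (f a).rev) ↔ (f a = (f b).rev ∧ g a = (g b).rev) := by
        rw [eq_comm, Fin.rev_eq_iff, eq_comm (a := f b), Fin.rev_eq_iff, and_comm]
      simp only [h, true_and, if_true, h']
      split_ifs
      · rw [Algebra.smul_def, mul_one]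
      · simp
    · simp [h]
  · intro l _ hl
    simp [Matrix.single, hl]
  · simp
  · intro k _ hk
    simp [Matrix.single, hk]
  · simp

/-- P is invariant under transposing both factors. In this form it can be recognized in the product
of two operators Q sharing a position. -/
theorem flip_eq_sum {a b : Fin m} (hab : a ≠ b) :
    flip (2 * n) B a b = ∑ k, ∑ l, atPos a (formTranspose K κ (unitMat B l k)) *
      atPos b (formTranspose K κ (unitMat B k l)) := by
  ext f g
  simp only [Matrix.sum_apply, atPos_mul_atPos_apply hab]
  rw [Finset.sum_eq_single (Fin.rev (g b)), Finset.sum_eq_single (Fin.rev (f b))]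
  · simp only [formTranspose_apply, Matrix.single, Matrix.of_apply, and_self, if_true,
      flip, Fin.rev_inj, eq_iff_agreeOff a b f (g ∘ Equiv.swap a b), agreeOff_swap_right,
      Function.comp_apply, Equiv.swap_apply_left, Equiv.swap_apply_right]
    by_cases h : AgreeOff a b f g
    · simp only [h, true_and, if_true, and_comm (a := f b = g a), eq_comm (a := g b)]
      split_ifs with h'
      · rw [smul_mul_smul_comm, mul_one, h'.1, h'.2]
        rw [show formSgn K κ (g b) * formSgn K κ (g a) * (formSgn K κ (g a) * formSgn K κ (g b)) = 1
          by linear_combination (formSgn K κ (g b) * formSgn K κ (g b)) *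
            formSgn_mul_self (K := K) κ (g a) + formSgn_mul_self (K := K) κ (g b), one_smul]
      · simp
    · simp [h]
  · intro l _ hl
    simp [formTranspose_apply, Matrix.single, hl]
  · simp
  · intro k _ hk
    simp [formTranspose_apply, Matrix.single, hk]
  · simp

theorem qOp_commute_atPos {a b c : Fin m} (hab : a ≠ b) (hac : c ≠ a) (hbc : c ≠ b)
    (M : Matrix (Fin (2 * n)) (Fin (2 * n)) B) : Commute (qOp K κ B a b) (atPos c M) := by
  rw [qOp_eq_sum κ hab]
  refine Commute.sum_left _ _ _ fun k _ => Commute.sum_left _ _ _ fun l _ => ?_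
  exact (atPos_commute hac.symm fun i j _ _ => formTranspose_unitMat_commute κ k l i j _).mul_left
    (atPos_commute hbc.symm fun i j _ _ => unitMat_commute l k i j _)

theorem qOp_commute_qOp {a b c d : Fin m} (hab : a ≠ b) (hcd : c ≠ d) (hac : c ≠ a) (hbc : c ≠ b)
    (had : d ≠ a) (hbd : d ≠ b) :
    Commute (qOp K (n := n) κ B a b) (qOp K κ B c d) := by
  rw [qOp_eq_sum κ hcd]
  refine Commute.sum_right _ _ _ fun k _ => Commute.sum_right _ _ _ fun l _ => ?_
  exact (qOp_commute_atPos κ hab hac hbc _).mul_right (qOp_commute_atPos κ hab had hbd _)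

theorem permMat_mul_qOp (σ : Equiv.Perm (Fin m)) {a b : Fin m} (hab : a ≠ b) :
    permMat (2 * n) B σ * qOp K κ B a b =
      qOp K κ B (σ.symm a) (σ.symm b) * permMat (2 * n) B σ := by
  rw [qOp_eq_sum κ hab, qOp_eq_sum κ (a := σ.symm a) (b := σ.symm b) (by simpa using hab)]
  simp only [Finset.mul_sum, Finset.sum_mul, ← mul_assoc, permMat_mul_atPos]
  simp only [mul_assoc, permMat_mul_atPos]

/-- Expand Q_bc in matrix units; Q_ac carries the unit in position c over to position a, transposed,
and the sum that remains is P_ab. -/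
theorem qOp_mul_qOp_eq_mul_flip {a b c : Fin m} (hab : a ≠ b) (hac : a ≠ c) (hbc : b ≠ c) :
    qOp K (n := n) κ B a c * qOp K κ B b c = qOp K κ B a c * flip (2 * n) B a b := by
  rw [qOp_eq_sum κ hbc, flip_eq_sum (K := K) κ hab]
  simp only [Finset.mul_sum]
  refine Finset.sum_congr rfl fun k _ => Finset.sum_congr rfl fun l _ => ?_
  rw [(atPos_commute hbc fun i j _ _ => formTranspose_unitMat_commute κ k l i j _).eq, ← mul_assoc,
    ← mul_assoc, qOp_mul_atPos_right κ hac]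

theorem qOp_mul_flip_eq {a b c : Fin m} (hac : a ≠ c) (hbc : b ≠ c) :
    qOp K (n := n) κ B a c * flip (2 * n) B a b = flip (2 * n) B a b * qOp K κ B b c := by
  rw [flip_eq_permMat, permMat_mul_qOp κ _ hbc, Equiv.symm_swap, Equiv.swap_apply_right,
    Equiv.swap_apply_of_ne_of_ne hac.symm hbc.symm]

theorem emb_qOp (a b : Fin m) :
    emb a b (qOp K (n := n) κ B 0 1) = qOp K κ B a b := by
  ext f g
  have : AgreeOff 0 1 ![f a, f b] ![g a, g b] := by
    intro c h0 h1
    fin_cases c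
    · exact absurd rfl h0
    · exact absurd rfl h1
  simp only [emb, qOp, Matrix.of_apply, this, ← ite_and]
  simp

theorem formTranspose_one : formTranspose K κ (1 : Matrix (Fin (2 * n)) (Fin (2 * n)) B) = 1 := by
  ext i j
  rw [formTranspose_apply, Matrix.one_apply, Matrix.one_apply]
  simp only [Fin.rev_inj, eq_comm (a := j)]
  split_ifs with h
  · rw [h, formSgn_mul_self, one_smul]
  · simp

end Contraction

end

end YangianDet

namespace YangianDet

noncomputable section

/-! ### Antisymmetry -/

section Antisymmetry

variable {N m : ℕ} {B : Type*} [Ring B]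

theorem antisymmetrizer_eq : antisymmetrizer N m B =
    ∑ σ : Equiv.Perm (Fin m), ((Equiv.Perm.sign σ : ℤˣ) : ℤ) • permMat N B σ := by
  ext f g
  rw [antisymmetrizer, Matrix.of_apply, Matrix.sum_apply]
  refine Finset.sum_congr rfl fun σ _ => ?_
  simp only [permMat, Matrix.smul_apply, Matrix.of_apply]
  split_ifs <;> simp

/-- `M` is multiplied by `sgn σ` when it is composed with a permutation `σ` on the left. -/
def LeftAnti (M : Matrix (Fin m → Fin N) (Fin m → Fin N) B) : Prop :=
  ∀ σ : Equiv.Perm (Fin m), permMat N B σ * M = ((Equiv.Perm.sign σ : ℤˣ) : ℤ) • M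

/-- `M` is multiplied by `sgn σ` when it is composed with a permutation `σ` on the right. -/
def RightAnti (M : Matrix (Fin m → Fin N) (Fin m → Fin N) B) : Prop :=
  ∀ σ : Equiv.Perm (Fin m), M * permMat N B σ = ((Equiv.Perm.sign σ : ℤˣ) : ℤ) • M

theorem LeftAnti.mul {M : Matrix (Fin m → Fin N) (Fin m → Fin N) B} (h : LeftAnti M)
    (X : Matrix (Fin m → Fin N) (Fin m → Fin N) B) : LeftAnti (M * X) := by
  intro σ
  rw [← mul_assoc, h σ, smul_mul_assoc]

theorem sign_mul_sign (σ : Equiv.Perm (Fin m)) :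
    ((Equiv.Perm.sign σ : ℤˣ) : ℤ) * ((Equiv.Perm.sign σ : ℤˣ) : ℤ) = 1 := by
  rw [← Units.val_mul, Int.units_mul_self, Units.val_one]

theorem leftAnti_antisymmetrizer : LeftAnti (antisymmetrizer N m B) := by
  intro τ
  rw [antisymmetrizer_eq, Finset.mul_sum, Finset.smul_sum]
  refine Finset.sum_bij (fun σ _ => σ * τ) (by simp) (by simp) ?_ ?_
  · intro σ _
    exact ⟨σ * τ⁻¹, by simp, by simp⟩
  · intro σ _
    rw [mul_smul_comm, permMat_mul, smul_smul, Equiv.Perm.sign_mul, Units.val_mul, mul_left_comm,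
      sign_mul_sign, mul_one]

theorem rightAnti_antisymmetrizer : RightAnti (antisymmetrizer N m B) := by
  intro τ
  rw [antisymmetrizer_eq, Finset.sum_mul, Finset.smul_sum]
  refine Finset.sum_bij (fun σ _ => τ * σ) (by simp) (by simp) ?_ ?_
  · intro σ _
    exact ⟨τ⁻¹ * σ, by simp, by simp⟩
  · intro σ _
    rw [smul_mul_assoc, permMat_mul, smul_smul, Equiv.Perm.sign_mul, Units.val_mul, ← mul_assoc,
      sign_mul_sign, one_mul]

theorem RightAnti.mul_flip {M : Matrix (Fin m → Fin N) (Fin m → Fin N) B} (h : RightAnti M)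
    {a b : Fin m} (hab : a ≠ b) : M * flip N B a b = -M := by
  rw [flip_eq_permMat, h, Equiv.Perm.sign_swap hab]
  simp

theorem LeftAnti.flip_mul {M : Matrix (Fin m → Fin N) (Fin m → Fin N) B} (h : LeftAnti M)
    {a b : Fin m} (hab : a ≠ b) : flip N B a b * M = -M := by
  rw [flip_eq_permMat, h, Equiv.Perm.sign_swap hab]
  simp

/-- Induction over permutations along adjacent transpositions. -/
theorem perm_induction_adjacent {p : Equiv.Perm (Fin m) → Prop} (h1 : p 1)
    (hs : ∀ i j : Fin m, (j : ℕ) = i + 1 → p (Equiv.swap i j))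
    (hm : ∀ σ τ, p σ → p τ → p (σ * τ)) (σ : Equiv.Perm (Fin m)) : p σ := by
  cases m with
  | zero => rwa [Subsingleton.elim σ 1]
  | succ k =>
    have hσ : σ ∈ Submonoid.closure
        (Set.range fun i : Fin k => Equiv.swap i.castSucc i.succ) := by
      rw [Equiv.Perm.mclosure_swap_castSucc_succ]
      trivial
    induction hσ using Submonoid.closure_induction with
    | mem x hx =>
      obtain ⟨i, rfl⟩ := hx
      exact hs _ _ (by simp)
    | one => exact h1
    | mul x y _ _ hx hy => exact hm x y hx hy

/-- Adjacent transpositions generate the symmetric group, so only neighbouring spectral parameters,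
which differ by one, have to be compared. -/
theorem rightAnti_of_adjacent {M : Matrix (Fin m → Fin N) (Fin m → Fin N) B}
    (h : ∀ i j : Fin m, (j : ℕ) = i + 1 → M * flip N B i j = -M) : RightAnti M := by
  intro σ
  induction σ using perm_induction_adjacent with
  | h1 => simp [permMat_one]
  | hs i j hij =>
    have hne : i ≠ j := by
      rintro rfl
      omega
    rw [← flip_eq_permMat, h i j hij, Equiv.Perm.sign_swap hne]
    simp
  | hm σ τ hσ hτ =>
    rw [← permMat_mul, ← mul_assoc, hτ, smul_mul_assoc, hσ, smul_smul, Equiv.Perm.sign_mul,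
      Units.val_mul, mul_comm]

theorem LeftAnti.smul {M : Matrix (Fin m → Fin N) (Fin m → Fin N) B} (h : LeftAnti M) (c : B)
    : LeftAnti (c • M) := by
  intro σ
  have h1 := h σ
  ext f g
  have h2 := congrFun (congrFun h1 f) g
  rw [permMat_mul_apply] at h2 ⊢
  simp only [Matrix.smul_apply, smul_eq_mul] at h2 ⊢
  rw [h2, mul_smul_comm]

theorem RightAnti.smul {M : Matrix (Fin m → Fin N) (Fin m → Fin N) B} (h : RightAnti M) (c : B)
    : RightAnti (c • M) := by
  intro σ
  rw [smul_mul_assoc, h σ, smul_comm]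

/-- Exchanging two equal indices leaves the entry unchanged and changes its sign, so twice the entry
is zero. -/
theorem LeftAnti.apply_eq_zero (h2 : ∀ x : B, x + x = 0 → x = 0)
    {M : Matrix (Fin m → Fin N) (Fin m → Fin N) B} (h : LeftAnti M) {f : Fin m → Fin N}
    (hf : ¬ Function.Injective f) (g : Fin m → Fin N) : M f g = 0 := by
  simp only [Function.Injective, not_forall] at hf
  obtain ⟨a, b, hab, hne⟩ := hf
  have h1 := congrFun (congrFun (h.flip_mul hne) f) g
  rw [flip_eq_permMat, permMat_mul_apply, Equiv.symm_swap] at h1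
  have h3 : f ∘ Equiv.swap a b = f := by
    funext c
    rcases eq_or_ne c a with rfl | hca
    · simp [hab]
    rcases eq_or_ne c b with rfl | hcb
    · simp [hab]
    simp [Equiv.swap_apply_of_ne_of_ne hca hcb]
  rw [h3, Matrix.neg_apply] at h1
  apply h2
  nth_rewrite 1 [h1]
  simp

theorem RightAnti.apply_eq_zero (h2 : ∀ x : B, x + x = 0 → x = 0)
    {M : Matrix (Fin m → Fin N) (Fin m → Fin N) B} (h : RightAnti M) (f : Fin m → Fin N)
    {g : Fin m → Fin N} (hg : ¬ Function.Injective g) : M f g = 0 := by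
  simp only [Function.Injective, not_forall] at hg
  obtain ⟨a, b, hab, hne⟩ := hg
  have h1 := congrFun (congrFun (h.mul_flip hne) f) g
  rw [flip_eq_permMat, mul_permMat_apply] at h1
  have h3 : g ∘ Equiv.swap a b = g := by
    funext c
    rcases eq_or_ne c a with rfl | hca
    · simp [hab]
    rcases eq_or_ne c b with rfl | hcb
    · simp [hab]
    simp [Equiv.swap_apply_of_ne_of_ne hca hcb]
  rw [h3, Matrix.neg_apply] at h1
  apply h2
  nth_rewrite 1 [h1]
  simp

theorem antisymmetrizer_apply_id (σ : Equiv.Perm (Fin N)) :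
    antisymmetrizer N N B σ id = ((Equiv.Perm.sign σ : ℤˣ) : ℤ) := by
  rw [antisymmetrizer, Matrix.of_apply, Finset.sum_eq_single σ]
  · simp
  · intro τ _ hτ
    have : (σ : Fin N → Fin N) ≠ id ∘ τ := fun h => hτ (Equiv.ext fun i => (congrFun h i).symm)
    rw [if_neg this]
  · simp

theorem antisymmetrizer_id_id : antisymmetrizer N N B id id = 1 := by
  simpa using antisymmetrizer_apply_id (B := B) (1 : Equiv.Perm (Fin N))

/-- An operator which is antisymmetric on both sides is a multiple of the antisymmetrizer. -/
theorem eq_smul_antisymmetrizer (h2 : ∀ x : B, x + x = 0 → x = 0)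
    {M : Matrix (Fin N → Fin N) (Fin N → Fin N) B} (hl : LeftAnti M) (hr : RightAnti M) :
    M = M id id • antisymmetrizer N N B := by
  -- Here the number of factors equals dim V: injective index functions are permutations, and every
  -- such entry is the (id, id) entry up to two signs.
  have key : ∀ X : Matrix (Fin N → Fin N) (Fin N → Fin N) B, LeftAnti X → RightAnti X →
      ∀ σ τ : Equiv.Perm (Fin N), X σ τ = ((Equiv.Perm.sign σ : ℤˣ) : ℤ) •
        ((Equiv.Perm.sign τ : ℤˣ) : ℤ) • X id id := by
    intro X hl hr σ τ
    have h3 := congrFun (congrFun (hl σ) σ) τ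
    have h4 := congrFun (congrFun (hr τ) id) id
    rw [permMat_mul_apply, Matrix.smul_apply] at h3
    rw [mul_permMat_apply, Matrix.smul_apply] at h4
    have h5 : (σ : Fin N → Fin N) ∘ σ.symm = id := by
      funext i; simp
    rw [h5] at h3
    rw [Function.id_comp] at h4
    rw [← h4, h3, smul_smul, sign_mul_sign, one_smul]
  ext f g
  by_cases hf : Function.Injective f
  · by_cases hg : Function.Injective g
    · have hf' := Equiv.ofBijective f (Finite.injective_iff_bijective.1 hf)
      obtain ⟨σ, rfl⟩ : ∃ σ : Equiv.Perm (Fin N), f = σ :=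
        ⟨Equiv.ofBijective f (Finite.injective_iff_bijective.1 hf), rfl⟩
      obtain ⟨τ, rfl⟩ : ∃ τ : Equiv.Perm (Fin N), g = τ :=
        ⟨Equiv.ofBijective g (Finite.injective_iff_bijective.1 hg), rfl⟩
      rw [key _ hl hr, key _ (leftAnti_antisymmetrizer.smul _) (rightAnti_antisymmetrizer.smul _)]
      rw [Matrix.smul_apply, antisymmetrizer_id_id, smul_eq_mul, mul_one]
    · rw [hr.apply_eq_zero h2 f hg, (rightAnti_antisymmetrizer.smul _).apply_eq_zero h2 f hg]
  · rw [hl.apply_eq_zero h2 hf, (leftAnti_antisymmetrizer.smul _).apply_eq_zero h2 hf]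

theorem antisymmetrizer_mul_self : antisymmetrizer N m B * antisymmetrizer N m B =
    m.factorial • antisymmetrizer N m B := by
  nth_rewrite 1 [antisymmetrizer_eq]
  rw [Finset.sum_mul]
  have : ∀ σ : Equiv.Perm (Fin m), (((Equiv.Perm.sign σ : ℤˣ) : ℤ) • permMat N B σ) *
      antisymmetrizer N m B = antisymmetrizer N m B := by
    intro σ
    rw [smul_mul_assoc, leftAnti_antisymmetrizer, smul_smul, sign_mul_sign, one_smul]
  rw [Finset.sum_congr rfl fun σ _ => this σ, Finset.sum_const, Finset.card_univ,
    Fintype.card_perm, Fintype.card_fin]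

/-- `e x = y e` for some `y`. -/
def Intertwines {R : Type*} [Ring R] (e x : R) : Prop := ∃ y, e * x = y * e

theorem Intertwines.mul {R : Type*} [Ring R] {e x x' : R} (h : Intertwines e x)
    (h' : Intertwines e x') : Intertwines e (x * x') := by
  obtain ⟨y, hy⟩ := h
  obtain ⟨y', hy'⟩ := h'
  exact ⟨y * y', by rw [← mul_assoc, hy, mul_assoc, hy', mul_assoc]⟩

theorem Intertwines.of_commute {R : Type*} [Ring R] {e x : R} (h : Commute e x) :
    Intertwines e x := ⟨x, h⟩

theorem Intertwines.list_prod {R : Type*} [Ring R] {e : R} {l : List R}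
    (h : ∀ x ∈ l, Intertwines e x) : Intertwines e l.prod := by
  induction l with
  | nil => exact .of_commute (Commute.one_right e)
  | cons x l ih =>
    rw [List.prod_cons]
    exact (h x (by simp)).mul (ih fun y hy => h y (by simp [hy]))

/-- From (1 - P)X = Y(1 - P) follows 2AX = A(1 - P)X = AY(1 - P), and (1 - P)P = -(1 - P). Hence
2AXP = -2AX, and 2 is cancelled. -/
theorem mul_flip_of_intertwines (h2 : ∀ x : B, x + x = 0 → x = 0)
    {A X : Matrix (Fin m → Fin N) (Fin m → Fin N) B} (hA : RightAnti A) {a b : Fin m} (hab : a ≠ b)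
    (hX : Intertwines (1 - flip N B a b) X) : A * X * flip N B a b = -(A * X) := by
  obtain ⟨Y, hY⟩ := hX
  have h3 : A * (1 - flip N B a b) = A + A := by
    rw [mul_sub, mul_one, hA.mul_flip hab, sub_neg_eq_add]
  have h4 : (1 - flip N B a b) * flip N B a b = -(1 - flip N B a b) := by
    rw [sub_mul, one_mul, flip_mul_flip, neg_sub]
  have h5 : A * X + A * X = A * Y * (1 - flip N B a b) := by
    rw [← add_mul, ← h3, mul_assoc, hY, mul_assoc]
  have h6 : (A * X * flip N B a b + A * X) + (A * X * flip N B a b + A * X) = 0 := by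
    calc _ = (A * X + A * X) * flip N B a b + (A * X + A * X) := by noncomm_ring
      _ = 0 := by
        rw [h5, mul_assoc, h4]
        noncomm_ring
  rw [← add_eq_zero_iff_eq_neg]
  ext f g
  exact h2 _ (congrFun (congrFun h6 f) g)

theorem finRange_split {i j : Fin m} (hij : (j : ℕ) = i + 1) :
    ∃ l₁ l₂ : List (Fin m), List.finRange m = l₁ ++ i :: j :: l₂ := by
  refine ⟨(List.finRange m).take i, (List.finRange m).drop (j + 1), ?_⟩
  have h1 : (List.finRange m).drop i = i :: (List.finRange m).drop (i + 1) := by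
    rw [List.drop_eq_getElem_cons (by simp)]
    simp
  have h2 : (List.finRange m).drop j = j :: (List.finRange m).drop (j + 1) := by
    rw [List.drop_eq_getElem_cons (by simp)]
    simp
  rw [← h2, hij, ← h1, List.take_append_drop]

/-- `Z₁ ⊗ ⋯ ⊗ Z_m`, the entries being multiplied in this order. -/
def prodPos (Z : Fin m → Matrix (Fin N) (Fin N) B) :
    Matrix (Fin m → Fin N) (Fin m → Fin N) B :=
  ((List.finRange m).map fun a => atPos a (Z a)).prod

theorem list_prod_atPos_apply (Z : Fin m → Matrix (Fin N) (Fin N) B) {l : List (Fin m)}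
    (hl : l.Nodup) (f g : Fin m → Fin N) : (l.map fun a => atPos a (Z a)).prod f g =
      if ∀ a, a ∉ l → f a = g a then (l.map fun a => Z a (f a) (g a)).prod else 0 := by
  induction l generalizing f with
  | nil => simp [Matrix.one_apply, funext_iff]
  | cons a l ih =>
    rw [List.nodup_cons] at hl
    rw [List.map_cons, List.prod_cons, atPos_mul_apply, Finset.sum_eq_single (g a), ih hl.2]
    · have h1 : (∀ b, b ∉ l → Function.update f a (g a) b = g b) ↔
          ∀ b, b ∉ a :: l → f b = g b := by
        refine forall_congr' fun b => ?_
        rcases eq_or_ne b a with rfl | hb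
        · simp
        · simp [hb]
      simp only [h1, List.map_cons, List.prod_cons]
      split_ifs
      · congr 2
        refine List.map_congr_left fun b hb => ?_
        rw [Function.update_of_ne]
        rintro rfl
        exact hl.1 hb
      · simp
    · intro k _ hk
      have : ¬ ∀ b, b ∉ l → Function.update f a k b = g b := by
        intro h
        exact hk (by simpa using h a hl.1)
      rw [ih hl.2, if_neg this, mul_zero]
    · simp

theorem prodPos_apply (Z : Fin m → Matrix (Fin N) (Fin N) B) (f g : Fin m → Fin N) :
    prodPos Z f g = ((List.finRange m).map fun a => Z a (f a) (g a)).prod := by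
  rw [prodPos, list_prod_atPos_apply Z (List.nodup_finRange m), if_pos]
  simp

/-- The entries of the relation
`(d - c P) T₁ T'₂ = T'₂ T₁ (d - c P)`. -/
def RTT (c d : B) (T T' : Matrix (Fin N) (Fin N) B) : Prop :=
  ∀ i j k l, d * (T i j * T' k l - T' k l * T i j) = c * (T k j * T' i l - T' k j * T i l)

/-- With both scalars kept on the left, no centrality is needed; it is needed only to gather them
into an R-matrix. -/
theorem RTT.atPos {c d : B} {T T' : Matrix (Fin N) (Fin N) B} (h : RTT c d T T') {a b : Fin m}
    (hab : a ≠ b) : d • (atPos a T * atPos b T' - atPos b T' * atPos a T) =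
      c • (flip N B a b * (atPos a T * atPos b T') - atPos b T' * atPos a T * flip N B a b) := by
  ext f g
  simp only [Matrix.smul_apply, Matrix.sub_apply, flip_eq_permMat, permMat_mul_apply,
    mul_permMat_apply, atPos_mul_atPos_apply hab, atPos_mul_atPos_apply hab.symm,
    agreeOff_comm b a, Equiv.symm_swap, agreeOff_swap_left, agreeOff_swap_right,
    Function.comp_apply, Equiv.swap_apply_left, Equiv.swap_apply_right, smul_eq_mul]
  split_ifs
  · exact h _ _ _ _
  · simp

/-- Equal scalars correspond to spectral parameters differing by one, where R = 1 - P. -/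
theorem RTT.intertwines {T T' : Matrix (Fin N) (Fin N) B} (h : RTT 1 1 T T') {a b : Fin m}
    (hab : a ≠ b) : Intertwines (1 - flip N B a b) (YangianDet.atPos a T * YangianDet.atPos b T') := by
  refine ⟨YangianDet.atPos b T' * YangianDet.atPos a T, ?_⟩
  have := h.atPos hab
  rw [one_smul, one_smul] at this
  rw [sub_mul, mul_sub, one_mul, mul_one]
  rw [sub_eq_sub_iff_add_eq_add] at this ⊢
  rw [this, add_comm]

/-- P_ij commutes with the factors at other positions, so the intertwining of the block at i, j
extends to the whole product. -/
theorem rightAnti_mul_prodPos (h2 : ∀ x : B, x + x = 0 → x = 0)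
    (Z : Fin m → Matrix (Fin N) (Fin N) B)
    (hZ : ∀ i j : Fin m, (j : ℕ) = i + 1 → RTT 1 1 (Z i) (Z j)) :
    RightAnti (antisymmetrizer N m B * prodPos Z) := by
  refine rightAnti_of_adjacent fun i j hij => ?_
  have hne : i ≠ j := by
    rintro rfl
    omega
  refine mul_flip_of_intertwines h2 rightAnti_antisymmetrizer hne ?_
  obtain ⟨l₁, l₂, hl⟩ := finRange_split hij
  have hnd := List.nodup_finRange m
  rw [prodPos, hl] at *
  simp only [List.map_append, List.map_cons, List.prod_append, List.prod_cons]
  have key : ∀ l : List (Fin m), (∀ a ∈ l, a ≠ i ∧ a ≠ j) →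
      Intertwines (1 - flip N B i j) (l.map fun a => atPos a (Z a)).prod := by
    intro l hl
    refine Intertwines.list_prod fun x hx => ?_
    obtain ⟨a, ha, rfl⟩ := List.mem_map.1 hx
    exact .of_commute ((Commute.one_left _).sub_left
      (flip_commute_atPos (hl a ha).1 (hl a ha).2 _))
  rw [← mul_assoc (atPos i (Z i))]
  refine (key _ ?_).mul (((hZ i j hij).intertwines hne).mul (key _ ?_))
  · intro a ha
    rw [List.nodup_append] at hnd
    exact ⟨hnd.2.2 a ha i (by simp), hnd.2.2 a ha j (by simp)⟩
  · intro a ha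
    have := hnd.of_append_right
    simp only [List.nodup_cons, List.mem_cons, not_or] at this
    exact ⟨by rintro rfl; exact this.1.2 ha, by rintro rfl; exact this.2.1 ha⟩

theorem antisymmetrizer_mul_prodPos (h2 : ∀ x : B, x + x = 0 → x = 0)
    (Z : Fin N → Matrix (Fin N) (Fin N) B)
    (hZ : ∀ i j : Fin N, (j : ℕ) = i + 1 → RTT 1 1 (Z i) (Z j)) :
    antisymmetrizer N N B * prodPos Z =
      diagCoeff (antisymmetrizer N N B * prodPos Z) • antisymmetrizer N N B :=
  eq_smul_antisymmetrizer h2 (leftAnti_antisymmetrizer.mul _) (rightAnti_mul_prodPos h2 Z hZ)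

/-- `A_m (Z₁ ⊗ ⋯ ⊗ Z_m) A_m`. -/
def doubleAnti (Z : Fin m → Matrix (Fin N) (Fin N) B) : Matrix (Fin m → Fin N) (Fin m → Fin N) B :=
  antisymmetrizer N m B * prodPos Z * antisymmetrizer N m B

end Antisymmetry

/-! ### Reordering factors between two antisymmetrizers. -/

section Reordering

variable {N m : ℕ} {K : Type*} [Field K] {B : Type*} [Ring B] [Algebra K B]

/-- Sandwich k(st - ts) = P st - ts P between two copies of A: both flips are absorbed with sign -1,
which leaves (k + 1)(A st A - A ts A) = 0. -/
theorem doubleAnti_swap (Z : Fin m → Matrix (Fin N) (Fin N) B) {i j : Fin m}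
    (hij : (j : ℕ) = i + 1) {k : K} (hk : k + 1 ≠ 0)
    (hZ : RTT 1 (algebraMap K B k) (Z i) (Z j)) :
    doubleAnti Z = doubleAnti (Z ∘ Equiv.swap i j) := by
  have hne : i ≠ j := by
    rintro rfl
    omega
  obtain ⟨l₁, l₂, hl⟩ := finRange_split hij
  have hnd := List.nodup_finRange m
  rw [hl] at hnd
  have hl₁ : ∀ a ∈ l₁, a ≠ i ∧ a ≠ j := by
    intro a ha
    rw [List.nodup_append] at hnd
    exact ⟨hnd.2.2 a ha i (by simp), hnd.2.2 a ha j (by simp)⟩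
  have hl₂ : ∀ a ∈ l₂, a ≠ i ∧ a ≠ j := by
    intro a ha
    have := hnd.of_append_right
    simp only [List.nodup_cons, List.mem_cons, not_or] at this
    exact ⟨by rintro rfl; exact this.1.2 ha, by rintro rfl; exact this.2.1 ha⟩
  have hcomm : ∀ l : List (Fin m), (∀ a ∈ l, a ≠ i ∧ a ≠ j) →
      Commute (flip N B i j) (l.map fun a => atPos a (Z a)).prod := by
    intro l hl
    refine Commute.list_prod_right _ _ fun x hx => ?_
    obtain ⟨a, ha, rfl⟩ := List.mem_map.1 hx
    exact flip_commute_atPos (hl a ha).1 (hl a ha).2 _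
  have hmap : ∀ l : List (Fin m), (∀ a ∈ l, a ≠ i ∧ a ≠ j) →
      (l.map fun a => atPos a ((Z ∘ Equiv.swap i j) a)) = l.map fun a => atPos a (Z a) := by
    intro l hl
    refine List.map_congr_left fun a ha => ?_
    rw [Function.comp_apply, Equiv.swap_apply_of_ne_of_ne (hl a ha).1 (hl a ha).2]
  have hc₁ := hcomm l₁ hl₁
  have hc₂ := hcomm l₂ hl₂
  have hrel := hZ.atPos (m := m) hne
  have hPi := flip_mul_atPos' i j (Z j)
  have hPj := flip_mul_atPos i j (Z i)
  rw [doubleAnti, doubleAnti, prodPos, prodPos, hl]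
  simp only [List.map_append, List.map_cons, List.prod_append, List.prod_cons, hmap l₁ hl₁,
    hmap l₂ hl₂]
  rw [Function.comp_apply, Function.comp_apply, Equiv.swap_apply_left, Equiv.swap_apply_right]
  have hA := (rightAnti_antisymmetrizer (N := N) (B := B)).mul_flip hne
  have hA' := (leftAnti_antisymmetrizer (N := N) (B := B)).flip_mul hne
  generalize (l₁.map fun a => atPos a (Z a)).prod = x at *
  generalize (l₂.map fun a => atPos a (Z a)).prod = y at *
  generalize antisymmetrizer N m B = A at *
  rw [one_smul, algebraMap_smul] at hrel
  generalize flip N B i j = P at *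
  generalize atPos i (Z i) = s at *
  generalize atPos j (Z j) = t at *
  generalize atPos i (Z j) = t' at *
  generalize atPos j (Z i) = s' at *
  have h1 : A * (x * (P * (s * t) * y)) * A = -(A * (x * (s * (t * y))) * A) := by
    have : A * (x * (P * (s * t) * y)) * A = A * P * (x * (s * (t * y))) * A := by
      rw [mul_assoc A P, ← mul_assoc P x, hc₁.eq]
      simp only [mul_assoc]
    rw [this, hA]
    simp only [neg_mul]
  have h2 : A * (x * (t * s * P * y)) * A = -(A * (x * (t * (s * y))) * A) := by
    have : A * (x * (t * s * P * y)) * A = A * (x * (t * (s * y))) * (P * A) := by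
      rw [mul_assoc (t * s), hc₂.eq]
      simp only [mul_assoc]
    rw [this, hA']
    simp only [mul_neg]
  -- Conjugation by P exchanges the positions of the two matrices while keeping their order; the
  -- signs produced at the two copies of A cancel.
  have h3 : A * (x * (t * (s * y))) * A = A * (x * (t' * (s' * y))) * A := by
    have : A * P * (x * (t * (s * y))) * A = A * (x * (t' * (s' * y))) * (P * A) := by
      calc A * P * (x * (t * (s * y))) * A = A * (P * x) * (t * (s * y)) * A := by
            simp only [mul_assoc]
        _ = A * x * ((P * t) * (s * y)) * A := by
            rw [hc₁.eq]
            simp only [mul_assoc]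
        _ = A * x * t' * ((P * s) * y) * A := by
            rw [hPi]
            simp only [mul_assoc]
        _ = A * x * t' * s' * (P * y) * A := by
            rw [hPj]
            simp only [mul_assoc]
        _ = _ := by
            rw [hc₂.eq]
            simp only [mul_assoc]
    rw [hA, hA'] at this
    simpa only [neg_mul, mul_neg, neg_inj] using this
  have h4 := congrArg (fun w => A * (x * (w * y)) * A) hrel
  simp only [smul_mul_assoc, mul_smul_comm, mul_sub, sub_mul, h1, h2] at h4
  simp only [mul_assoc] at h1 h2 h3 h4 ⊢
  rw [← h3]
  have h5 : (k + 1) • (A * (x * (s * (t * (y * A)))) - A * (x * (t * (s * (y * A))))) = 0 := by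
    rw [add_smul, h4, one_smul]
    abel
  rcases smul_eq_zero.1 h5 with h | h
  · exact absurd h hk
  · exact sub_eq_zero.1 h

theorem doubleAnti_perm (h2 : (2 : K) ≠ 0) (Z : Fin m → Matrix (Fin N) (Fin N) B)
    (hZ : ∀ i j, i ≠ j → ∃ k : K, RTT 1 (algebraMap K B k) (Z i) (Z j) ∧
      RTT 1 (algebraMap K B (-k)) (Z j) (Z i)) (σ : Equiv.Perm (Fin m)) :
    doubleAnti (Z ∘ σ) = doubleAnti Z := by
  induction σ using perm_induction_adjacent generalizing Z with
  | h1 => rfl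
  | hs i j hij =>
    have hne : i ≠ j := by
      rintro rfl
      omega
    obtain ⟨k, hk1, hk2⟩ := hZ i j hne
    -- For k = -1 the factor k + 1 is lost, but the relation with the two matrices exchanged has
    -- parameter 1 and the factor 2.
    by_cases hk : k + 1 = 0
    · have h3 := doubleAnti_swap (Z ∘ Equiv.swap i j) hij (k := -k)
        (by rw [eq_neg_of_add_eq_zero_left hk, neg_neg, one_add_one_eq_two]; exact h2)
        (by simpa using hk2)
      rw [h3, Function.comp_assoc, ← Equiv.coe_trans, Equiv.swap_swap, Equiv.coe_refl,
        Function.comp_id]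
    · exact (doubleAnti_swap Z hij hk hk1).symm
  | hm σ τ hσ hτ =>
    rw [Equiv.Perm.coe_mul, ← Function.comp_assoc, hτ (Z ∘ σ) fun i j hij => hZ _ _ (by simpa using hij),
      hσ _ hZ]

end Reordering

/-! ### Transposing factors between two antisymmetrizers. -/

section Transposition

variable {n : ℕ} {K : Type*} [Field K] (κ : FormType) {B : Type*} [Ring B] [Algebra K B]

theorem antisymmetrizer_apply_comm {N m : ℕ} (f g : Fin m → Fin N) :
    antisymmetrizer N m B f g = antisymmetrizer N m B g f := by
  rw [antisymmetrizer, Matrix.of_apply, Matrix.of_apply]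
  refine Finset.sum_bij (fun σ _ => σ⁻¹) (by simp) (by simp) ?_ ?_
  · intro σ _
    exact ⟨σ⁻¹, by simp, by simp⟩
  · intro σ _
    rw [Equiv.Perm.sign_inv]
    congr 1
    simp only [eq_iff_iff]
    constructor
    · rintro rfl
      funext i
      simp
    · rintro rfl
      funext i
      simp

theorem antisymmetrizer_comp_apply {N : ℕ} (ρ : Equiv.Perm (Fin N)) (f : Fin N → Fin N) :
    antisymmetrizer N N B (ρ ∘ f) id =
      ((Equiv.Perm.sign ρ : ℤˣ) : ℤ) • antisymmetrizer N N B f id := by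
  rw [antisymmetrizer, Matrix.of_apply, Matrix.of_apply, Finset.smul_sum]
  symm
  refine Finset.sum_bij (fun σ _ => ρ * σ) (by simp) (by simp) ?_ ?_
  · intro σ _
    exact ⟨ρ⁻¹ * σ, by simp, by simp⟩
  · intro σ _
    have : (ρ ∘ f = id ∘ (ρ * σ : Equiv.Perm (Fin N))) ↔ f = id ∘ σ := by
      rw [Function.id_comp, Function.id_comp, Equiv.Perm.coe_mul]
      exact ρ.injective.comp_left.eq_iff
    simp only [this]
    split_ifs <;> simp [Equiv.Perm.sign_mul]

theorem antisymmetrizer_apply_commute {N m : ℕ} (f g : Fin m → Fin N) (x : B) :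
    Commute (antisymmetrizer N m B f g) x := by
  rw [antisymmetrizer, Matrix.of_apply]
  refine Commute.sum_left _ _ _ fun σ _ => ?_
  split_ifs
  · exact Int.cast_commute _ _
  · exact Commute.zero_left _

theorem list_prod_smul {ι : Type*} (l : List ι) (c : ι → K) (x : ι → B) :
    (l.map fun a => c a • x a).prod = (l.map c).prod • (l.map x).prod := by
  induction l with
  | nil => simp
  | cons a l ih => simp only [List.map_cons, List.prod_cons, ih, smul_mul_smul_comm]

theorem doubleAnti_apply {N m : ℕ} (Z : Fin m → Matrix (Fin N) (Fin N) B) (f g : Fin m → Fin N) :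
    doubleAnti Z f g = ∑ f', ∑ g', antisymmetrizer N m B f f' * antisymmetrizer N m B g' g *
      prodPos Z f' g' := by
  rw [doubleAnti, mul_assoc, Matrix.mul_apply]
  refine Finset.sum_congr rfl fun f' _ => ?_
  rw [Matrix.mul_apply, Finset.mul_sum]
  refine Finset.sum_congr rfl fun g' _ => ?_
  rw [mul_assoc, (antisymmetrizer_apply_commute g' g _).eq]

/-- The entry of A vanishes unless f is a permutation, and then the signs attached to all indices
have a product independent of f. -/
theorem antisymmetrizer_smul_formSgn (f : Fin (2 * n) → Fin (2 * n)) (x : B) :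
    antisymmetrizer (2 * n) (2 * n) B f id *
        (((List.finRange (2 * n)).map fun a => formSgn K κ (f a)).prod • x) =
      ((List.finRange (2 * n)).map fun a => formSgn K κ a).prod •
        (antisymmetrizer (2 * n) (2 * n) B f id * x) := by
  by_cases hf : Function.Injective f
  · obtain ⟨σ, rfl⟩ : ∃ σ : Equiv.Perm (Fin (2 * n)), f = σ :=
      ⟨Equiv.ofBijective f (Finite.injective_iff_bijective.1 hf), rfl⟩
    have : ((List.finRange (2 * n)).map fun a => formSgn K κ (σ a)).prod =
        ((List.finRange (2 * n)).map fun a => formSgn K κ a).prod := by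
      rw [← List.ofFn_eq_map, ← List.ofFn_eq_map, List.prod_ofFn, List.prod_ofFn]
      exact Equiv.prod_comp σ fun a => formSgn K κ a
    rw [this, mul_smul_comm]
  · have : antisymmetrizer (2 * n) (2 * n) B f id = 0 := by
      rw [antisymmetrizer, Matrix.of_apply]
      refine Finset.sum_eq_zero fun σ _ => if_neg ?_
      rintro rfl
      exact hf (by simpa using σ.injective)
    simp [this]

theorem formSgn_prod_mul_self :
    ((List.finRange (2 * n)).map fun a => formSgn K κ a).prod *
      ((List.finRange (2 * n)).map fun a => formSgn K κ a).prod = 1 := by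
  rw [← List.prod_map_mul]
  apply List.prod_eq_one
  intro x hx
  obtain ⟨a, _, rfl⟩ := List.mem_map.1 hx
  exact formSgn_mul_self κ a

/-- In the expansion over row and column indices f, g, transposition exchanges f with g and reverses
all indices, leaving the order of the noncommuting entries alone. The signs of the form and of the
reversal each occur twice and cancel. -/
theorem doubleAnti_formTranspose (Z : Fin (2 * n) → Matrix (Fin (2 * n)) (Fin (2 * n)) B) :
    doubleAnti (fun a => formTranspose K κ (Z a)) id id = doubleAnti Z id id := by
  rw [doubleAnti_apply, doubleAnti_apply]
  have h1 : ∀ f g, antisymmetrizer (2 * n) (2 * n) B id f * antisymmetrizer (2 * n) (2 * n) B g id *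
      prodPos (fun a => formTranspose K κ (Z a)) f g =
      antisymmetrizer (2 * n) (2 * n) B id f * antisymmetrizer (2 * n) (2 * n) B g id *
      prodPos Z (Fin.revPerm ∘ g) (Fin.revPerm ∘ f) := by
    intro f g
    rw [prodPos_apply, prodPos_apply, antisymmetrizer_apply_comm id f]
    simp only [formTranspose_apply, list_prod_smul, List.prod_map_mul]
    rw [mul_assoc, mul_smul, mul_smul_comm, antisymmetrizer_smul_formSgn, mul_assoc,
      ← mul_smul_comm, ← mul_smul_comm]
    rw [mul_smul_comm, antisymmetrizer_smul_formSgn, smul_smul, formSgn_prod_mul_self, one_smul]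
    rfl
  simp only [h1]
  rw [Finset.sum_comm]
  have hrev : ∀ f : Fin (2 * n) → Fin (2 * n),
      (Fin.revPerm : Equiv.Perm (Fin (2 * n))) ∘ (Fin.revPerm : Equiv.Perm (Fin (2 * n))) ∘ f = f := by
    intro f
    funext i
    simp
  have hinv : Function.Involutive fun f : Fin (2 * n) → Fin (2 * n) =>
      (Fin.revPerm : Equiv.Perm (Fin (2 * n))) ∘ f := hrev
  rw [← Equiv.sum_comp hinv.toPerm]
  refine Finset.sum_congr rfl fun f _ => ?_
  rw [← Equiv.sum_comp hinv.toPerm]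
  refine Finset.sum_congr rfl fun g _ => ?_
  simp only [Function.Involutive.coe_toPerm, hrev]
  congr 1
  rw [antisymmetrizer_apply_comm id, antisymmetrizer_comp_apply, antisymmetrizer_comp_apply,
    smul_mul_smul_comm, sign_mul_sign, one_smul, antisymmetrizer_apply_comm id f]
  exact antisymmetrizer_apply_commute _ _ _

end Transposition

end

end YangianDet

namespace YangianDet

noncomputable section

/-! ### The ordered products `⟨S₁, …, S_m⟩` -/

section Bracket

variable {n m : ℕ} {K : Type*} [Field K] (κ : FormType) {B : Type*} [Ring B] [Algebra K B]
  {Z : Type*} [CommRing Z] [Algebra Z B]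

/-- `1 - β Q_{ab}`. -/
def rPrime (K : Type*) [Field K] {n : ℕ} (κ : FormType) {m : ℕ} {B : Type*} [Ring B] [Algebra K B]
    {Z : Type*} [CommRing Z] [Algebra Z B] (β : Fin m → Fin m → Z) (a b : Fin m) :
    Matrix (Fin m → Fin (2 * n)) (Fin m → Fin (2 * n)) B :=
  1 - β a b • qOp K κ B a b

/-- The product `S_a (R'_{ab} R'_{ac} ⋯) S_b (R'_{bc} ⋯) ⋯` over a list `a, b, c, …`. -/
def bracketList (K : Type*) [Field K] {n : ℕ} (κ : FormType) {m : ℕ} {B : Type*} [Ring B]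
    [Algebra K B] {Z : Type*} [CommRing Z] [Algebra Z B]
    (S : Fin m → Matrix (Fin (2 * n)) (Fin (2 * n)) B) (β : Fin m → Fin m → Z) :
    List (Fin m) → Matrix (Fin m → Fin (2 * n)) (Fin m → Fin (2 * n)) B
  | [] => 1
  | a :: l => atPos a (S a) * (l.map (rPrime K κ β a)).prod * bracketList K κ S β l

variable (S : Fin m → Matrix (Fin (2 * n)) (Fin (2 * n)) B) (β : Fin m → Fin m → Z)

theorem rPrime_comm (hβ : ∀ a b, β a b = β b a) (a b : Fin m) :
    rPrime K (n := n) (B := B) κ β a b = rPrime K κ β b a := by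
  rw [rPrime, rPrime, qOp_comm, hβ]

theorem rPrime_commute_of_commute {a b : Fin m}
    {X : Matrix (Fin m → Fin (2 * n)) (Fin m → Fin (2 * n)) B}
    (h : Commute (qOp K κ B a b) X) : Commute (rPrime K κ β a b) X :=
  (Commute.one_left _).sub_left (h.smul_left _)

theorem rPrime_commute_atPos {a b c : Fin m} (hab : a ≠ b) (hac : c ≠ a) (hbc : c ≠ b)
    (M : Matrix (Fin (2 * n)) (Fin (2 * n)) B) : Commute (rPrime K κ β a b) (atPos c M) :=
  rPrime_commute_of_commute κ β (qOp_commute_atPos κ hab hac hbc M)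

theorem rPrime_commute_rPrime {a b c d : Fin m} (hab : a ≠ b) (hcd : c ≠ d) (hac : c ≠ a)
    (hbc : c ≠ b) (had : d ≠ a) (hbd : d ≠ b) :
    Commute (rPrime K (n := n) (B := B) κ β a b) (rPrime K κ β c d) :=
  rPrime_commute_of_commute κ β
    (rPrime_commute_of_commute κ β (qOp_commute_qOp κ hab hcd hac hbc had hbd).symm).symm

theorem rPrime_commute_flip {a b c d : Fin m} (hab : a ≠ b) (hac : c ≠ a)
    (hbc : c ≠ b) (had : d ≠ a) (hbd : d ≠ b) :
    Commute (rPrime K (n := n) (B := B) κ β a b) (flip (2 * n) B c d) := by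
  refine rPrime_commute_of_commute κ β (Commute.symm ?_)
  rw [Commute, SemiconjBy, flip_eq_permMat, permMat_mul_qOp κ _ hab, Equiv.symm_swap,
    Equiv.swap_apply_of_ne_of_ne hac.symm had.symm, Equiv.swap_apply_of_ne_of_ne hbc.symm hbd.symm]

/-- The Yang–Baxter relation, for spectral parameters differing by `1`. -/
theorem intertwines_rPrime_mul_rPrime {a b c : Fin m} (hab : a ≠ b) (hac : a ≠ c) (hbc : b ≠ c)
    (hβ : β a c = β b c + β a c * β b c) :
    Intertwines (1 - flip (2 * n) B a b) (rPrime K κ β a c * rPrime K κ β b c) := by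
  refine ⟨rPrime K κ β b c * rPrime K κ β a c, ?_⟩
  have h1 := qOp_mul_flip_eq (K := K) (B := B) (n := n) κ hac hbc
  have h2 := qOp_mul_flip_eq (K := K) (B := B) (n := n) κ hbc hac
  have h3 := qOp_mul_qOp_eq_mul_flip (K := K) (B := B) (n := n) κ hab hac hbc
  have h4 := qOp_mul_qOp_eq_mul_flip (K := K) (B := B) (n := n) κ hab.symm hbc hac
  have h5 := flip_mul_flip (N := 2 * n) (B := B) a b
  rw [flip_comm b a] at h2 h4
  rw [rPrime, rPrime]
  generalize qOp K κ B a c = Q₁ at *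
  generalize qOp K κ B b c = Q₂ at *
  generalize flip (2 * n) B a b = P at *
  have h6 : P * (Q₁ * Q₂) = Q₂ := by
    rw [h3, ← mul_assoc, ← h2, mul_assoc, h5, mul_one]
  have h7 : Q₂ * (Q₁ * P) = Q₂ := by
    rw [← mul_assoc, h4, mul_assoc, h5, mul_one]
  have h8 : P * (Q₁ * P) = Q₂ := by rw [← h3, h6]
  simp only [sub_mul, mul_sub, one_mul, mul_one, smul_mul_assoc, mul_smul_comm, smul_smul,
    mul_assoc, h8, h5, h6, h7, ← h1, ← h2, h3, h4]
  -- P² = 1, Q₁P = PQ₂, Q₁Q₂ = Q₁P and Q₂Q₁ = Q₂P have reduced every word; what is left is a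
  -- multiple of Q₂P - Q₁P, whose coefficient is zero by `hβ`.
  linear_combination (norm := module) hβ • (Q₂ * P - Q₁ * P)

/-- R'_ib and R'_jc commute for b ≠ c, so the two products interleave into pairs R'_ic R'_jc, each
governed by the Yang–Baxter relation. -/
theorem intertwines_list_rPrime {i j : Fin m} (hij : i ≠ j) {l : List (Fin m)} (hl : l.Nodup)
    (hi : i ∉ l) (hj : j ∉ l)
    (hβ : ∀ c, c ≠ i → c ≠ j → β i c = β j c + β i c * β j c) :
    Intertwines (1 - flip (2 * n) B i j)
      ((l.map (rPrime K κ β i)).prod * (l.map (rPrime K κ β j)).prod) := by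
  induction l with
  | nil => simpa using Intertwines.of_commute (Commute.one_right _)
  | cons b l ih =>
    simp only [List.nodup_cons, List.mem_cons, not_or] at hl hi hj
    have hc : Commute (l.map (rPrime K (n := n) (B := B) κ β i)).prod (rPrime K κ β j b) := by
      refine Commute.list_prod_left _ _ fun x hx => ?_
      obtain ⟨c, hc, rfl⟩ := List.mem_map.1 hx
      exact rPrime_commute_rPrime κ β (by rintro rfl; exact hi.2 hc) hj.1 hij.symm
        (by rintro rfl; exact hj.2 hc) (Ne.symm hi.1) (by rintro rfl; exact hl.1 hc)
    simp only [List.map_cons, List.prod_cons]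
    have : rPrime K κ β i b * (l.map (rPrime K κ β i)).prod *
        (rPrime K κ β j b * (l.map (rPrime K κ β j)).prod) =
        rPrime K κ β i b * rPrime K (n := n) (B := B) κ β j b *
        ((l.map (rPrime K κ β i)).prod * (l.map (rPrime K κ β j)).prod) := by
      rw [mul_assoc, ← mul_assoc _ (rPrime K κ β j b), hc.eq]
      simp only [mul_assoc]
    rw [this]
    exact (intertwines_rPrime_mul_rPrime κ β hij hi.1 hj.1
      (hβ b (Ne.symm hi.1) (Ne.symm hj.1))).mul (ih hl.2 hi.2 hj.2)

theorem intertwines_bracketList_of_forall {i j : Fin m} {l : List (Fin m)}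
    (hl : l.Nodup) (hi : i ∉ l) (hj : j ∉ l) :
    Intertwines (1 - flip (2 * n) B i j) (bracketList K κ S β l) := by
  induction l with
  | nil => exact .of_commute (Commute.one_right _)
  | cons a l ih =>
    simp only [List.nodup_cons, List.mem_cons, not_or] at hl hi hj
    refine ((Intertwines.of_commute ?_).mul (.list_prod fun x hx => ?_)).mul (ih hl.2 hi.2 hj.2)
    · exact (Commute.one_left _).sub_left (flip_commute_atPos (Ne.symm hi.1) (Ne.symm hj.1) _)
    · obtain ⟨c, hc, rfl⟩ := List.mem_map.1 hx
      exact .of_commute ((Commute.one_left _).sub_left (rPrime_commute_flip κ β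
        (by rintro rfl; exact hl.1 hc) hi.1 (by rintro rfl; exact hi.2 hc) hj.1
        (by rintro rfl; exact hj.2 hc)).symm)

/-- Only three kinds of blocks see both i and j: S_i R'_ij S_j, the pairs R'_ic R'_jc behind it, and
the pairs R'_ai R'_aj in front. Everything else commutes with P_ij. -/
theorem intertwines_bracketList {i j : Fin m} (hij : i ≠ j) {l₁ l₂ : List (Fin m)}
    (hl : (l₁ ++ i :: j :: l₂).Nodup) (hβs : ∀ a b, β a b = β b a)
    (hβ : ∀ c, c ≠ i → c ≠ j → β i c = β j c + β i c * β j c)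
    (hS : Intertwines (1 - flip (2 * n) B i j)
      (atPos i (S i) * rPrime K κ β i j * atPos j (S j))) :
    Intertwines (1 - flip (2 * n) B i j) (bracketList K κ S β (l₁ ++ i :: j :: l₂)) := by
  induction l₁ with
  | nil =>
    simp only [List.nil_append, List.nodup_cons, List.mem_cons, not_or] at hl
    simp only [List.nil_append, bracketList, List.map_cons, List.prod_cons]
    have hc : Commute (l₂.map (rPrime K (n := n) (B := B) κ β i)).prod (atPos j (S j)) := by
      refine Commute.list_prod_left _ _ fun x hx => ?_
      obtain ⟨c, hc, rfl⟩ := List.mem_map.1 hx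
      exact rPrime_commute_atPos κ β (by rintro rfl; exact hl.1.2 hc) hij.symm
        (by rintro rfl; exact hl.2.1 hc) _
    have : atPos i (S i) * (rPrime K κ β i j * (l₂.map (rPrime K κ β i)).prod) *
        (atPos j (S j) * (l₂.map (rPrime K κ β j)).prod * bracketList K κ S β l₂) =
        (atPos i (S i) * rPrime K κ β i j * atPos j (S j)) *
        ((l₂.map (rPrime K κ β i)).prod * (l₂.map (rPrime K κ β j)).prod) *
        bracketList K κ S β l₂ := by
      simp only [mul_assoc]
      rw [← mul_assoc _ (atPos j (S j)), hc.eq]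
      simp only [mul_assoc]
    rw [this]
    exact (hS.mul (intertwines_list_rPrime κ β hij hl.2.2 hl.1.2 hl.2.1 hβ)).mul
      (intertwines_bracketList_of_forall κ S β hl.2.2 hl.1.2 hl.2.1)
  | cons a l₁ ih =>
    simp only [List.cons_append, List.nodup_cons] at hl
    rw [List.cons_append, bracketList]
    have hai : i ≠ a := by
      rintro rfl
      exact hl.1 (by simp)
    have haj : j ≠ a := by
      rintro rfl
      exact hl.1 (by simp)
    refine ((Intertwines.of_commute ?_).mul ?_).mul (ih hl.2)
    · exact (Commute.one_left _).sub_left (flip_commute_atPos hai.symm haj.symm _)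
    · simp only [List.map_append, List.map_cons, List.prod_append, List.prod_cons]
      have key : ∀ l : List (Fin m), a ∉ l → i ∉ l → j ∉ l →
          Intertwines (1 - flip (2 * n) B i j) (l.map (rPrime K κ β a)).prod := by
        intro l hal hil hjl
        refine .list_prod fun x hx => ?_
        obtain ⟨c, hc, rfl⟩ := List.mem_map.1 hx
        exact .of_commute ((Commute.one_left _).sub_left (rPrime_commute_flip κ β
          (by rintro rfl; exact hal hc) hai (by rintro rfl; exact hil hc) haj
          (by rintro rfl; exact hjl hc)).symm)
      have hl' := hl.2
      rw [List.nodup_append] at hl'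
      have h2 := hl'.2.1
      simp only [List.nodup_cons, List.mem_cons, not_or] at h2
      simp only [List.mem_append, List.mem_cons, not_or] at hl
      rw [← mul_assoc (rPrime K κ β a i)]
      refine (key l₁ hl.1.1 (fun h => hl'.2.2 i h i (by simp) rfl)
        fun h => hl'.2.2 j h j (by simp) rfl).mul
        (Intertwines.mul ?_ (key l₂ hl.1.2.2.2 h2.1.2 h2.2.1))
      -- Symmetry of R' brings R'_ai R'_aj to the shape covered by the Yang–Baxter relation.
      rw [rPrime_comm κ β hβs a i, rPrime_comm κ β hβs a j]
      exact intertwines_rPrime_mul_rPrime κ β hij hai haj (hβ a hai.symm haj.symm)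

theorem rightAnti_mul_bracketList (h2 : ∀ x : B, x + x = 0 → x = 0)
    (hβs : ∀ a b, β a b = β b a)
    (hβ : ∀ i j : Fin m, (j : ℕ) = i + 1 → ∀ c, c ≠ i → c ≠ j → β i c = β j c + β i c * β j c)
    (hS : ∀ i j : Fin m, (j : ℕ) = i + 1 → Intertwines (1 - flip (2 * n) B i j)
      (atPos i (S i) * rPrime K κ β i j * atPos j (S j))) :
    RightAnti (antisymmetrizer (2 * n) m B * bracketList K κ S β (List.finRange m)) := by
  refine rightAnti_of_adjacent fun i j hij => ?_
  have hne : i ≠ j := by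
    rintro rfl
    omega
  refine mul_flip_of_intertwines h2 rightAnti_antisymmetrizer hne ?_
  obtain ⟨l₁, l₂, hl⟩ := finRange_split hij
  have hnd := List.nodup_finRange m
  rw [hl] at hnd ⊢
  exact intertwines_bracketList κ S β hne hnd hβs (hβ i j hij) (hS i j hij)

/-- T'_a is carried to the right past one T_b after another; the operators R' not involving b
commute with T_b and stay out of the way. -/
theorem atPos_mul_list_rPrime_mul (T T' : Fin m → Matrix (Fin (2 * n)) (Fin (2 * n)) B)
    (hT : ∀ a b : Fin m, a ≠ b → atPos a (T' a) * rPrime K κ β a b * atPos b (T b) =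
      atPos b (T b) * rPrime K κ β a b * atPos a (T' a)) {a : Fin m} {l : List (Fin m)}
    (hl : l.Nodup) (ha : a ∉ l) :
    atPos a (T' a) * (l.map (rPrime K κ β a)).prod * (l.map fun b => atPos b (T b)).prod =
      (l.map fun b => atPos b (T b)).prod * (l.map (rPrime K κ β a)).prod * atPos a (T' a) := by
  induction l with
  | nil => simp
  | cons b l ih =>
    simp only [List.nodup_cons, List.mem_cons, not_or] at hl ha
    have hc₁ : Commute (l.map (rPrime K (n := n) (B := B) κ β a)).prod (atPos b (T b)) := by
      refine Commute.list_prod_left _ _ fun x hx => ?_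
      obtain ⟨c, hc, rfl⟩ := List.mem_map.1 hx
      exact rPrime_commute_atPos κ β (by rintro rfl; exact ha.2 hc) (Ne.symm ha.1)
        (by rintro rfl; exact hl.1 hc) _
    have hc₂ : Commute (rPrime K (n := n) (B := B) κ β a b)
        (l.map fun b => atPos b (T b)).prod := by
      refine Commute.list_prod_right _ _ fun x hx => ?_
      obtain ⟨c, hc, rfl⟩ := List.mem_map.1 hx
      exact rPrime_commute_atPos κ β ha.1 (by rintro rfl; exact ha.2 hc)
        (by rintro rfl; exact hl.1 hc) _
    have ih' := ih hl.2 ha.2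
    have hab := hT a b ha.1
    simp only [List.map_cons, List.prod_cons]
    generalize (l.map (rPrime K (n := n) (B := B) κ β a)).prod = x at *
    generalize (l.map fun b => atPos b (T b)).prod = y at *
    calc atPos a (T' a) * (rPrime K κ β a b * x) * (atPos b (T b) * y)
        = atPos a (T' a) * rPrime K κ β a b * (x * atPos b (T b)) * y := by
          simp only [mul_assoc]
      _ = (atPos a (T' a) * rPrime K κ β a b * atPos b (T b)) * x * y := by
          rw [hc₁.eq]
          simp only [mul_assoc]
      _ = atPos b (T b) * rPrime K κ β a b * (atPos a (T' a) * x * y) := by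
          rw [hab]
          simp only [mul_assoc]
      _ = atPos b (T b) * (rPrime K κ β a b * y) * x * atPos a (T' a) := by
          rw [ih']
          simp only [mul_assoc]
      _ = _ := by
          rw [hc₂.eq]
          simp only [mul_assoc]

theorem bracketList_one_commute_atPos {a : Fin m} {l : List (Fin m)} (hl : l.Nodup) (ha : a ∉ l)
    (M : Matrix (Fin (2 * n)) (Fin (2 * n)) B) :
    Commute (bracketList K (n := n) κ (fun _ => 1) β l) (atPos a M) := by
  induction l with
  | nil => exact Commute.one_left _
  | cons b l ih =>
    simp only [List.nodup_cons, List.mem_cons, not_or] at hl ha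
    rw [bracketList, atPos_one, one_mul]
    refine (Commute.list_prod_left _ _ fun x hx => ?_).mul_left (ih hl.2 ha.2)
    obtain ⟨c, hc, rfl⟩ := List.mem_map.1 hx
    exact rPrime_commute_atPos κ β (by rintro rfl; exact hl.1 hc) ha.1
      (by rintro rfl; exact ha.2 hc) _

/-- After T'_a has passed the later T_b, it still has to pass the scalar bracket of the later
positions, which does not involve a. -/
theorem bracketList_mul (T T' : Fin m → Matrix (Fin (2 * n)) (Fin (2 * n)) B)
    (hT : ∀ a b : Fin m, a ≠ b → atPos a (T' a) * rPrime K κ β a b * atPos b (T b) =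
      atPos b (T b) * rPrime K κ β a b * atPos a (T' a)) {l : List (Fin m)} (hl : l.Nodup) :
    bracketList K κ (fun a => T a * T' a) β l =
      (l.map fun a => atPos a (T a)).prod * bracketList K κ (fun _ => 1) β l *
        (l.map fun a => atPos a (T' a)).prod := by
  induction l with
  | nil => simp [bracketList]
  | cons a l ih =>
    rw [List.nodup_cons] at hl
    have h1 := atPos_mul_list_rPrime_mul κ β T T' hT hl.2 hl.1
    have h2 := bracketList_one_commute_atPos (K := K) (B := B) κ β hl.2 hl.1 (T' a)
    rw [bracketList, bracketList, ih hl.2, ← atPos_mul, atPos_one, one_mul]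
    simp only [List.map_cons, List.prod_cons]
    generalize (l.map (rPrime K (n := n) (B := B) κ β a)).prod = x at *
    generalize (l.map fun b => atPos b (T b)).prod = y at *
    generalize (l.map fun b => atPos b (T' b)).prod = z at *
    generalize bracketList K κ (fun _ => (1 : Matrix (Fin (2 * n)) (Fin (2 * n)) B)) β l = w at *
    calc atPos a (T a) * atPos a (T' a) * x * (y * w * z)
        = atPos a (T a) * (atPos a (T' a) * x * y) * w * z := by simp only [mul_assoc]
      _ = atPos a (T a) * y * x * (atPos a (T' a) * w) * z := by
          rw [h1]
          simp only [mul_assoc]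
      _ = _ := by
          rw [← h2.eq]
          simp only [mul_assoc]

end Bracket

/-! ### The scalar `α_N(u)` -/

section Alpha

variable {n : ℕ} {K : Type*} [Field K] (κ : FormType) {B : Type*} [CommRing B] [Algebra K B]

/-- The derivation induced by X acts on the top exterior power by the trace. The sum commutes with
permutations, so the product is a multiple of A_N, found from one entry. -/
theorem antisymmetrizer_mul_sum_atPos {N : ℕ} (h2 : ∀ x : B, x + x = 0 → x = 0)
    (X : Matrix (Fin N) (Fin N) B) :
    antisymmetrizer N N B * ∑ j, atPos j X = X.trace • antisymmetrizer N N B := by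
  have hr : RightAnti (antisymmetrizer N N B * ∑ j, atPos j X) := by
    intro σ
    have : permMat N B σ * ∑ j, atPos j X = (∑ j, atPos j X) * permMat N B σ := by
      rw [Finset.mul_sum, Finset.sum_mul]
      simp only [permMat_mul_atPos]
      exact Equiv.sum_comp σ.symm fun j => atPos j X * permMat N B σ
    rw [mul_assoc, ← this, ← mul_assoc, rightAnti_antisymmetrizer, smul_mul_assoc]
  rw [eq_smul_antisymmetrizer h2 (leftAnti_antisymmetrizer.mul _) hr]
  congr 1
  rw [Finset.mul_sum, Matrix.sum_apply, Matrix.trace]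
  refine Finset.sum_congr rfl fun j _ => ?_
  rw [mul_atPos_apply, Finset.sum_eq_single j]
  · have : Function.update (id : Fin N → Fin N) j j = id := Function.update_eq_self j id
    rw [this, antisymmetrizer_id_id, one_mul]
    rfl
  · intro k _ hk
    -- Changing the j-th index to k ≠ j repeats the index k, so only diagonal entries of X
    -- contribute.
    rw [rightAnti_antisymmetrizer.apply_eq_zero h2, zero_mul]
    intro h
    exact hk (h (a₁ := k) (a₂ := j) (by simp [hk]))
  · simp

theorem formTranspose_sum {ι : Type*} (s : Finset ι)
    (M : ι → Matrix (Fin (2 * n)) (Fin (2 * n)) B) :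
    formTranspose K κ (∑ i ∈ s, M i) = ∑ i ∈ s, formTranspose K κ (M i) := by
  ext i j
  simp only [formTranspose_apply, Matrix.sum_apply, Finset.smul_sum]

theorem sum_unitMat : ∑ k, unitMat B k k = (1 : Matrix (Fin (2 * n)) (Fin (2 * n)) B) := by
  ext i j
  rw [Matrix.sum_apply, Finset.sum_eq_single i]
  · simp [Matrix.single, Matrix.one_apply]
  · intro k _ hk
    simp [Matrix.single, hk]
  · simp

theorem sum_unitMat_mul_formTranspose :
    ∑ k, ∑ l, unitMat B l k * formTranspose K κ (unitMat B k l) =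
      formSign K κ • (1 : Matrix (Fin (2 * n)) (Fin (2 * n)) B) := by
  ext i j
  simp only [Matrix.sum_apply]
  rw [Finset.sum_eq_single (Fin.rev j), Finset.sum_eq_single i]
  · rw [Matrix.single_mul_apply_same, one_mul, formTranspose_apply, Matrix.smul_apply,
      Matrix.one_apply]
    by_cases h : i = j
    · subst h
      simp [formSgn_rev, Algebra.smul_def, mul_assoc, ← map_mul, formSgn_mul_self]
    · simp [Matrix.single, h]
  · intro l _ hl
    rw [Matrix.single_mul_apply_of_ne]
    exact hl.symm
  · simp
  · intro k _ hk
    refine Finset.sum_eq_zero fun l _ => ?_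
    rcases eq_or_ne l i with rfl | hl
    · rw [Matrix.single_mul_apply_same, one_mul, formTranspose_apply]
      simp [Matrix.single, hk]
    · rw [Matrix.single_mul_apply_of_ne]
      exact hl.symm
  · simp

/-- Expand Q_aj in matrix units and complete the sum to all j. The full sum acts by traces and
leaves ∑ E_kk' = 1; the added term j = a contributes ∑ E_lk E_kl' = ±1. -/
theorem antisymmetrizer_mul_sum_qOp (h2 : ∀ x : B, x + x = 0 → x = 0) (a : Fin (2 * n)) :
    antisymmetrizer (2 * n) (2 * n) B * ∑ j ∈ Finset.univ.erase a, qOp K κ B a j =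
      (1 - formSign K κ) • antisymmetrizer (2 * n) (2 * n) B := by
  have h1 : ∑ j ∈ Finset.univ.erase a, qOp K (n := n) κ B a j = ∑ k, ∑ l,
      ((∑ j, atPos j (unitMat B l k)) * atPos a (formTranspose K κ (unitMat B k l)) -
        atPos a (unitMat B l k * formTranspose K κ (unitMat B k l))) := by
    rw [Finset.sum_congr rfl fun j hj => qOp_eq_sum κ (Finset.ne_of_mem_erase hj).symm,
      Finset.sum_comm]
    refine Finset.sum_congr rfl fun k _ => ?_
    rw [Finset.sum_comm]
    refine Finset.sum_congr rfl fun l _ => ?_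
    rw [← Finset.add_sum_erase _ _ (Finset.mem_univ a), add_mul, atPos_mul, add_sub_cancel_left,
      Finset.sum_mul]
    refine Finset.sum_congr rfl fun j hj => ?_
    exact atPos_commute (Finset.ne_of_mem_erase hj).symm
      fun i i' _ _ => formTranspose_unitMat_commute κ k l i i' _
  have h3 : ∑ k, ∑ l, antisymmetrizer (2 * n) (2 * n) B * (∑ j, atPos j (unitMat B l k)) *
      atPos a (formTranspose K κ (unitMat B k l)) = antisymmetrizer (2 * n) (2 * n) B := by
    have : ∀ k, ∑ l, antisymmetrizer (2 * n) (2 * n) B * (∑ j, atPos j (unitMat B l k)) *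
      atPos a (formTranspose K κ (unitMat B k l)) = antisymmetrizer (2 * n) (2 * n) B *
        atPos a (formTranspose K κ (unitMat B k k)) := by
      intro k
      rw [Finset.sum_eq_single k]
      · rw [antisymmetrizer_mul_sum_atPos h2, Matrix.trace_single_eq_same, one_smul]
      · intro l _ hl
        rw [antisymmetrizer_mul_sum_atPos h2, Matrix.trace_single_eq_of_ne _ _ _ hl, zero_smul,
          zero_mul]
      · simp
    rw [Finset.sum_congr rfl fun k _ => this k, ← Finset.mul_sum, ← atPos_sum,
      ← formTranspose_sum, sum_unitMat, formTranspose_one, atPos_one, mul_one]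
  rw [h1]
  simp only [Finset.mul_sum, mul_sub, Finset.sum_sub_distrib, ← mul_assoc] at h3 ⊢
  rw [h3, sub_smul, one_smul]
  congr 1
  simp only [← Finset.mul_sum, ← atPos_sum]
  rw [sum_unitMat_mul_formTranspose, atPos_smul, atPos_one, mul_smul_comm, mul_one]

/-- Behind an antisymmetric M the product Q_ad Q_ac acts as -Q_ac, so no quadratic terms survive.
The condition `hb` is what makes the coefficient of the new Q_ac equal to the common value b. -/
theorem mul_list_rPrime {m : ℕ} {M : Matrix (Fin m → Fin (2 * n)) (Fin m → Fin (2 * n)) B}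
    (β : Fin m → Fin m → B) (b : B) {a : Fin m} {l : List (Fin m)} (hl : l.Nodup) (ha : a ∉ l)
    (hM : ∀ c ∈ l, ∀ d ∈ l, c ≠ d → M * flip (2 * n) B c d = -M)
    (hb : ∀ l' c l'', l = l' ++ c :: l'' → β a c * (1 + (l'.length : B) * b) = b) :
    M * (l.map (rPrime K κ β a)).prod = M * (1 - b • (l.map (qOp K κ B a)).sum) := by
  induction l using List.reverseRecOn with
  | nil => simp
  | append_singleton l c ih =>
    have hcl : c ∉ l := fun h => by
      rw [List.nodup_append] at hl
      exact hl.2.2 c h c (by simp) rfl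
    have hl' : l.Nodup := hl.of_append_left
    simp only [List.mem_append, List.mem_singleton, not_or] at ha
    rw [List.map_append, List.prod_append, ← mul_assoc, ih hl' ha.1
      (fun c hc d hd => hM c (by simp [hc]) d (by simp [hd]))
      (fun l' d l'' h => hb l' d (l'' ++ [c]) (by rw [h]; simp))]
    have hQ : ∀ l₀ : List (Fin m), (∀ d ∈ l₀, d ∈ l) →
        M * ((l₀.map (qOp K κ B a)).sum * qOp K κ B a c) =
        -((l₀.length : B) • (M * qOp K κ B a c)) := by
      intro l₀ hl₀
      induction l₀ with
      | nil => simp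
      | cons d l₀ ih₀ =>
        have hd := hl₀ d (by simp)
        have hda : d ≠ a := by
          rintro rfl
          exact ha.1 hd
        have hdc : d ≠ c := by
          rintro rfl
          exact hcl hd
        -- Q_da Q_ca = Q_da P_dc = P_dc Q_ca, and M absorbs P_dc with a sign.
        have hQQ : M * (qOp K κ B a d * qOp K κ B a c) = -(M * qOp K κ B a c) := by
          rw [qOp_comm κ a d, qOp_comm κ a c,
            qOp_mul_qOp_eq_mul_flip κ hdc hda (Ne.symm ha.2),
            qOp_mul_flip_eq κ hda (Ne.symm ha.2), ← mul_assoc,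
            hM d (by simp [hd]) c (by simp) hdc, neg_mul]
        rw [List.map_cons, List.sum_cons, add_mul, mul_add, hQQ,
          ih₀ fun d hd => hl₀ d (by simp [hd]), List.length_cons]
        push_cast
        module
    have hb' := hb l c [] rfl
    have h3 := hQ l fun _ h => h
    simp only [List.map_cons, List.map_nil, List.prod_cons, List.prod_nil, mul_one,
      List.map_append, List.sum_append, List.sum_cons, List.sum_nil, add_zero]
    rw [rPrime]
    simp only [mul_sub, sub_mul, mul_one, mul_smul_comm, smul_mul_assoc, mul_assoc, one_mul, h3,
      smul_add, mul_add]
    linear_combination (norm := module) (-hb') • (M * qOp K κ B a c)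

/-- The product of the `1 - b_a ∑ Q_{ac}` over the elements `a` of a list, where `c` runs over
the elements behind `a`. -/
def contractionProd (K : Type*) [Field K] {n : ℕ} (κ : FormType) {m : ℕ} {B : Type*} [CommRing B]
    [Algebra K B] (b : Fin m → B) :
    List (Fin m) → Matrix (Fin m → Fin (2 * n)) (Fin m → Fin (2 * n)) B
  | [] => 1
  | a :: l => (1 - b a • (l.map (qOp K κ B a)).sum) * contractionProd K κ b l

/-- The flip only permutes the summands. Hence antisymmetry in the later positions survives
multiplication by a collapsed factor. -/
theorem list_qOp_sum_commute_flip {m : ℕ} {a c d : Fin m} {l : List (Fin m)} (hl : l.Nodup)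
    (ha : a ∉ l) (hc : c ∈ l) (hd : d ∈ l) :
    Commute (flip (2 * n) B c d) (l.map (qOp K κ B a)).sum := by
  have hac : a ≠ c := by
    rintro rfl
    exact ha hc
  have had : a ≠ d := by
    rintro rfl
    exact ha hd
  have hmem : ∀ x, x ∈ l → Equiv.swap c d x ∈ l := by
    intro x hx
    rw [Equiv.swap_apply_def]
    split_ifs
    · exact hd
    · exact hc
    · exact hx
  have hperm : (l.map (Equiv.swap c d)).Perm l := by
    rw [List.perm_ext_iff_of_nodup (hl.map (Equiv.swap c d).injective) hl]
    intro x
    rw [List.mem_map]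
    constructor
    · rintro ⟨y, hy, rfl⟩
      exact hmem y hy
    · intro hx
      exact ⟨Equiv.swap c d x, hmem x hx, by simp⟩
  have hQ : ∀ x ∈ l, permMat (2 * n) B (Equiv.swap c d) * qOp K κ B a x =
      qOp K κ B a (Equiv.swap c d x) * permMat (2 * n) B (Equiv.swap c d) := by
    intro x hx
    have hax : a ≠ x := by
      rintro rfl
      exact ha hx
    rw [permMat_mul_qOp κ _ hax, Equiv.symm_swap, Equiv.swap_apply_of_ne_of_ne hac had]
  rw [Commute, SemiconjBy, flip_eq_permMat, ← List.sum_map_mul_left, List.map_congr_left hQ,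
    List.sum_map_mul_right (f := fun x => qOp K (n := n) κ B a (Equiv.swap c d x))]
  congr 1
  have h := (hperm.map (qOp K (n := n) κ B a)).sum_eq
  rwa [List.map_map] at h

/-- The groups of R' are collapsed from left to right; each step requires antisymmetry only in the
positions not yet treated. -/
theorem mul_bracketList_one {m : ℕ} (β : Fin m → Fin m → B) (b : Fin m → B) {l : List (Fin m)}
    (hl : l.Nodup) (hb : ∀ l₀ a l' c l'', l = l₀ ++ a :: (l' ++ c :: l'') →
      β a c * (1 + (l'.length : B) * b a) = b a)
    {M : Matrix (Fin m → Fin (2 * n)) (Fin m → Fin (2 * n)) B}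
    (hM : ∀ c ∈ l, ∀ d ∈ l, c ≠ d → M * flip (2 * n) B c d = -M) :
    M * bracketList K κ (fun _ => 1) β l = M * contractionProd K κ b l := by
  induction l generalizing M with
  | nil => rfl
  | cons a l ih =>
    rw [List.nodup_cons] at hl
    rw [bracketList, contractionProd, atPos_one, one_mul, ← mul_assoc,
      mul_list_rPrime κ β (b a) hl.2 hl.1
      (fun c hc d hd => hM c (by simp [hc]) d (by simp [hd]))
      (fun l' c l'' h => hb [] a l' c l'' (by rw [h]; rfl)), ← mul_assoc]
    refine ih hl.2 (fun l₀ a' l' c l'' h => hb (a :: l₀) a' l' c l'' (by rw [h]; rfl)) ?_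
    intro c hc d hd hcd
    have h1 : Commute (flip (2 * n) B c d) (1 - b a • (l.map (qOp K κ B a)).sum) :=
      (Commute.one_right _).sub_right
        ((list_qOp_sum_commute_flip κ hl.2 hl.1 hc hd).smul_right _)
    rw [mul_assoc, ← h1.eq, ← mul_assoc, hM c (by simp [hc]) d (by simp [hd]) hcd, neg_mul]

theorem contractionProd_commute_qOp {m : ℕ} (b : Fin m → B) {i j : Fin m} (hij : i ≠ j)
    {l : List (Fin m)} (hl : l.Nodup) (hi : i ∉ l) (hj : j ∉ l) :
    Commute (qOp K κ B i j) (contractionProd K (n := n) κ b l) := by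
  induction l with
  | nil => exact Commute.one_right _
  | cons a l ih =>
    simp only [List.nodup_cons, List.mem_cons, not_or] at hl hi hj
    refine ((Commute.one_right _).sub_right (Commute.smul_right ?_ _)).mul_right
      (ih hl.2 hi.2 hj.2)
    refine Commute.list_sum_right _ _ fun x hx => ?_
    obtain ⟨c, hc, rfl⟩ := List.mem_map.1 hx
    exact qOp_commute_qOp κ hij (by rintro rfl; exact hl.1 hc) (Ne.symm hi.1) (Ne.symm hj.1)
      (by rintro rfl; exact hi.2 hc) (by rintro rfl; exact hj.2 hc)

/-- The projection onto the line spanned by `e_1 ⊗ ⋯ ⊗ e_N`. -/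
def diagUnit (N : ℕ) (B : Type*) [Ring B] : Matrix (Fin N → Fin N) (Fin N → Fin N) B :=
  Matrix.single id id 1

/-- On e_1 ⊗ ⋯ ⊗ e_N the contraction is nonzero only at two positions carrying opposite indices. -/
theorem qOp_mul_diagUnit {i j : Fin (2 * n)} (h : i ≠ Fin.rev j) :
    qOp K κ B i j * diagUnit (2 * n) B = 0 := by
  ext f g
  rw [diagUnit, Matrix.mul_apply]
  refine Finset.sum_eq_zero fun k _ => ?_
  by_cases hk : k = id
  · subst hk
    simp [qOp, h]
  · simp [Matrix.single, Ne.symm hk]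

/-- The second half of the positions contains no two opposite indices, so its factors act trivially
on e_1 ⊗ ⋯ ⊗ e_N. -/
theorem contractionProd_mul_diagUnit (b : Fin (2 * n) → B) {l : List (Fin (2 * n))}
    (hl : ∀ a ∈ l, n ≤ (a : ℕ)) :
    contractionProd K κ b l * diagUnit (2 * n) B = diagUnit (2 * n) B := by
  induction l with
  | nil => exact one_mul _
  | cons a l ih =>
    rw [contractionProd, mul_assoc, ih fun c hc => hl c (by simp [hc]), sub_mul, one_mul,
      smul_mul_assoc]
    have : (l.map (qOp K κ B a)).sum * diagUnit (2 * n) B = 0 := by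
      rw [← List.sum_map_mul_right]
      apply List.sum_eq_zero
      intro x hx
      obtain ⟨c, hc, rfl⟩ := List.mem_map.1 hx
      apply qOp_mul_diagUnit
      intro h
      have h1 := congrArg Fin.val h
      rw [Fin.val_rev] at h1
      have := hl a (by simp)
      have := hl c (by simp [hc])
      have := c.isLt
      omega
    rw [this, smul_zero, sub_zero]

/-- Descending induction from k = n. For a position a < n the sum over later positions may be
completed to all j ≠ a, since the added terms vanish on e_1 ⊗ ⋯ ⊗ e_N; behind A_N the completed sum
is a scalar. -/
theorem antisymmetrizer_mul_contractionProd (h2 : ∀ x : B, x + x = 0 → x = 0)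
    (b : ℕ → B) {k : ℕ} (hk : k ≤ n) :
    antisymmetrizer (2 * n) (2 * n) B *
        (contractionProd K κ (fun a => b a) ((List.finRange (2 * n)).drop k) *
          diagUnit (2 * n) B) =
      (∏ a ∈ Finset.Ico k n, (1 - (1 - formSign K κ) • b a)) •
        (antisymmetrizer (2 * n) (2 * n) B * diagUnit (2 * n) B) := by
  induction hk using Nat.decreasingInduction with
  | self =>
    rw [contractionProd_mul_diagUnit, Finset.Ico_self, Finset.prod_empty, one_smul]
    intro a ha
    obtain ⟨i, hi, rfl⟩ := List.mem_iff_getElem.1 ha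
    simp
  | of_succ k hk ih =>
    have hk2 : k < 2 * n := by omega
    have h1 : (List.finRange (2 * n)).drop k = ⟨k, hk2⟩ :: (List.finRange (2 * n)).drop (k + 1) := by
      rw [List.drop_eq_getElem_cons (by simpa using hk2)]
      simp
    have hmem : ∀ x : Fin (2 * n), x ∈ (List.finRange (2 * n)).drop (k + 1) ↔ k < (x : ℕ) := by
      intro x
      rw [List.mem_drop_iff_getElem]
      constructor
      · rintro ⟨i, hi, rfl⟩
        simp
        omega
      · intro hx
        refine ⟨x - (k + 1), ?_, ?_⟩
        · simp
          omega
        · ext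
          simp
          omega
    have hnd : ((List.finRange (2 * n)).drop (k + 1)).Nodup :=
      (List.nodup_finRange _).sublist (List.drop_sublist _ _)
    generalize (List.finRange (2 * n)).drop (k + 1) = l at *
    set a : Fin (2 * n) := ⟨k, hk2⟩ with ha
    have hsum : (l.map (qOp K (n := n) κ B a)).sum =
        ∑ j ∈ Finset.univ.erase a, qOp K (n := n) κ B a j -
        ∑ j ∈ Finset.univ.filter (fun j : Fin (2 * n) => (j : ℕ) < k), qOp K (n := n) κ B a j := by
      rw [eq_sub_iff_add_eq, ← List.sum_toFinset _ hnd, ← Finset.sum_union]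
      · congr 1
        ext x
        simp only [Finset.mem_union, List.mem_toFinset, hmem, Finset.mem_filter, Finset.mem_univ,
          true_and, Finset.mem_erase, and_true, ne_eq, Fin.ext_iff, ha]
        omega
      · rw [Finset.disjoint_left]
        intro x hx
        simp only [List.mem_toFinset, hmem, Finset.mem_filter, Finset.mem_univ,
          true_and] at hx ⊢
        omega
    -- For j < a the operator Q_aj commutes with the remaining factors, which involve later
    -- positions only, and reaches e_1 ⊗ ⋯ ⊗ e_N. Both a and j lie in the first half, so it gives
    -- zero there.
    have hzero : (∑ j ∈ Finset.univ.filter (fun j : Fin (2 * n) => (j : ℕ) < k), qOp K κ B a j) *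
        (contractionProd K κ (fun a => b a) l * diagUnit (2 * n) B) = 0 := by
      rw [Finset.sum_mul]
      refine Finset.sum_eq_zero fun j hj => ?_
      simp only [Finset.mem_filter, Finset.mem_univ, true_and] at hj
      have hja : a ≠ j := by
        rw [Ne, Fin.ext_iff, ha]
        simp
        omega
      rw [← mul_assoc, (contractionProd_commute_qOp κ _ hja hnd (by simp [hmem, ha])
        (by simp [hmem]; omega)).eq, mul_assoc, qOp_mul_diagUnit, mul_zero]
      intro h
      have h3 := congrArg Fin.val h
      rw [Fin.val_rev, ha] at h3
      simp at h3
      omega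
    rw [h1, contractionProd, mul_assoc, sub_mul, one_mul, smul_mul_assoc, hsum, sub_mul, hzero,
      sub_zero, mul_sub, mul_smul_comm, ← mul_assoc _ (∑ j ∈ Finset.univ.erase a, _),
      antisymmetrizer_mul_sum_qOp κ h2, smul_mul_assoc, ih, Finset.prod_eq_prod_Ico_succ_bot hk,
      mul_smul]
    simp only [ha]
    generalize (∏ a ∈ Finset.Ico (k + 1) n, (1 - (1 - formSign K κ) • b a)) •
        (antisymmetrizer (2 * n) (2 * n) B * diagUnit (2 * n) B) = w
    rw [sub_smul 1 ((1 - formSign K κ) • b k), one_smul, smul_assoc, smul_comm (1 - formSign K κ)]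

theorem diagCoeff_antisymmetrizer_mul_bracketList (h2 : ∀ x : B, x + x = 0 → x = 0)
    (β : Fin (2 * n) → Fin (2 * n) → B) (b : ℕ → B)
    (hb : ∀ a c : Fin (2 * n), a < c → β a c * (1 + ((c - a - 1 : ℕ) : B) * b a) = b a) :
    diagCoeff (antisymmetrizer (2 * n) (2 * n) B *
      bracketList K κ (fun _ => 1) β (List.finRange (2 * n))) =
      ∏ a ∈ Finset.range n, (1 - (1 - formSign K κ) • b a) := by
  rw [mul_bracketList_one κ β (fun a => b a) (List.nodup_finRange _)]
  · have h1 := congrFun (congrFun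
      (antisymmetrizer_mul_contractionProd (K := K) κ h2 b (Nat.zero_le n)) id) id
    have h3 : ∀ M : Matrix (Fin (2 * n) → Fin (2 * n)) (Fin (2 * n) → Fin (2 * n)) B,
        (M * diagUnit (2 * n) B) id id = M id id := by
      intro M
      rw [diagUnit, Matrix.mul_single_apply_same, mul_one]
    rw [← mul_assoc, h3, Matrix.smul_apply, h3, antisymmetrizer_id_id, List.drop_zero] at h1
    rw [diagCoeff, h1, Nat.Ico_zero_eq_range]
    simp
  · intro l₀ a l' c l'' h
    have ha : (l₀.length : ℕ) = a := by
      have h1 : (List.finRange (2 * n))[l₀.length]? = some a := by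
        rw [h]
        simp
      obtain ⟨h1, h3⟩ := List.getElem?_eq_some_iff.1 h1
      rw [← h3]
      simp
    have hc : (l₀.length + (1 + l'.length) : ℕ) = c := by
      have h4 : l₀ ++ a :: (l' ++ c :: l'') = (l₀ ++ a :: l') ++ c :: l'' := by simp
      have h1 : (List.finRange (2 * n))[l₀.length + (1 + l'.length)]? = some c := by
        rw [h, h4, List.getElem?_append_right (by simp)]
        have h5 : l₀.length + (1 + l'.length) - (l₀ ++ a :: l').length = 0 := by
          simp
          omega
        rw [h5]
        simp
      obtain ⟨h1, h3⟩ := List.getElem?_eq_some_iff.1 h1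
      rw [← h3]
      simp
    have hlen : l'.length = c - a - 1 := by omega
    rw [hlen]
    exact hb a c (Fin.lt_def.2 (by omega))
  · intro c _ d _ hcd
    exact rightAnti_antisymmetrizer.mul_flip hcd

end Alpha

end

end YangianDet

namespace YangianDet

noncomputable section

/-! ### The ternary and the quaternary relation over an arbitrary ring -/

section RingMaps

variable {N m n : ℕ} {K : Type*} [Field K] (κ : FormType) {B B' : Type*} [Ring B] [Ring B']
  (φ : B →+* B')

theorem map_atPos (a : Fin m) (M : Matrix (Fin N) (Fin N) B) :
    (atPos a M).map φ = atPos a (M.map φ) := by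
  ext f g
  simp only [atPos, Matrix.map_apply, Matrix.of_apply]
  split_ifs <;> simp

theorem map_flip (a b : Fin m) : (flip N B a b).map φ = flip N B' a b := by
  ext f g
  simp only [flip, Matrix.map_apply, Matrix.of_apply]
  split_ifs <;> simp

theorem map_antisymmetrizer : (antisymmetrizer N m B).map φ = antisymmetrizer N m B' := by
  ext f g
  simp only [antisymmetrizer, Matrix.map_apply, Matrix.of_apply, map_sum]
  refine Finset.sum_congr rfl fun σ _ => ?_
  split_ifs <;> simp

theorem map_one_tensor : (1 : Matrix (Fin m → Fin N) (Fin m → Fin N) B).map φ = 1 :=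
  Matrix.map_one φ (map_zero φ) (map_one φ)

theorem map_smul_tensor {ι : Type*} (c : B) (M : Matrix ι ι B) : (c • M).map φ = φ c • M.map φ := by
  ext f g
  simp

theorem map_sub_tensor {ι : Type*} (M M' : Matrix ι ι B) : (M - M').map φ = M.map φ - M'.map φ := by
  ext f g
  simp

theorem map_rMatrix (c d : B) (a b : Fin m) :
    (rMatrix N c d a b).map φ = rMatrix N (φ c) (φ d) a b := by
  rw [rMatrix, rMatrix, map_sub_tensor, map_smul_tensor, map_smul_tensor, map_one_tensor, map_flip]

theorem RTT.map {c d : B} {T T' : Matrix (Fin N) (Fin N) B} (h : RTT c d T T') :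
    RTT (φ c) (φ d) (T.map φ) (T'.map φ) := by
  intro i j k l
  simpa using congrArg φ (h i j k l)

variable [Algebra K B] [Algebra K B'] {φ}

theorem map_qOp (hφ : ∀ c, φ (algebraMap K B c) = algebraMap K B' c) (a b : Fin m) :
    (qOp K (n := n) κ B a b).map φ = qOp K κ B' a b := by
  ext f g
  simp only [qOp, Matrix.map_apply, Matrix.of_apply]
  split_ifs
  · rw [hφ]
  · simp

theorem map_formTranspose (hφ : ∀ c, φ (algebraMap K B c) = algebraMap K B' c)
    (M : Matrix (Fin (2 * n)) (Fin (2 * n)) B) :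
    (formTranspose K κ M).map φ = formTranspose K κ (M.map φ) := by
  ext i j
  simp only [Matrix.map_apply, formTranspose_apply]
  rw [Algebra.smul_def, map_mul, hφ, ← Algebra.smul_def]

end RingMaps

/-! ### Operator forms of the ternary and quaternary relations. -/

section Relations

variable {N m n : ℕ} {K : Type*} [Field K] (κ : FormType) {B : Type*} [Ring B]

theorem mul_smul_of_central {ι : Type*} [Fintype ι] {c : B} (hc : ∀ x, Commute c x)
    (M M' : Matrix ι ι B) : M * (c • M') = c • (M * M') := by
  ext i j
  simp only [Matrix.mul_apply, Matrix.smul_apply, smul_eq_mul, Finset.mul_sum]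
  refine Finset.sum_congr rfl fun k _ => ?_
  rw [← mul_assoc, ← (hc _).eq, mul_assoc]

theorem RTT.rMatrix_mul {c d : B} {T T' : Matrix (Fin N) (Fin N) B} (h : RTT c d T T')
    (hc : ∀ x, Commute c x) (hd : ∀ x, Commute d x) {a b : Fin m} (hab : a ≠ b) :
    rMatrix N c d a b * (YangianDet.atPos a T * YangianDet.atPos b T') =
      YangianDet.atPos b T' * YangianDet.atPos a T * rMatrix N c d a b := by
  have h1 := h.atPos hab
  rw [rMatrix, sub_mul, mul_sub, mul_smul_of_central hd, mul_smul_of_central hc, smul_mul_assoc,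
    smul_mul_assoc, one_mul, mul_one]
  rw [smul_sub, smul_sub, sub_eq_sub_iff_add_eq_add] at h1
  rw [sub_eq_sub_iff_add_eq_add, h1, add_comm]

theorem rtt_of_rMatrix_mul {c d : B} {T T' : Matrix (Fin N) (Fin N) B}
    (hc : ∀ x, Commute c x) (hd : ∀ x, Commute d x)
    (h : rMatrix N c d 0 1 * atPos (0 : Fin 2) T * atPos 1 T' =
      atPos 1 T' * atPos 0 T * rMatrix N c d 0 1) : RTT c d T T' := by
  intro i j k l
  have h01 : (0 : Fin 2) ≠ 1 := by decide
  rw [rMatrix, mul_assoc, sub_mul, mul_sub, mul_smul_of_central hd, mul_smul_of_central hc,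
    smul_mul_assoc, smul_mul_assoc, one_mul, mul_one] at h
  have h1 := congrFun (congrFun h ![i, k]) ![j, l]
  have hA : ∀ f g : Fin 2 → Fin N, AgreeOff 0 1 f g := by
    intro f g c h0 h1
    fin_cases c
    · exact absurd rfl h0
    · exact absurd rfl h1
  have hA' : ∀ f g : Fin 2 → Fin N, AgreeOff 1 0 f g := fun f g => (agreeOff_comm _ _ _ _).1 (hA f g)
  simp only [Matrix.sub_apply, Matrix.smul_apply, flip_eq_permMat, permMat_mul_apply,
    mul_permMat_apply, atPos_mul_atPos_apply h01, atPos_mul_atPos_apply h01.symm, hA, hA', if_true,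
    smul_eq_mul, Function.comp_apply, Equiv.symm_swap, Equiv.swap_apply_left,
    Equiv.swap_apply_right, Matrix.cons_val_zero, Matrix.cons_val_one] at h1
  rw [mul_sub, mul_sub, sub_eq_sub_iff_add_eq_add, add_comm (c * _)]
  rw [sub_eq_sub_iff_add_eq_add] at h1
  rw [h1]

variable [Algebra K B]

/-- `R_{ab} S_a R'_{ab} S'_b = S'_b R'_{ab} S_a R_{ab}` with `R_{ab} = d₁ - c P_{ab}` and
`R'_{ab} = d₂ - c Q_{ab}`. -/
def Reflection (K : Type*) [Field K] {n : ℕ} (κ : FormType) {m : ℕ} {B : Type*} [Ring B]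
    [Algebra K B] (c d₁ d₂ : B) (S S' : Matrix (Fin (2 * n)) (Fin (2 * n)) B) (a b : Fin m) :
    Prop :=
  rMatrix (2 * n) c d₁ a b * atPos a S * (d₂ • (1 : Matrix _ _ B) - c • qOp K κ B a b) *
      atPos b S' =
    atPos b S' * (d₂ • (1 : Matrix _ _ B) - c • qOp K κ B a b) * atPos a S *
      rMatrix (2 * n) c d₁ a b

theorem Reflection.map {B' : Type*} [Ring B'] [Algebra K B'] {φ : B →+* B'}
    (hφ : ∀ c, φ (algebraMap K B c) = algebraMap K B' c) {c d₁ d₂ : B}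
    {S S' : Matrix (Fin (2 * n)) (Fin (2 * n)) B} {a b : Fin m}
    (h : Reflection K κ c d₁ d₂ S S' a b) :
    Reflection K κ (φ c) (φ d₁) (φ d₂) (S.map φ) (S'.map φ) a b := by
  have h1 := congrArg (fun M => M.map φ) h
  rw [Reflection]
  simpa only [Matrix.map_mul, map_rMatrix, map_atPos, map_sub_tensor, map_smul_tensor,
    map_one_tensor, map_qOp κ hφ] using h1

theorem Reflection.emb {c d₁ d₂ : B} {S S' : Matrix (Fin (2 * n)) (Fin (2 * n)) B}
    (h : Reflection K κ c d₁ d₂ S S' (0 : Fin 2) 1) {a b : Fin m} (hab : a ≠ b) :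
    Reflection K κ c d₁ d₂ S S' a b := by
  have h1 := congrArg (YangianDet.emb a b) h
  rw [Reflection, rMatrix]
  simpa only [emb_mul hab, rMatrix, emb_sub, emb_smul, emb_one, emb_flip, emb_qOp,
    emb_atPos_zero hab, emb_atPos_one hab] using h1

theorem atPos_mul_qOp_mul_atPos_apply {a b : Fin m} (hab : a ≠ b)
    (W T : Matrix (Fin (2 * n)) (Fin (2 * n)) B) (f g : Fin m → Fin (2 * n)) :
    (atPos a (formTranspose K κ W) * qOp K κ B a b * atPos b T :
      Matrix (Fin m → Fin (2 * n)) (Fin m → Fin (2 * n)) B) f g =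
      if AgreeOff a b f g then (formSgn K κ (f a) * formSgn K κ (g a)) •
        (W (f b) (Fin.rev (f a)) * T (Fin.rev (g a)) (g b)) else 0 := by
  rw [mul_atPos_apply, Finset.sum_eq_single (Fin.rev (g a)), atPos_mul_apply,
    Finset.sum_eq_single (Fin.rev (f b))]
  · simp only [qOp, Matrix.of_apply, agreeOff_update_left, agreeOff_update_right',
      Function.update_self, Function.update_of_ne hab, Function.update_of_ne hab.symm, Fin.rev_rev,
      and_true]
    split_ifs
    · rw [formTranspose_apply, Fin.rev_rev, smul_mul_assoc, smul_mul_assoc, ← Algebra.commutes,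
        ← Algebra.smul_def, smul_mul_assoc, smul_smul]
      congr 1
      linear_combination formSgn K κ (f a) * formSgn K κ (g a) *
        formSgn_mul_self (K := K) κ (Fin.rev (f b))
    · simp
  · intro k _ hk
    simp only [qOp, Matrix.of_apply, Function.update_self, Function.update_of_ne hab.symm]
    rw [if_neg (fun h => hk h.2.1), mul_zero]
  · simp
  · intro k _ hk
    rw [atPos_mul_apply, Finset.sum_eq_zero, zero_mul]
    intro l _
    simp only [qOp, Matrix.of_apply, Function.update_self, Function.update_of_ne hab]
    rw [if_neg, mul_zero]
    rintro ⟨-, -, h⟩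
    exact hk ((eq_rev_comm _ _).1 h)
  · simp

theorem atPos_mul_qOp_mul_atPos_apply' {a b : Fin m} (hab : a ≠ b)
    (W T : Matrix (Fin (2 * n)) (Fin (2 * n)) B) (f g : Fin m → Fin (2 * n)) :
    (atPos b T * qOp K κ B a b * atPos a (formTranspose K κ W) :
      Matrix (Fin m → Fin (2 * n)) (Fin m → Fin (2 * n)) B) f g =
      if AgreeOff a b f g then (formSgn K κ (f a) * formSgn K κ (g a)) •
        (T (f b) (Fin.rev (f a)) * W (Fin.rev (g a)) (g b)) else 0 := by
  rw [mul_atPos_apply, Finset.sum_eq_single (Fin.rev (g b)), atPos_mul_apply,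
    Finset.sum_eq_single (Fin.rev (f a))]
  · simp only [qOp, Matrix.of_apply, agreeOff_update_left', agreeOff_update_right,
      Function.update_self, Function.update_of_ne hab, Function.update_of_ne hab.symm, Fin.rev_rev,
      and_true]
    split_ifs
    · rw [formTranspose_apply, Fin.rev_rev, mul_smul_comm, ← Algebra.commutes,
        ← Algebra.smul_def, smul_mul_assoc, smul_smul]
      congr 1
      linear_combination formSgn K κ (f a) * formSgn K κ (g a) *
        formSgn_mul_self (K := K) κ (Fin.rev (g b))
    · simp
  · intro k _ hk
    simp only [qOp, Matrix.of_apply, Function.update_self, Function.update_of_ne hab]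
    rw [if_neg, mul_zero]
    rintro ⟨-, h, -⟩
    exact hk ((eq_rev_comm _ _).1 h)
  · simp
  · intro k _ hk
    rw [atPos_mul_apply, Finset.sum_eq_zero, zero_mul]
    intro l _
    simp only [qOp, Matrix.of_apply, Function.update_self, Function.update_of_ne hab.symm]
    rw [if_neg (fun h => hk h.2.2), mul_zero]
  · simp

/-- This is the relation transposed in the first factor. It is checked entry by entry because
partial transposition is not compatible with products over a noncommutative ring. -/
theorem RTT.formTranspose_left {c d : B} {W T : Matrix (Fin (2 * n)) (Fin (2 * n)) B}
    (h : RTT c d W T) (hc : ∀ x, Commute c x) (hd : ∀ x, Commute d x) {a b : Fin m} (hab : a ≠ b) :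
    YangianDet.atPos a (formTranspose K κ W) *
        (d • (1 : Matrix _ _ B) - c • qOp K κ B a b) * YangianDet.atPos b T =
      YangianDet.atPos b T * (d • (1 : Matrix _ _ B) - c • qOp K κ B a b) *
        YangianDet.atPos a (formTranspose K κ W) := by
  rw [mul_sub, mul_sub, mul_smul_of_central hc, mul_smul_of_central hc, mul_smul_of_central hd,
    mul_smul_of_central hd, sub_mul, sub_mul, mul_one, mul_one, smul_mul_assoc, smul_mul_assoc,
    smul_mul_assoc, smul_mul_assoc]
  ext f g
  simp only [Matrix.sub_apply, Matrix.smul_apply, atPos_mul_qOp_mul_atPos_apply κ hab,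
    atPos_mul_qOp_mul_atPos_apply' κ hab, atPos_mul_atPos_apply hab,
    atPos_mul_atPos_apply hab.symm, agreeOff_comm b a]
  split_ifs
  · have h1 := congrArg (fun x => (formSgn K κ (f a) * formSgn K κ (g a)) • x)
      (h (Fin.rev (g a)) (Fin.rev (f a)) (f b) (g b))
    simp only [mul_sub, smul_sub, ← mul_smul_comm] at h1
    simp only [formTranspose_apply, smul_mul_assoc, smul_eq_mul, mul_smul_comm] at h1 ⊢
    rw [sub_eq_sub_iff_add_eq_add] at h1 ⊢
    rw [h1, add_comm]
  · simp

theorem RTT.formTranspose {c d : B} {X Y : Matrix (Fin (2 * n)) (Fin (2 * n)) B}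
    (h : RTT c d Y X) : RTT c d (formTranspose K κ X) (formTranspose K κ Y) := by
  intro i j k l
  have h1 := h (Fin.rev l) (Fin.rev k) (Fin.rev j) (Fin.rev i)
  simp only [formTranspose_apply, smul_mul_smul_comm]
  have e1 : formSgn K κ k * formSgn K κ l * (formSgn K κ i * formSgn K κ j) =
    formSgn K κ i * formSgn K κ j * (formSgn K κ k * formSgn K κ l) := by ring
  have e2 : formSgn K κ k * formSgn K κ j * (formSgn K κ i * formSgn K κ l) =
    formSgn K κ i * formSgn K κ j * (formSgn K κ k * formSgn K κ l) := by ring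
  rw [e1, e2, ← smul_sub, ← smul_sub, mul_smul_comm, mul_smul_comm]
  congr 1
  rw [← neg_sub, mul_neg, h1, ← mul_neg, neg_sub]

/-- PQ = QP = ±Q. -/
theorem rMatrix_mul_qOp_comm {c d₁ d₂ : B} (hc : ∀ x, Commute c x) (hd₁ : ∀ x, Commute d₁ x)
    (hd₂ : ∀ x, Commute d₂ x) (a b : Fin m) :
    rMatrix (2 * n) c d₁ a b * (d₂ • (1 : Matrix _ _ B) - c • qOp K κ B a b) =
      (d₂ • (1 : Matrix _ _ B) - c • qOp K κ B a b) * rMatrix (2 * n) c d₁ a b := by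
  have h1 : ∀ x y : B, (∀ z, Commute x z) → 
      ∀ M : Matrix (Fin m → Fin (2 * n)) (Fin m → Fin (2 * n)) B, x • y • M = y • x • M := by
    intro x y hx M
    rw [smul_smul, smul_smul, (hx y).eq]
  rw [rMatrix, sub_mul, sub_mul, mul_sub, mul_sub, mul_sub, mul_sub]
  simp only [smul_mul_assoc, one_mul, mul_one, mul_smul_of_central hc, mul_smul_of_central hd₁,
    mul_smul_of_central hd₂, flip_mul_qOp, qOp_mul_flip]
  rw [h1 d₂ d₁ hd₂, h1 d₂ c hd₂, h1 c d₁ hc]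
  abel

/-- Intended for W = T(-u) and W' = T(-v): the four relations are those for (u, v), (-u, v), (-v, u)
and (-v, -u). The inner two exchange transposed and plain factors through R', the outer two move R,
and R commutes with R'. -/
theorem reflection_mul_formTranspose {c d₁ d₂ : B} {T T' W W' : Matrix (Fin (2 * n)) (Fin (2 * n)) B}
    (hc : ∀ x, Commute c x) (hd₁ : ∀ x, Commute d₁ x) (hd₂ : ∀ x, Commute d₂ x)
    (h₁ : RTT c d₁ T T') (h₂ : RTT c d₂ W T') (h₃ : RTT c d₂ W' T) (h₄ : RTT c d₁ W' W)
    {a b : Fin m} (hab : a ≠ b) :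
    Reflection K κ c d₁ d₂ (T * formTranspose K κ W) (T' * formTranspose K κ W') a b := by
  have e1 := h₁.rMatrix_mul hc hd₁ hab
  have e2 := h₂.formTranspose_left (K := K) κ hc hd₂ hab
  have e3 := h₃.formTranspose_left (K := K) κ hc hd₂ hab.symm
  have e4 := (h₄.formTranspose (K := K) κ).rMatrix_mul hc hd₁ hab
  have e5 := rMatrix_mul_qOp_comm (K := K) (n := n) κ hc hd₁ hd₂ a b
  rw [qOp_comm] at e3
  rw [Reflection, ← atPos_mul, ← atPos_mul]
  generalize d₂ • (1 : Matrix (Fin m → Fin (2 * n)) _ B) - c • qOp K κ B a b = R' at *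
  generalize rMatrix (2 * n) c d₁ a b = R at *
  generalize atPos a T = T₁ at *
  generalize atPos b T' = T₂ at *
  generalize atPos a (formTranspose K κ W) = W₁ at *
  generalize atPos b (formTranspose K κ W') = W₂ at *
  calc R * (T₁ * W₁) * R' * (T₂ * W₂) = R * T₁ * (W₁ * R' * T₂) * W₂ := by simp only [mul_assoc]
    _ = R * (T₁ * T₂) * R' * W₁ * W₂ := by rw [e2]; simp only [mul_assoc]
    _ = T₂ * T₁ * (R * R') * W₁ * W₂ := by rw [e1]; simp only [mul_assoc]
    _ = T₂ * T₁ * R' * (R * (W₁ * W₂)) := by rw [e5]; simp only [mul_assoc]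
    _ = T₂ * (T₁ * R' * W₂) * W₁ * R := by rw [e4]; simp only [mul_assoc]
    _ = _ := by rw [← e3]; simp only [mul_assoc]

end Relations

/-! ### Centrality of u⁻¹ and v⁻¹, and the defining relations over series. -/

section Central

variable {A : Type*} [Ring A]

theorem commute_uInv (F : A⟦X⟧⟦X⟧) : Commute uInv F := by
  ext k : 1
  rw [uInv, inU, PowerSeries.coeff_C_mul, PowerSeries.coeff_mul_C]
  exact (PowerSeries.commute_X _).symm.eq

theorem commute_vInv (F : A⟦X⟧⟦X⟧) : Commute vInv F := by
  rw [vInv, inV, PowerSeries.map_X]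
  exact (PowerSeries.commute_X F).symm

theorem commute_uInv_mul_vInv (F : A⟦X⟧⟦X⟧) : Commute (uInv * vInv) F :=
  (commute_uInv F).mul_left (commute_vInv F)

theorem commute_vInv_sub_uInv (F : A⟦X⟧⟦X⟧) : Commute (vInv - uInv) F :=
  (commute_vInv F).sub_left (commute_uInv F)

theorem commute_neg_vInv_sub_uInv (F : A⟦X⟧⟦X⟧) : Commute (-vInv - uInv) F :=
  (commute_vInv F).neg_left.sub_left (commute_uInv F)

theorem ternary_iff {N : ℕ} (T : Matrix (Fin N) (Fin N) A⟦X⟧) :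
    ternaryLeft T = ternaryRight T ↔
      RTT (uInv * vInv) (vInv - uInv) (T.map inU) (T.map inV) := by
  refine ⟨rtt_of_rMatrix_mul commute_uInv_mul_vInv commute_vInv_sub_uInv, fun h => ?_⟩
  rw [ternaryLeft, ternaryRight, mul_assoc]
  exact h.rMatrix_mul commute_uInv_mul_vInv commute_vInv_sub_uInv (by decide)

variable {K : Type*} [Field K] [Algebra K A] {n : ℕ} (κ : FormType)

theorem quaternary_iff (S : Matrix (Fin (2 * n)) (Fin (2 * n)) A⟦X⟧) :
    quaternaryLeft K κ S = quaternaryRight K κ S ↔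
      Reflection K κ (uInv * vInv) (vInv - uInv) (-vInv - uInv) (S.map inU) (S.map inV)
        (0 : Fin 2) 1 := by
  rw [quaternaryLeft, quaternaryRight, Reflection, rMatrixPrime_eq κ (by decide)]

end Central

/-! ### Naturality of the relations under algebra homomorphisms. -/

section Functoriality

variable {K : Type*} [Field K] {A A' : Type*} [Ring A] [Ring A'] [Algebra K A] [Algebra K A']
  (φ : A →ₐ[K] A')

theorem map_inU (f : A⟦X⟧) : PowerSeries.map (PowerSeries.map φ.toRingHom) (inU f) =
    inU (PowerSeries.map φ.toRingHom f) := by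
  rw [inU, inU, PowerSeries.map_C]

theorem map_inV (f : A⟦X⟧) : PowerSeries.map (PowerSeries.map φ.toRingHom) (inV f) =
    inV (PowerSeries.map φ.toRingHom f) := by
  ext k : 1
  simp [inV]

theorem map_uInv : PowerSeries.map (PowerSeries.map φ.toRingHom) uInv = uInv := by
  rw [uInv, map_inU, PowerSeries.map_X, uInv]

theorem map_vInv : PowerSeries.map (PowerSeries.map φ.toRingHom) vInv = vInv := by
  rw [vInv, map_inV, PowerSeries.map_X, vInv]

theorem map_algebraMap_series (c : K) :
    PowerSeries.map φ.toRingHom (algebraMap K A⟦X⟧ c) = algebraMap K A'⟦X⟧ c := by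
  rw [PowerSeries.algebraMap_apply, PowerSeries.map_C, PowerSeries.algebraMap_apply]
  simp

theorem map_algebraMap_series₂ (c : K) :
    PowerSeries.map (PowerSeries.map φ.toRingHom) (algebraMap K A⟦X⟧⟦X⟧ c) =
      algebraMap K A'⟦X⟧⟦X⟧ c := by
  rw [PowerSeries.algebraMap_apply (A := A⟦X⟧), PowerSeries.map_C,
    PowerSeries.algebraMap_apply (A := A'⟦X⟧), map_algebraMap_series]

theorem map_matrix_inU {ι : Type*} (T : Matrix ι ι A⟦X⟧) :
    (T.map inU).map (PowerSeries.map (PowerSeries.map φ.toRingHom)) =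
      (T.map (PowerSeries.map φ.toRingHom)).map inU := by
  ext1 i j
  exact map_inU φ (T i j)

theorem map_matrix_inV {ι : Type*} (T : Matrix ι ι A⟦X⟧) :
    (T.map inV).map (PowerSeries.map (PowerSeries.map φ.toRingHom)) =
      (T.map (PowerSeries.map φ.toRingHom)).map inV := by
  ext1 i j
  exact map_inV φ (T i j)

theorem map_ternaryLeft {N : ℕ} (T : Matrix (Fin N) (Fin N) A⟦X⟧) :
    (ternaryLeft T).map (PowerSeries.map (PowerSeries.map φ.toRingHom)) =
      ternaryLeft (T.map (PowerSeries.map φ.toRingHom)) := by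
  simp only [ternaryLeft, Matrix.map_mul, map_rMatrix, map_atPos, map_matrix_inU, map_matrix_inV,
    map_mul, map_sub, map_uInv, map_vInv]

theorem map_ternaryRight {N : ℕ} (T : Matrix (Fin N) (Fin N) A⟦X⟧) :
    (ternaryRight T).map (PowerSeries.map (PowerSeries.map φ.toRingHom)) =
      ternaryRight (T.map (PowerSeries.map φ.toRingHom)) := by
  simp only [ternaryRight, Matrix.map_mul, map_rMatrix, map_atPos, map_matrix_inU, map_matrix_inV,
    map_mul, map_sub, map_uInv, map_vInv]

variable {n : ℕ} (κ : FormType)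

theorem map_rMatrixPrime {m : ℕ} {a b : Fin m} (hab : a ≠ b) (c d : A⟦X⟧⟦X⟧) :
    (rMatrixPrime K n κ c d a b).map (PowerSeries.map (PowerSeries.map φ.toRingHom)) =
      rMatrixPrime K n κ (PowerSeries.map (PowerSeries.map φ.toRingHom) c)
        (PowerSeries.map (PowerSeries.map φ.toRingHom) d) a b := by
  rw [rMatrixPrime_eq κ hab, rMatrixPrime_eq κ hab, map_sub_tensor, map_smul_tensor,
    map_smul_tensor, map_one_tensor, map_qOp κ (map_algebraMap_series₂ φ)]

theorem map_quaternaryLeft (S : Matrix (Fin (2 * n)) (Fin (2 * n)) A⟦X⟧) :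
    (quaternaryLeft K κ S).map (PowerSeries.map (PowerSeries.map φ.toRingHom)) =
      quaternaryLeft K κ (S.map (PowerSeries.map φ.toRingHom)) := by
  simp only [quaternaryLeft, Matrix.map_mul, map_rMatrix, map_rMatrixPrime φ κ zero_ne_one, map_atPos,
    map_matrix_inU, map_matrix_inV, map_mul, map_sub, map_neg, map_uInv, map_vInv]

theorem map_quaternaryRight (S : Matrix (Fin (2 * n)) (Fin (2 * n)) A⟦X⟧) :
    (quaternaryRight K κ S).map (PowerSeries.map (PowerSeries.map φ.toRingHom)) =
      quaternaryRight K κ (S.map (PowerSeries.map φ.toRingHom)) := by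
  simp only [quaternaryRight, Matrix.map_mul, map_rMatrix, map_rMatrixPrime φ κ zero_ne_one, map_atPos,
    map_matrix_inU, map_matrix_inV, map_mul, map_sub, map_neg, map_uInv, map_vInv]

theorem map_affineSubst (a b : K) {ι : Type*} (M : Matrix ι ι A⟦X⟧) :
    (M.map (affineSubst a b)).map (PowerSeries.map φ.toRingHom) =
      (M.map (PowerSeries.map φ.toRingHom)).map (affineSubst a b) := by
  ext1 i j
  simp only [Matrix.map_apply, affineSubst_eq, affineHom_map]

theorem map_primeNeg (S : Matrix (Fin (2 * n)) (Fin (2 * n)) A⟦X⟧) :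
    (primeNeg K κ S).map (PowerSeries.map φ.toRingHom) =
      primeNeg K κ (S.map (PowerSeries.map φ.toRingHom)) := by
  rw [primeNeg, primeNeg, map_affineSubst, map_formTranspose κ (map_algebraMap_series φ)]

theorem map_scalarSeries (f : K⟦X⟧) :
    PowerSeries.map φ.toRingHom (scalarSeries A f) = scalarSeries A' f := by
  ext r
  simp [scalarSeries]

theorem map_symmetryRight (S : Matrix (Fin (2 * n)) (Fin (2 * n)) A⟦X⟧) :
    (symmetryRight K κ S).map (PowerSeries.map φ.toRingHom) =
      symmetryRight K κ (S.map (PowerSeries.map φ.toRingHom)) := by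
  rw [symmetryRight, symmetryRight, ← map_affineSubst]
  ext1 i j
  simp only [Matrix.map_apply, Matrix.add_apply, Matrix.smul_apply, Matrix.sub_apply, map_add,
    smul_eq_mul, map_mul, map_sub, map_scalarSeries]
  rw [Algebra.smul_def, map_mul, map_algebraMap_series, ← Algebra.smul_def]
  simp only [map_mul, map_sub, map_scalarSeries]

theorem map_genMatrix {N : ℕ} (t : Fin N → Fin N → ℕ → A) :
    (genMatrix t).map (PowerSeries.map φ.toRingHom) = genMatrix fun i j r => φ (t i j r) := by
  ext i j r
  simp only [genMatrix, Matrix.map_apply, Matrix.of_apply, PowerSeries.coeff_map,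
    PowerSeries.coeff_mk]
  rcases r with _ | r
  · dsimp only
    split_ifs <;> simp
  · rfl

end Functoriality

/-! ### Universal properties of the two Yangians. -/

section Presentations

variable {K : Type*} [Field K] {A : Type*} [Ring A] [Algebra K A]

theorem genMatrix_coeff {N : ℕ} (M : Matrix (Fin N) (Fin N) A⟦X⟧)
    (hM : M.map PowerSeries.constantCoeff = 1) :
    genMatrix (fun i j r => PowerSeries.coeff (r + 1) (M i j)) = M := by
  ext i j r
  simp only [genMatrix, Matrix.of_apply, PowerSeries.coeff_mk]
  rcases r with _ | r
  · have h := congrFun (congrFun hM i) j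
    rw [Matrix.map_apply, Matrix.one_apply] at h
    simp [h]
  · rfl

theorem freeMatrix_map {N : ℕ} (φ : FreeGen K N →ₐ[K] A) :
    (freeMatrix K N).map (PowerSeries.map φ.toRingHom) =
      genMatrix fun i j r => φ (FreeAlgebra.ι K (i, j, r)) :=
  map_genMatrix φ _

theorem matT_eq (N : ℕ) : matT K N = (freeMatrix K N).map
    (PowerSeries.map (RingQuot.mkAlgHom K (YangianRel K N)).toRingHom) :=
  (freeMatrix_map _).symm

theorem rtt_matT (N : ℕ) : RTT (uInv * vInv) (vInv - uInv) ((matT K N).map inU)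
    ((matT K N).map inV) := by
  rw [← ternary_iff, matT_eq, ← map_ternaryLeft, ← map_ternaryRight]
  ext f g s r
  simp only [Matrix.map_apply, PowerSeries.coeff_map]
  exact RingQuot.mkAlgHom_rel K (YangianRel.ternary f g r s)

/-- The homomorphism from the Yangian defined by a solution of the ternary relation. -/
theorem exists_yangian_hom {N : ℕ} (M : Matrix (Fin N) (Fin N) A⟦X⟧)
    (hM : M.map PowerSeries.constantCoeff = 1)
    (h : RTT (uInv * vInv) (vInv - uInv) (M.map inU) (M.map inV)) :
    ∃ φ : Yangian K N →ₐ[K] A, (matT K N).map (PowerSeries.map φ.toRingHom) = M := by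
  let ψ : FreeGen K N →ₐ[K] A :=
    FreeAlgebra.lift K fun x => PowerSeries.coeff (x.2.2 + 1) (M x.1 x.2.1)
  have hψ : (freeMatrix K N).map (PowerSeries.map ψ.toRingHom) = M := by
    rw [freeMatrix_map, ← genMatrix_coeff M hM]
    simp [ψ, genMatrix_coeff M hM]
  have hrel : ∀ ⦃x y⦄, YangianRel K N x y → ψ x = ψ y := by
    rintro _ _ ⟨f, g, r, s⟩
    have h1 := (ternary_iff M).2 h
    rw [← hψ, ← map_ternaryLeft, ← map_ternaryRight] at h1
    have h2 := congrArg (PowerSeries.coeff r) (congrArg (PowerSeries.coeff s)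
      (congrFun (congrFun h1 f) g))
    simpa only [Matrix.map_apply, PowerSeries.coeff_map] using! h2
  refine ⟨RingQuot.liftAlgHom K ⟨ψ, hrel⟩, ?_⟩
  rw [matT, map_genMatrix, ← hψ, freeMatrix_map]
  simp

variable {n : ℕ} (κ : FormType)

theorem matS_eq : matS K n κ = (freeMatrix K (2 * n)).map
    (PowerSeries.map (RingQuot.mkAlgHom K (TwistedRel K n κ)).toRingHom) :=
  (freeMatrix_map _).symm

theorem reflection_matS : Reflection K κ (uInv * vInv) (vInv - uInv) (-vInv - uInv)
    ((matS K n κ).map inU) ((matS K n κ).map inV) (0 : Fin 2) 1 := by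
  rw [← quaternary_iff, matS_eq, ← map_quaternaryLeft, ← map_quaternaryRight]
  ext f g s r
  simp only [Matrix.map_apply, PowerSeries.coeff_map]
  exact RingQuot.mkAlgHom_rel K (TwistedRel.quaternary f g r s)

theorem symmetry_matS : primeNeg K κ (matS K n κ) = symmetryRight K κ (matS K n κ) := by
  rw [matS_eq, ← map_primeNeg, ← map_symmetryRight]
  ext i j r
  simp only [Matrix.map_apply, PowerSeries.coeff_map]
  exact RingQuot.mkAlgHom_rel K (TwistedRel.symmetry i j r)

/-- The homomorphism from the twisted Yangian defined by a solution of its relations. -/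
theorem exists_twistedYangian_hom (M : Matrix (Fin (2 * n)) (Fin (2 * n)) A⟦X⟧)
    (hM : M.map PowerSeries.constantCoeff = 1)
    (h : quaternaryLeft K κ M = quaternaryRight K κ M)
    (h' : primeNeg K κ M = symmetryRight K κ M) :
    ∃ φ : TwistedYangian K n κ →ₐ[K] A, (matS K n κ).map (PowerSeries.map φ.toRingHom) = M := by
  let ψ : FreeGen K (2 * n) →ₐ[K] A :=
    FreeAlgebra.lift K fun x => PowerSeries.coeff (x.2.2 + 1) (M x.1 x.2.1)
  have hψ : (freeMatrix K (2 * n)).map (PowerSeries.map ψ.toRingHom) = M := by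
    rw [freeMatrix_map, ← genMatrix_coeff M hM]
    simp [ψ, genMatrix_coeff M hM]
  have hrel : ∀ ⦃x y⦄, TwistedRel K n κ x y → ψ x = ψ y := by
    rintro _ _ (⟨f, g, r, s⟩ | ⟨i, j, r⟩)
    · rw [← hψ, ← map_quaternaryLeft, ← map_quaternaryRight] at h
      have h2 := congrArg (PowerSeries.coeff r) (congrArg (PowerSeries.coeff s)
        (congrFun (congrFun h f) g))
      simpa only [Matrix.map_apply, PowerSeries.coeff_map] using! h2
    · rw [← hψ, ← map_primeNeg, ← map_symmetryRight] at h'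
      have h2 := congrArg (PowerSeries.coeff r) (congrFun (congrFun h' i) j)
      simpa only [Matrix.map_apply, PowerSeries.coeff_map] using! h2
  refine ⟨RingQuot.liftAlgHom K ⟨ψ, hrel⟩, ?_⟩
  rw [matS, map_genMatrix, ← hψ, freeMatrix_map]
  simp

theorem twistedYangian_hom_ext {φ ψ : TwistedYangian K n κ →ₐ[K] A}
    (h : (matS K n κ).map (PowerSeries.map φ.toRingHom) =
      (matS K n κ).map (PowerSeries.map ψ.toRingHom)) : φ = ψ := by
  refine RingQuot.ringQuot_ext' K (s := TwistedRel K n κ) φ ψ (FreeAlgebra.hom_ext (funext fun x => ?_))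
  have h2 := congrArg (PowerSeries.coeff (x.2.2 + 1)) (congrFun (congrFun h x.1) x.2.1)
  simpa [matS, genMatrix] using h2

end Presentations

end

end YangianDet

namespace YangianDet

noncomputable section

/-! ### Specialization of the spectral parameters -/

section Scalars

variable {K : Type*} [Field K] {A : Type*} [Ring A] [Algebra K A]

theorem affineInv_ne_zero {a : K} (ha : a ≠ 0) (b : K) : affineInv a b ≠ 0 := by
  intro h
  have h1 := affineInv_mul ha b
  rw [h, mul_zero] at h1
  exact PowerSeries.X_ne_zero h1.symm

theorem affineInv_sub {a a' : K} (ha : a ≠ 0) (ha' : a' ≠ 0) (b b' : K) :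
    PowerSeries.X * (affineInv a' b' - affineInv a b) =
      (PowerSeries.C (a - a') + PowerSeries.C (b - b') * PowerSeries.X) *
        (affineInv a b * affineInv a' b') := by
  have h := affineInv_mul ha b
  have h' := affineInv_mul ha' b'
  rw [map_sub, map_sub]
  linear_combination (affineInv a b) * h' - (affineInv a' b') * h

theorem scalarSeries_mul (f g : K⟦X⟧) :
    scalarSeries A (f * g) = scalarSeries A f * scalarSeries A g :=
  map_mul _ f g

theorem scalarSeries_sub (f g : K⟦X⟧) :
    scalarSeries A (f - g) = scalarSeries A f - scalarSeries A g :=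
  map_sub _ f g

theorem scalarSeries_neg (f : K⟦X⟧) : scalarSeries A (-f) = -scalarSeries A f :=
  map_neg _ f

theorem scalarSeries_one : scalarSeries A (1 : K⟦X⟧) = 1 :=
  map_one (PowerSeries.map (algebraMap K A))

theorem scalarSeries_C (c : K) : scalarSeries A (PowerSeries.C c) = algebraMap K A⟦X⟧ c := by
  rw [scalarSeries, PowerSeries.map_C, PowerSeries.algebraMap_apply]

/-- Although A may have zero divisors, a nonzero scalar series is a power of X up to a unit, and X
can be cancelled over any ring. -/
theorem scalarSeries_mul_left_cancel {c : K⟦X⟧} (hc : c ≠ 0) {f g : A⟦X⟧}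
    (h : scalarSeries A c * f = scalarSeries A c * g) : f = g := by
  obtain ⟨k, u, hu⟩ := IsDiscreteValuationRing.associated_pow_irreducible hc
    (PowerSeries.X_irreducible (R := K))
  have h1 : ∀ f : A⟦X⟧, scalarSeries A (u : K⟦X⟧) * (scalarSeries A c * f) =
      PowerSeries.X ^ k * f := by
    intro f
    rw [← mul_assoc, ← scalarSeries_mul, mul_comm, hu, scalarSeries, map_pow, PowerSeries.map_X]
  have h2 : (PowerSeries.X : A⟦X⟧) ^ k * f = PowerSeries.X ^ k * g := by rw [← h1, h, h1]
  ext r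
  have h3 := congrArg (PowerSeries.coeff (r + k)) h2
  rwa [PowerSeries.coeff_X_pow_mul, PowerSeries.coeff_X_pow_mul] at h3

theorem affineHom_algebraMap (a b c : K) :
    affineHom A a b (algebraMap K A⟦X⟧ c) = algebraMap K A⟦X⟧ c := by
  rw [PowerSeries.algebraMap_apply, affineHom_C]

theorem inU_algebraMap (c : K) :
    inU (algebraMap K A⟦X⟧ c) = algebraMap K A⟦X⟧⟦X⟧ c := by
  rw [PowerSeries.algebraMap_apply (A := A⟦X⟧), inU]

theorem inV_algebraMap (c : K) :
    inV (algebraMap K A⟦X⟧ c) = algebraMap K A⟦X⟧⟦X⟧ c := by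
  rw [PowerSeries.algebraMap_apply (A := A⟦X⟧), PowerSeries.algebraMap_apply, inV,
    PowerSeries.map_C]

theorem affineHom₂_algebraMap (a b a' b' c : K) :
    affineHom₂ A a b a' b' (algebraMap K A⟦X⟧⟦X⟧ c) = algebraMap K A⟦X⟧ c := by
  rw [← inU_algebraMap, affineHom₂_inU, affineHom_algebraMap]

theorem series_two_torsion (h2 : (2 : K) ≠ 0) (x : A⟦X⟧) (hx : x + x = 0) : x = 0 := by
  have h : (2 : K) • x = 0 := by rw [two_smul, hx]
  rwa [smul_eq_zero_iff_right h2] at h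

end Scalars

/-! ### Exchange of the two spectral parameters. -/

section SwapVariables

variable {A : Type*} [Ring A]

/-- The exchange of `u` and `v`. -/
def swapHom (A : Type*) [Ring A] : A⟦X⟧⟦X⟧ →+* A⟦X⟧⟦X⟧ where
  toFun F := PowerSeries.mk fun s => PowerSeries.mk fun r =>
    PowerSeries.coeff s (PowerSeries.coeff r F)
  map_zero' := by
    ext
    simp
  map_add' F G := by
    ext
    simp
  map_one' := by
    ext s r
    simp only [PowerSeries.coeff_mk, PowerSeries.coeff_one]
    split_ifs <;> simp [PowerSeries.coeff_one, *]
  map_mul' F G := by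
    ext s r
    simp only [PowerSeries.coeff_mk, PowerSeries.coeff_mul, map_sum]
    exact Finset.sum_comm

theorem swapHom_inU (f : A⟦X⟧) : swapHom A (inU f) = inV f := by
  ext s r
  simp only [swapHom, RingHom.coe_mk, MonoidHom.coe_mk, OneHom.coe_mk, PowerSeries.coeff_mk, inU,
    inV, PowerSeries.coeff_map, PowerSeries.coeff_C]
  split_ifs <;> simp

theorem swapHom_inV (f : A⟦X⟧) : swapHom A (inV f) = inU f := by
  ext s r
  simp only [swapHom, RingHom.coe_mk, MonoidHom.coe_mk, OneHom.coe_mk, PowerSeries.coeff_mk, inU,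
    inV, PowerSeries.coeff_map, PowerSeries.coeff_C]
  split_ifs <;> simp

end SwapVariables

section Specialization

variable {N : ℕ} {K : Type*} [Field K] {A : Type*} [Ring A] [Algebra K A]

theorem RTT.neg {B : Type*} [Ring B] {c d : B} {T T' : Matrix (Fin N) (Fin N) B}
    (h : RTT c d T T') : RTT (-c) (-d) T T' := by
  intro i j k l
  rw [neg_mul, neg_mul, h i j k l]

/-- The hypothesis `hcd` is c/d = 1/((a - a')u + b - b') with denominators cleared. The specialized
relation carries the extra scalar 1/((au + b)(a'u + b')), which is cancelled. -/
theorem rtt_affineHom {T : Matrix (Fin N) (Fin N) A⟦X⟧}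
    (h : RTT (uInv * vInv) (vInv - uInv) (T.map inU) (T.map inV)) {a a' : K} (ha : a ≠ 0)
    (ha' : a' ≠ 0) (b b' : K) {c d : K⟦X⟧}
    (hcd : c * (PowerSeries.C (a - a') + PowerSeries.C (b - b') * PowerSeries.X) =
      d * PowerSeries.X) :
    RTT (scalarSeries A c) (scalarSeries A d) (T.map (affineHom A a b))
      (T.map (affineHom A a' b')) := by
  have h1 := h.map (affineHom₂ A a b a' b')
  rw [map_mul, map_sub, affineHom₂_uInv, affineHom₂_vInv, ← scalarSeries_mul, ← scalarSeries_sub]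
    at h1
  have h2 : c * (affineInv a' b' - affineInv a b) = d * (affineInv a b * affineInv a' b') := by
    refine mul_left_cancel₀ (PowerSeries.X_ne_zero (R := K)) ?_
    linear_combination c * affineInv_sub ha ha' b b' + affineInv a b * affineInv a' b' * hcd
  intro i j k l
  refine scalarSeries_mul_left_cancel (mul_ne_zero (affineInv_ne_zero ha b)
    (affineInv_ne_zero ha' b')) ?_
  have h3 := congrArg (fun x => scalarSeries A c * x) (h1 i j k l)
  simp only [← mul_assoc, ← scalarSeries_mul, h2, Matrix.map_apply, affineHom₂_inU,
    affineHom₂_inV] at h3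
  simp only [← mul_assoc, ← scalarSeries_mul, Matrix.map_apply]
  have e : ∀ f : K⟦X⟧, affineInv a b * affineInv a' b' * f = f * affineInv a b * affineInv a' b' := by
    intro f
    ring
  rw [e, e]
  simpa only [← mul_assoc] using h3

theorem scaleHom_matrix_inU (a a' : K) (T : Matrix (Fin N) (Fin N) A⟦X⟧) :
    (T.map inU).map (scaleHom A a a') = (T.map (affineHom A a 0)).map inU := by
  ext1 i j
  exact scaleHom_inU a a' _

theorem scaleHom_matrix_inV (a a' : K) (T : Matrix (Fin N) (Fin N) A⟦X⟧) :
    (T.map inV).map (scaleHom A a a') = (T.map (affineHom A a' 0)).map inV := by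
  ext1 i j
  exact scaleHom_inV a a' _

theorem swapHom_matrix_inU (T : Matrix (Fin N) (Fin N) A⟦X⟧) :
    (T.map inU).map (swapHom A) = T.map inV := by
  ext1 i j
  exact swapHom_inU _

theorem swapHom_matrix_inV (T : Matrix (Fin N) (Fin N) A⟦X⟧) :
    (T.map inV).map (swapHom A) = T.map inU := by
  ext1 i j
  exact swapHom_inV _

theorem matrix_affineHom_one_zero (T : Matrix (Fin N) (Fin N) A⟦X⟧) :
    T.map (affineHom A (1 : K) 0) = T := by
  ext1 i j
  exact affineHom_one_zero _

theorem matrix_affineHom_affineHom {a a' : K} (ha : a ≠ 0) (ha' : a' ≠ 0) (b b' : K)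
    (T : Matrix (Fin N) (Fin N) A⟦X⟧) :
    (T.map (affineHom A a' b')).map (affineHom A a b) =
      T.map (affineHom A (a' * a) (a' * b + b')) := by
  ext1 i j
  exact affineHom_affineHom ha ha' b b' _

theorem matrix_affineSubst (a b : K) (T : Matrix (Fin N) (Fin N) A⟦X⟧) :
    T.map (affineSubst a b) = T.map (affineHom A a b) := by
  ext1 i j
  exact affineSubst_eq a b _

variable {n : ℕ} (κ : FormType)

theorem primeNeg_eq (T : Matrix (Fin (2 * n)) (Fin (2 * n)) A⟦X⟧) :
    primeNeg K κ T = formTranspose K κ (T.map (affineHom A (-1 : K) 0)) := by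
  rw [primeNeg, matrix_affineSubst, map_formTranspose κ (affineHom_algebraMap _ _)]

/-! ### The series `T(u) T'(-u)` satisfies the relations of the twisted Yangian -/

theorem quaternary_mul_primeNeg {T : Matrix (Fin (2 * n)) (Fin (2 * n)) A⟦X⟧}
    (h : RTT (uInv * vInv) (vInv - uInv) (T.map inU) (T.map inV)) :
    quaternaryLeft K κ (T * primeNeg K κ T) = quaternaryRight K κ (T * primeNeg K κ T) := by
  have hneg : ∀ a a' : K, a = -1 → scaleHom A a a' uInv = -uInv := by
    rintro _ a' rfl
    rw [uInv, scaleHom_inU, affineHom_neg_X, map_neg]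
  have hneg' : ∀ a a' : K, a' = -1 → scaleHom A a a' vInv = -vInv := by
    rintro a _ rfl
    rw [vInv, scaleHom_inV, affineHom_neg_X, map_neg]
  have hone : scaleHom A (1 : K) (-1) uInv = uInv := by
    rw [uInv, scaleHom_inU, affineHom_one_zero]
  have hone' : scaleHom A (-1 : K) 1 vInv = vInv := by
    rw [vInv, scaleHom_inV, affineHom_one_zero]
  -- The scale homomorphisms change only signs, so the relations whose first parameter is -v also
  -- need u and v exchanged.
  have hswap := h.map (swapHom A)
  rw [swapHom_matrix_inU, swapHom_matrix_inV, map_mul, map_sub, uInv, vInv, swapHom_inU,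
    swapHom_inV] at hswap
  change RTT (vInv * uInv) (uInv - vInv) _ _ at hswap
  have h2 := (h.map (scaleHom A (-1 : K) 1)).neg
  rw [scaleHom_matrix_inU, scaleHom_matrix_inV, matrix_affineHom_one_zero, map_mul, map_sub, hone',
    hneg _ _ rfl, neg_mul, neg_neg, sub_neg_eq_add, neg_add'] at h2
  have h3 := (hswap.map (scaleHom A (1 : K) (-1))).neg
  rw [scaleHom_matrix_inU, scaleHom_matrix_inV, matrix_affineHom_one_zero, map_mul, map_sub, hone,
    hneg' _ _ rfl, neg_mul, neg_neg, sub_neg_eq_add, add_comm, neg_add',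
    ← (commute_uInv vInv).eq] at h3
  have h4 := hswap.map (scaleHom A (-1 : K) (-1))
  rw [scaleHom_matrix_inU, scaleHom_matrix_inV, map_mul, map_sub, hneg _ _ rfl,
    hneg' _ _ rfl, neg_mul_neg, neg_sub_neg, ← (commute_uInv vInv).eq] at h4
  rw [quaternary_iff, Matrix.map_mul, Matrix.map_mul, primeNeg_eq,
    map_formTranspose κ inU_algebraMap, map_formTranspose κ inV_algebraMap]
  exact reflection_mul_formTranspose κ commute_uInv_mul_vInv commute_vInv_sub_uInv
    commute_neg_vInv_sub_uInv h h2 h3 h4 (by decide)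

/-- S(u) and S'(-u) are entrywise the same sums with T(u) and T(-u) multiplied in opposite orders.
The relation at (u, -u) gives S'(-u) - S(u) = ±(S'(-u) - S'(u))/(2u), and comparison with its image
under u ↦ -u replaces S' by S on the right. -/
theorem symmetry_mul_primeNeg (h2 : (2 : K) ≠ 0) {T : Matrix (Fin (2 * n)) (Fin (2 * n)) A⟦X⟧}
    (h : RTT (uInv * vInv) (vInv - uInv) (T.map inU) (T.map inV)) :
    primeNeg K κ (T * primeNeg K κ T) = symmetryRight K κ (T * primeNeg K κ T) := by
  have hneg1 : (-1 : K) ≠ 0 := neg_ne_zero.2 one_ne_zero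
  set x : A⟦X⟧ := scalarSeries A (affineInv (2 : K) 0) with hx
  set τ := affineHom A (-1 : K) 0 with hτ
  have hττ : ∀ f, τ (τ f) = f := by
    intro f
    rw [hτ, affineHom_affineHom hneg1 hneg1]
    simp [affineHom_one_zero]
  have hτx : τ x = -x := by
    rw [hτ, hx, affineHom_scalarSeries, affineHom_affineInv hneg1 h2, ← scalarSeries_neg]
    congr 1
    refine mul_left_cancel₀ (a := PowerSeries.C (2 : K)) (by simpa using h2) ?_
    have e1 := affineInv_mul h2 0
    have e2 := affineInv_mul (mul_ne_zero h2 hneg1) (2 * 0 + 0)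
    simp only [map_zero, zero_mul, add_zero, mul_zero, map_mul, map_neg, map_one] at e1 e2 ⊢
    linear_combination e1 - e2
  -- The parameters u and -u differ by 2u, whence the scalar 1/(2u).
  have hR := rtt_affineHom h (one_ne_zero (α := K)) hneg1 0 0 (c := affineInv 2 0) (d := 1) (by
    have := affineInv_mul h2 0
    rw [one_mul, mul_comm]
    convert this using 2
    norm_num)
  rw [matrix_affineHom_one_zero, scalarSeries_one] at hR
  have hS : ∀ i j, (T * primeNeg K κ T) i j = ∑ k, (formSgn K κ j * formSgn K κ k) •
      (T i k * τ (T (Fin.rev j) (Fin.rev k))) := by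
    intro i j
    rw [primeNeg_eq, Matrix.mul_apply]
    refine Finset.sum_congr rfl fun k _ => ?_
    rw [formTranspose_apply, mul_smul_comm, mul_comm (formSgn K κ k)]
    rfl
  have hS' : ∀ i j, primeNeg K κ (T * primeNeg K κ T) i j =
      ∑ k, (formSgn K κ j * formSgn K κ k) • (τ (T (Fin.rev j) (Fin.rev k)) * T i k) := by
    intro i j
    rw [primeNeg_eq, formTranspose_apply, Matrix.map_apply, hS, map_sum, Finset.smul_sum,
      ← Equiv.sum_comp Fin.revPerm]
    refine Finset.sum_congr rfl fun k _ => ?_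
    have e : ∀ (c : K) (f : A⟦X⟧), τ (c • f) = c • τ f := by
      intro c f
      rw [Algebra.smul_def, map_mul, hτ, affineHom_algebraMap, ← Algebra.smul_def]
    rw [e, map_mul, Fin.revPerm_apply, Fin.rev_rev, Fin.rev_rev, hττ, smul_smul,
      formSgn_rev_mul_rev]
    congr 1
    linear_combination formSgn K κ j * formSgn K κ k * formSgn_mul_self (K := K) κ i
  -- the difference of the two products, in terms of the transposed matrix
  have hD : ∀ i j, primeNeg K κ (T * primeNeg K κ T) i j - (T * primeNeg K κ T) i j =
      formSign K κ • (x * (primeNeg K κ (T * primeNeg K κ T) i j -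
        τ (primeNeg K κ (T * primeNeg K κ T) i j))) := by
    intro i j
    have e : ∀ (c : K) (f : A⟦X⟧), τ (c • f) = c • τ f := by
      intro c f
      rw [Algebra.smul_def, map_mul, hτ, affineHom_algebraMap, ← Algebra.smul_def]
    have h1 : primeNeg K κ (T * primeNeg K κ T) i j -
        τ (primeNeg K κ (T * primeNeg K κ T) i j) = ∑ k, (formSgn K κ j * formSgn K κ (Fin.rev k)) •
          (τ (T (Fin.rev j) k) * T i (Fin.rev k) - T (Fin.rev j) k * τ (T i (Fin.rev k))) := by
      rw [hS', map_sum, ← Finset.sum_sub_distrib, ← Equiv.sum_comp Fin.revPerm]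
      refine Finset.sum_congr rfl fun k _ => ?_
      rw [Fin.revPerm_apply, Fin.rev_rev, e, map_mul, hττ, smul_sub]
    rw [h1, hS', hS, ← Finset.sum_sub_distrib, Finset.mul_sum, Finset.smul_sum]
    refine Finset.sum_congr rfl fun k _ => ?_
    have h3 := hR i k (Fin.rev j) (Fin.rev k)
    simp only [one_mul, Matrix.map_apply] at h3
    rw [← smul_sub, ← neg_sub, h3, formSgn_rev, mul_smul_comm, smul_smul, ← mul_neg, neg_sub]
    congr 1
    linear_combination (-formSgn K κ j * formSgn K κ k) * formSign_mul_self (K := K) κ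
  ext1 i j
  have h3 := hD i j
  have h4 := congrArg τ h3
  rw [Algebra.smul_def, map_mul, map_mul, map_sub, map_sub, hτx, hττ, hτ, affineHom_algebraMap,
    ← Algebra.smul_def, ← hτ, neg_mul, ← mul_neg, neg_sub, ← h3] at h4
  -- The right side is even in u, because 1/(2u) and the difference are both odd; so the left side
  -- is even too.
  have h5 : primeNeg K κ (T * primeNeg K κ T) i j - τ (primeNeg K κ (T * primeNeg K κ T) i j) =
      (T * primeNeg K κ T) i j - τ ((T * primeNeg K κ T) i j) := by
    rw [sub_eq_sub_iff_add_eq_add] at h4 ⊢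
    rw [← h4, add_comm]
  rw [h5, sub_eq_iff_eq_add'] at h3
  rw [h3, symmetryRight, matrix_affineSubst]
  simp only [Matrix.add_apply, Matrix.smul_apply, Matrix.sub_apply, Matrix.map_apply, smul_eq_mul]
  rfl

end Specialization

end

end YangianDet

namespace YangianDet

noncomputable section

/-! ### The quantum determinant -/

section QuantumDeterminant

variable {N : ℕ} {K : Type*} [Field K] {A : Type*} [Ring A] [Algebra K A]

theorem tensorProduct_eq (T : Matrix (Fin N) (Fin N) A⟦X⟧) :
    tensorProduct K T = prodPos fun a : Fin N => T.map (affineHom A (1 : K) (-((a : ℕ) : K))) := by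
  simp only [tensorProduct, prodPos, matrix_affineSubst]

theorem rtt_shift {T : Matrix (Fin N) (Fin N) A⟦X⟧}
    (h : RTT (uInv * vInv) (vInv - uInv) (T.map inU) (T.map inV)) {a : K} (ha : a ≠ 0)
    (b b' : K) : RTT 1 (algebraMap K A⟦X⟧ (b - b')) (T.map (affineHom A a b))
      (T.map (affineHom A a b')) := by
  have h1 := rtt_affineHom h ha ha b b' (c := 1) (d := PowerSeries.C (b - b')) (by simp)
  rwa [scalarSeries_one, scalarSeries_C] at h1

theorem rtt_shift_one {T : Matrix (Fin N) (Fin N) A⟦X⟧}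
    (h : RTT (uInv * vInv) (vInv - uInv) (T.map inU) (T.map inV)) {a : K} (ha : a ≠ 0)
    {b b' : K} (hb : b - b' = 1) : RTT 1 1 (T.map (affineHom A a b))
      (T.map (affineHom A a b')) := by
  have h1 := rtt_shift h ha b b'
  rwa [hb, map_one] at h1

theorem antisymmetrizer_mul_tensorProduct (h2 : (2 : K) ≠ 0) {T : Matrix (Fin N) (Fin N) A⟦X⟧}
    (h : RTT (uInv * vInv) (vInv - uInv) (T.map inU) (T.map inV)) :
    antisymmetrizer N N A⟦X⟧ * tensorProduct K T =
      diagCoeff (antisymmetrizer N N A⟦X⟧ * tensorProduct K T) • antisymmetrizer N N A⟦X⟧ := by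
  rw [tensorProduct_eq]
  refine antisymmetrizer_mul_prodPos (series_two_torsion h2) _ fun i j hij =>
    rtt_shift_one h one_ne_zero ?_
  rw [hij]
  push_cast
  ring

variable {n : ℕ} (κ : FormType)

theorem map_prodPos {B B' : Type*} [Ring B] [Ring B'] (φ : B →+* B') {m : ℕ}
    (Z : Fin m → Matrix (Fin N) (Fin N) B) :
    (prodPos Z).map φ = prodPos fun a => (Z a).map φ := by
  have h : ∀ l : List (Fin m), (l.map fun a => atPos a (Z a)).prod.map φ =
      (l.map fun a => atPos a ((Z a).map φ)).prod := by
    intro l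
    induction l with
    | nil => simpa using map_one_tensor φ
    | cons a l ih => rw [List.map_cons, List.prod_cons, Matrix.map_mul, ih, map_atPos, List.map_cons,
        List.prod_cons]
  exact h _

/-- The parameters -u, -u+1, … increase, opposite to those in a quantum determinant, but
transposition reverses the ternary relation, so the product is still a multiple of A_N. Multiplying
by a second A_N allows transposition and reordering, after which it is the ordinary product at
-u+N-1. -/
theorem antisymmetrizer_mul_prodPos_formTranspose (h2 : (2 : K) ≠ 0)
    (hfac : ((2 * n).factorial : K) ≠ 0) {T : Matrix (Fin (2 * n)) (Fin (2 * n)) A⟦X⟧}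
    (h : RTT (uInv * vInv) (vInv - uInv) (T.map inU) (T.map inV)) :
    antisymmetrizer (2 * n) (2 * n) A⟦X⟧ *
        prodPos (fun a : Fin (2 * n) =>
          formTranspose K κ (T.map (affineHom A (-1 : K) ((a : ℕ) : K)))) =
      affineSubst (-1 : K) (((2 * n : ℕ) : K) - 1)
          (diagCoeff (antisymmetrizer (2 * n) (2 * n) A⟦X⟧ * tensorProduct K T)) •
        antisymmetrizer (2 * n) (2 * n) A⟦X⟧ := by
  have hneg : (-1 : K) ≠ 0 := neg_ne_zero.2 one_ne_zero
  set Y : Fin (2 * n) → Matrix (Fin (2 * n)) (Fin (2 * n)) A⟦X⟧ :=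
    fun a => T.map (affineHom A (-1 : K) ((a : ℕ) : K)) with hY
  have h1 := antisymmetrizer_mul_prodPos (N := 2 * n) (series_two_torsion (A := A) h2)
    (fun a => formTranspose K κ (Y a)) (fun i j hij => RTT.formTranspose κ
      (rtt_shift_one h hneg (by rw [hij]; push_cast; ring)))
  rw [h1]
  congr 1
  have h3 : doubleAnti (fun a => formTranspose K κ (Y a)) id id =
      (diagCoeff (antisymmetrizer (2 * n) (2 * n) A⟦X⟧ *
        prodPos fun a => formTranspose K κ (Y a)) •
          ((2 * n).factorial • antisymmetrizer (2 * n) (2 * n) A⟦X⟧)) id id := by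
    rw [doubleAnti, h1, smul_mul_assoc, antisymmetrizer_mul_self, ← h1]
  -- Position N-1-a carries -u+N-1-a, that is, the parameter u - a after u ↦ -u+N-1.
  have h4 : Y ∘ Fin.revPerm = fun a : Fin (2 * n) => (T.map (affineHom A (1 : K) (-((a : ℕ) : K)))).map
      (affineHom A (-1 : K) (((2 * n : ℕ) : K) - 1)) := by
    funext a
    rw [matrix_affineHom_affineHom hneg one_ne_zero]
    simp only [hY, Function.comp_apply, Fin.revPerm_apply, Fin.val_rev]
    rw [Nat.cast_sub (by omega)]
    congr 3
    · ring
    · push_cast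
      ring
  have h5 := doubleAnti_perm (K := K) h2 Y (fun i j _ => ⟨_, rtt_shift h hneg _ _, by
    rw [neg_sub]
    exact rtt_shift h hneg _ _⟩) Fin.revPerm
  rw [doubleAnti_formTranspose, ← h5, h4, doubleAnti, ← map_prodPos, ← tensorProduct_eq,
    ← map_antisymmetrizer (affineHom A (-1 : K) (((2 * n : ℕ) : K) - 1)), ← Matrix.map_mul,
    antisymmetrizer_mul_tensorProduct h2 h, map_smul_tensor, map_antisymmetrizer, smul_mul_assoc,
    antisymmetrizer_mul_self] at h3
  simp only [Matrix.smul_apply, antisymmetrizer_id_id, smul_eq_mul, nsmul_one] at h3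
  rw [affineSubst_eq]
  have h6 : (((2 * n).factorial : ℕ) : A⟦X⟧) = algebraMap K A⟦X⟧ ((2 * n).factorial : K) := by simp
  rw [h6, ← Algebra.commutes, ← Algebra.commutes, ← Algebra.smul_def, ← Algebra.smul_def] at h3
  -- The second antisymmetrizer contributed the factor N!, invertible in K.
  exact (smul_right_injective _ hfac h3).symm

end QuantumDeterminant

/-! ### The Sklyanin determinant -/

section SklyaninDeterminant

variable {K : Type*} [Field K] {A : Type*} [Ring A] [Algebra K A] {n : ℕ} (κ : FormType)

/-- Series over a `K`-algebra form an algebra over the scalar series. -/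
@[reducible] def seriesAlgebra (K : Type*) [Field K] (A : Type*) [Ring A] [Algebra K A] :
    Algebra K⟦X⟧ A⟦X⟧ :=
  RingHom.toAlgebra' (PowerSeries.map (algebraMap K A)) fun c x => scalarSeries_commute c x

attribute [local instance] seriesAlgebra

theorem series_smul_def (c : K⟦X⟧) (f : A⟦X⟧) : c • f = scalarSeries A c * f := rfl

theorem series_smul_tensor {ι : Type*} (c : K⟦X⟧) (M : Matrix ι ι A⟦X⟧) :
    c • M = scalarSeries A c • M := rfl

/-- The scalars `1 / (-u_a - u_b)`. -/
def bracketScalar (K : Type*) [Field K] {m : ℕ} (a b : Fin m) : K⟦X⟧ :=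
  affineInv (-2 : K) (((a : ℕ) : K) + ((b : ℕ) : K))

theorem bracketScalar_comm {m : ℕ} (a b : Fin m) : bracketScalar K a b = bracketScalar K b a := by
  rw [bracketScalar, bracketScalar, add_comm]

theorem bracketScalar_mul (h2 : (2 : K) ≠ 0) {m : ℕ} (a b : Fin m) :
    (PowerSeries.C (-2) + PowerSeries.C (((a : ℕ) : K) + ((b : ℕ) : K)) * PowerSeries.X) *
      bracketScalar K a b = PowerSeries.X :=
  affineInv_mul (neg_ne_zero.2 h2) _

/-- This is 1/z = 1/(z+1) + 1/(z(z+1)) for z = -2u+i+c. -/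
theorem bracketScalar_succ (h2 : (2 : K) ≠ 0) {m : ℕ} {i j : Fin m} (hij : (j : ℕ) = i + 1)
    (c : Fin m) : bracketScalar K i c =
      bracketScalar K j c + bracketScalar K i c * bracketScalar K j c := by
  have h1 := bracketScalar_mul h2 i c
  have h3 := bracketScalar_mul h2 j c
  rw [hij] at h3
  refine mul_left_cancel₀ (PowerSeries.X_ne_zero (R := K)) ?_
  simp only [map_add, Nat.cast_add, Nat.cast_one, map_one] at h1 h3
  linear_combination bracketScalar K j c * h1 - bracketScalar K i c * h3

/-- In an increasing list the elements larger than a are exactly those behind a, so the filtered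
product obeys the recursion. -/
theorem list_prod_filter_eq {ι R : Type*} [LinearOrder ι] [Monoid R] (X : ι → R) (Y : ι → ι → R)
    (F : List ι → R) (hnil : F [] = 1)
    (hcons : ∀ a l, F (a :: l) = X a * (l.map (Y a)).prod * F l) {l : List ι}
    (hl : l.Pairwise (· < ·)) :
    (l.map fun a => X a * ((l.filter fun b => a < b).map (Y a)).prod).prod = F l := by
  induction l with
  | nil => rw [hnil, List.map_nil, List.prod_nil]
  | cons a l ih =>
    rw [List.pairwise_cons] at hl
    rw [hcons, ← ih hl.2, List.map_cons, List.prod_cons]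
    congr 2
    · rw [List.filter_cons_of_neg (by simp), List.filter_eq_self.2 fun b hb => by simpa using hl.1 b hb]
    · refine List.map_congr_left fun b hb => ?_
      rw [List.filter_cons_of_neg (by simpa using (hl.1 b hb).le)]

theorem bracket_eq (S : Matrix (Fin (2 * n)) (Fin (2 * n)) A⟦X⟧) :
    bracket K κ S = bracketList K κ
      (fun a : Fin (2 * n) => S.map (affineHom A (1 : K) (-((a : ℕ) : K)))) (bracketScalar K)
      (List.finRange (2 * n)) := by
  rw [← list_prod_filter_eq
    (fun a : Fin (2 * n) => atPos a (S.map (affineHom A (1 : K) (-((a : ℕ) : K)))))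
    (rPrime K κ (bracketScalar K)) (bracketList K κ _ (bracketScalar K)) rfl (fun _ _ => rfl)
    (List.sortedLT_finRange (2 * n)).pairwise, bracket]
  congr 1
  refine List.map_congr_left fun a _ => ?_
  rw [matrix_affineSubst]
  congr 2
  refine List.map_congr_left fun b hb => ?_
  rw [rMatrixPrime_eq κ (ne_of_lt (by simpa using (List.mem_filter.1 hb).2)), one_smul]
  rfl

theorem series_smul_tensor_cancel {ι : Type*} {c : K⟦X⟧} (hc : c ≠ 0) {M M' : Matrix ι ι A⟦X⟧}
    (h : c • M = c • M') : M = M' := by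
  ext1 i j
  exact scalarSeries_mul_left_cancel hc (congrFun (congrFun h i) j)

/-- At u - i and u - i - 1 the cleared R and R' become nonzero scalars times 1 - P and 1 - βQ; these
scalars occur on both sides and cancel. -/
theorem intertwines_of_reflection (h2 : (2 : K) ≠ 0)
    {S : Matrix (Fin (2 * n)) (Fin (2 * n)) A⟦X⟧}
    (h : Reflection K κ (uInv * vInv) (vInv - uInv) (-vInv - uInv) (S.map inU) (S.map inV)
      (0 : Fin 2) 1) {m : ℕ} {i j : Fin m} (hij : (j : ℕ) = i + 1) :
    Intertwines (1 - flip (2 * n) A⟦X⟧ i j)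
      (atPos i (S.map (affineHom A (1 : K) (-((i : ℕ) : K)))) * rPrime K κ (bracketScalar K) i j *
        atPos j (S.map (affineHom A (1 : K) (-((j : ℕ) : K))))) := by
  have hne : i ≠ j := by
    rintro rfl
    omega
  have h1 := ((h.map κ (affineHom₂_algebraMap (1 : K) (-((i : ℕ) : K)) 1
    (-((j : ℕ) : K)))).emb κ hne)
  simp only [map_mul, map_sub, map_neg, affineHom₂_uInv, affineHom₂_vInv] at h1
  have hU : (S.map inU).map (affineHom₂ A (1 : K) (-((i : ℕ) : K)) 1 (-((j : ℕ) : K))) =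
      S.map (affineHom A (1 : K) (-((i : ℕ) : K))) := by
    ext1
    exact affineHom₂_inU _ _ _ _ _
  have hV : (S.map inV).map (affineHom₂ A (1 : K) (-((i : ℕ) : K)) 1 (-((j : ℕ) : K))) =
      S.map (affineHom A (1 : K) (-((j : ℕ) : K))) := by
    ext1
    exact affineHom₂_inV _ _ _ _ _
  rw [hU, hV] at h1
  have hx := affineInv_mul (one_ne_zero (α := K)) (-((i : ℕ) : K))
  have hy := affineInv_mul (one_ne_zero (α := K)) (-((j : ℕ) : K))
  have hx0 := affineInv_ne_zero (one_ne_zero (α := K)) (-((i : ℕ) : K))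
  have hy0 := affineInv_ne_zero (one_ne_zero (α := K)) (-((j : ℕ) : K))
  have hβ := bracketScalar_mul h2 i j
  generalize affineInv (1 : K) (-((i : ℕ) : K)) = x at *
  generalize affineInv (1 : K) (-((j : ℕ) : K)) = y at *
  rw [hij] at hβ hy
  simp only [map_add, map_neg, Nat.cast_add, Nat.cast_one, map_one] at hβ hx hy
  have hX := PowerSeries.X_ne_zero (R := K)
  -- With x = 1/(u - i) and y = 1/(u - i - 1), this says that the parameters differ by one, so R
  -- becomes xy(1 - P).
  have e1 : y - x = x * y := by
    refine mul_left_cancel₀ hX ?_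
    linear_combination x * hy - y * hx
  have e2 : (-y - x) * bracketScalar K i j = x * y := by
    refine mul_left_cancel₀ hX ?_
    have : PowerSeries.C (2 : K) = 1 + 1 := by
      rw [← one_add_one_eq_two, map_add, map_one]
    rw [this] at hβ
    linear_combination x * y * hβ + (bracketScalar K i j) * (x * hy + y * hx)
  have e3 : (-y - x) ≠ 0 := by
    intro h0
    rw [h0, zero_mul] at e2
    exact mul_ne_zero hx0 hy0 e2.symm
  rw [Reflection, rMatrix, ← scalarSeries_mul, ← scalarSeries_sub, ← scalarSeries_neg,
    ← scalarSeries_sub, e1] at h1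
  simp only [← series_smul_tensor] at h1
  have hR : (-y - x) • (1 : Matrix (Fin m → Fin (2 * n)) (Fin m → Fin (2 * n)) A⟦X⟧) -
      (x * y) • qOp K κ A⟦X⟧ i j = (-y - x) • rPrime K κ (bracketScalar K) i j := by
    rw [rPrime, smul_sub, smul_smul, e2]
  rw [← smul_sub, hR] at h1
  have h0 := mul_ne_zero (mul_ne_zero hx0 hy0) e3
  generalize x * y = e at *
  generalize -y - x = g at *
  refine ⟨atPos j (S.map (affineHom A (1 : K) (-((j : ℕ) : K)))) *
    rPrime K κ (bracketScalar K) i j * atPos i (S.map (affineHom A (1 : K) (-((i : ℕ) : K)))),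
    series_smul_tensor_cancel h0 ?_⟩
  simp only [smul_mul_assoc, mul_smul_comm, smul_smul, mul_assoc] at h1 ⊢
  first
  | exact h1
  | rw [mul_comm g e] at h1
    exact h1

theorem rightAnti_mul_bracket (h2 : (2 : K) ≠ 0)
    {S : Fin (2 * n) → Matrix (Fin (2 * n)) (Fin (2 * n)) A⟦X⟧}
    (hS : ∀ i j : Fin (2 * n), (j : ℕ) = i + 1 → Intertwines (1 - flip (2 * n) A⟦X⟧ i j)
      (atPos i (S i) * rPrime K κ (bracketScalar K) i j * atPos j (S j))) :
    antisymmetrizer (2 * n) (2 * n) A⟦X⟧ *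
        bracketList K κ S (bracketScalar K) (List.finRange (2 * n)) =
      diagCoeff (antisymmetrizer (2 * n) (2 * n) A⟦X⟧ *
        bracketList K κ S (bracketScalar K) (List.finRange (2 * n))) •
        antisymmetrizer (2 * n) (2 * n) A⟦X⟧ :=
  eq_smul_antisymmetrizer (series_two_torsion h2) (leftAnti_antisymmetrizer.mul _)
    (rightAnti_mul_bracketList κ S _ (series_two_torsion h2) bracketScalar_comm
      (fun _ _ hij c _ _ => bracketScalar_succ h2 hij c) hS)

theorem antisymmetrizer_mul_bracket (h2 : (2 : K) ≠ 0)
    {S : Matrix (Fin (2 * n)) (Fin (2 * n)) A⟦X⟧}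
    (h : Reflection K κ (uInv * vInv) (vInv - uInv) (-vInv - uInv) (S.map inU) (S.map inV)
      (0 : Fin 2) 1) :
    antisymmetrizer (2 * n) (2 * n) A⟦X⟧ * bracket K κ S =
      diagCoeff (antisymmetrizer (2 * n) (2 * n) A⟦X⟧ * bracket K κ S) •
        antisymmetrizer (2 * n) (2 * n) A⟦X⟧ := by
  rw [bracket_eq]
  exact rightAnti_mul_bracket κ h2 fun i j hij => intertwines_of_reflection κ h2 h hij

/-- Transfers the computation of α_N from the commutative ring K⟦X⟧ to A⟦X⟧. -/
theorem map_bracketList_one {B B' Z Z' : Type*} [Ring B] [Ring B'] [Algebra K B] [Algebra K B']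
    [CommRing Z] [CommRing Z'] [Algebra Z B] [Algebra Z' B'] {φ : B →+* B'}
    (hφ : ∀ c, φ (algebraMap K B c) = algebraMap K B' c) {m : ℕ} (β : Fin m → Fin m → Z)
    (β' : Fin m → Fin m → Z')
    (hβ : ∀ a b, φ (algebraMap Z B (β a b)) = algebraMap Z' B' (β' a b)) (l : List (Fin m)) :
    (bracketList K (n := n) κ (fun _ => (1 : Matrix _ _ B)) β l).map φ =
      bracketList K κ (fun _ => (1 : Matrix _ _ B')) β' l := by
  have h1 : ∀ a b, (rPrime K (n := n) (B := B) κ β a b).map φ = rPrime K κ β' a b := by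
    intro a b
    ext f g
    have h3 := congrFun (congrFun (map_qOp (n := n) κ hφ a b) f) g
    rw [Matrix.map_apply] at h3
    have h4 := congrFun (congrFun (map_one_tensor (N := 2 * n) (m := m) φ) f) g
    rw [Matrix.map_apply] at h4
    rw [rPrime, rPrime, Matrix.map_apply, Matrix.sub_apply, Matrix.sub_apply, Matrix.smul_apply,
      Matrix.smul_apply, map_sub, Algebra.smul_def, Algebra.smul_def, map_mul, hβ, h3, h4]
  have h3 : ∀ a (l : List (Fin m)), ((l.map (rPrime K (n := n) (B := B) κ β a)).prod).map φ =
      (l.map (rPrime K κ β' a)).prod := by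
    intro a l
    induction l with
    | nil => simpa using map_one_tensor φ
    | cons b l ih => rw [List.map_cons, List.prod_cons, Matrix.map_mul, ih, h1, List.map_cons,
        List.prod_cons]
  induction l with
  | nil => exact map_one_tensor φ
  | cons a l ih => rw [bracketList, bracketList, Matrix.map_mul, ih, Matrix.map_mul, h3, atPos_one,
      atPos_one, map_one_tensor]

theorem alpha_mul (h2 : (2 : K) ≠ 0) (q : ℕ) :
    (PowerSeries.C (2 : K) + PowerSeries.C (1 - (q : K)) * PowerSeries.X) *
      alpha K q FormType.symplectic = PowerSeries.C 2 + PowerSeries.X := by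
  rw [alpha, mul_comm, mul_assoc, PowerSeries.inv_mul_cancel, mul_one]
  simpa using h2

/-- In the orthogonal case every factor is 1. In the symplectic case the factors are
(-2u+2a-1)/(-2u+2a+1), and the product telescopes. -/
theorem prod_eq_alpha (h2 : (2 : K) ≠ 0) :
    ∏ a ∈ Finset.range n, (1 - (1 - formSign K κ) • affineInv (-2 : K) (2 * (a : K) + 1)) =
      alpha K (2 * n) κ := by
  cases κ with
  | orthogonal => simp [formSign, alpha]
  | symplectic =>
    have hne : ∀ n : ℕ, PowerSeries.C (2 : K) + PowerSeries.C (1 - ((2 * n : ℕ) : K)) *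
        PowerSeries.X ≠ 0 := by
      intro n h
      have := congrArg PowerSeries.constantCoeff h
      simp [h2] at this
    refine mul_left_cancel₀ (hne n) ?_
    rw [alpha_mul h2]
    induction n with
    | zero => simp [mul_comm]
    | succ n ih =>
      rw [Finset.prod_range_succ, ← ih]
      have h1 := affineInv_mul (neg_ne_zero.2 h2) (2 * (n : K) + 1)
      have h3 : (1 - formSign K FormType.symplectic) • affineInv (-2 : K) (2 * (n : K) + 1) =
          2 * affineInv (-2 : K) (2 * (n : K) + 1) := by
        rw [formSign, sub_neg_eq_add, one_add_one_eq_two, two_smul, ← two_mul]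
      rw [h3]
      push_cast at h1 ⊢
      simp only [map_sub, map_add, map_mul, map_neg, map_one, mul_add] at h1 ⊢
      generalize ∏ a ∈ Finset.range n, (1 - (1 - formSign K FormType.symplectic) •
        affineInv (-2 : K) (2 * (a : K) + 1)) = w at *
      have h4 : PowerSeries.C (2 : K) = 2 := by
        rw [← one_add_one_eq_two, map_add, map_one, one_add_one_eq_two]
      simp only [h4] at h1 ⊢
      linear_combination (2 * w) * h1

theorem diagCoeff_bracket_one (h2 : (2 : K) ≠ 0) :
    diagCoeff (antisymmetrizer (2 * n) (2 * n) A⟦X⟧ *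
      bracketList K κ (fun _ => 1) (bracketScalar K) (List.finRange (2 * n))) =
      scalarSeries A (alpha K (2 * n) κ) := by
  -- The recursion is 1/β_ac = 1/b_a + (c - a - 1) with 1/β_ac = -2u+a+c, which forces 1/b_a =
  -- -2u+2a+1.
  have h1 := diagCoeff_antisymmetrizer_mul_bracketList (K := K) (B := K⟦X⟧) (n := n) κ
    (series_two_torsion h2) (bracketScalar K) (fun a => affineInv (-2 : K) (2 * (a : K) + 1)) (by
      intro a c hac
      have e1 := bracketScalar_mul h2 a c
      have e2 := affineInv_mul (neg_ne_zero.2 h2) (2 * ((a : ℕ) : K) + 1)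
      have e3 : PowerSeries.C (-2) + PowerSeries.C (2 * ((a : ℕ) : K) + 1) * PowerSeries.X ≠ 0 := by
        intro h
        have := congrArg PowerSeries.constantCoeff h
        simp [h2] at this
      have e4 : (((c : ℕ) - a - 1 : ℕ) : K⟦X⟧) = PowerSeries.C ((c : ℕ) : K) -
          PowerSeries.C ((a : ℕ) : K) - 1 := by
        have := Fin.lt_def.1 hac
        rw [Nat.cast_sub (by omega), Nat.cast_sub (by omega)]
        simp
      refine mul_left_cancel₀ e3 ?_
      rw [e4]
      simp only [map_add, map_mul, map_neg, map_one] at e1 e2 ⊢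
      have h4 : PowerSeries.C (2 : K) = 2 := by
        rw [← one_add_one_eq_two, map_add, map_one, one_add_one_eq_two]
      simp only [h4] at e1 e2 ⊢
      generalize affineInv (-2 : K) (2 * ((a : ℕ) : K) + 1) = b at *
      linear_combination e1 - e2 + bracketScalar K a c * (PowerSeries.C ((c : ℕ) : K) -
          PowerSeries.C ((a : ℕ) : K) - 1) * e2)
  rw [prod_eq_alpha κ h2] at h1
  rw [← h1]
  let φ : K⟦X⟧ →+* A⟦X⟧ := PowerSeries.map (algebraMap K A)
  have h3 := map_bracketList_one (K := K) (n := n) κ (φ := φ) (Z' := K⟦X⟧)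
    (fun c => scalarSeries_C c) (bracketScalar K) (bracketScalar K) (fun _ _ => rfl)
    (List.finRange (2 * n))
  rw [← h3, ← map_antisymmetrizer φ, ← Matrix.map_mul]
  rfl

/-- With all S equal to 1 the required intertwining is just PQ = QP. -/
theorem antisymmetrizer_mul_bracket_one (h2 : (2 : K) ≠ 0) :
    antisymmetrizer (2 * n) (2 * n) A⟦X⟧ *
      bracketList K κ (fun _ => 1) (bracketScalar K) (List.finRange (2 * n)) =
      scalarSeries A (alpha K (2 * n) κ) • antisymmetrizer (2 * n) (2 * n) A⟦X⟧ := by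
  rw [← diagCoeff_bracket_one κ h2]
  refine rightAnti_mul_bracket κ h2 fun i j hij => ?_
  rw [atPos_one, atPos_one, one_mul, mul_one]
  refine Intertwines.of_commute (((Commute.one_left _).sub_left ?_))
  refine (rPrime_commute_of_commute κ _ ?_).symm
  rw [Commute, SemiconjBy, flip_mul_qOp, qOp_mul_flip]

/-- The three blocks of the factored bracket are absorbed by A_N from left to right, each leaving
its scalar in front. -/
theorem diagCoeff_bracket_mul_primeNeg (h2 : (2 : K) ≠ 0) (hfac : ((2 * n).factorial : K) ≠ 0)
    {T : Matrix (Fin (2 * n)) (Fin (2 * n)) A⟦X⟧}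
    (h : RTT (uInv * vInv) (vInv - uInv) (T.map inU) (T.map inV)) :
    diagCoeff (antisymmetrizer (2 * n) (2 * n) A⟦X⟧ * bracket K κ (T * primeNeg K κ T)) =
      scalarSeries A (alpha K (2 * n) κ) *
        diagCoeff (antisymmetrizer (2 * n) (2 * n) A⟦X⟧ * tensorProduct K T) *
        affineSubst (-1 : K) (((2 * n : ℕ) : K) - 1)
          (diagCoeff (antisymmetrizer (2 * n) (2 * n) A⟦X⟧ * tensorProduct K T)) := by
  have hneg : (-1 : K) ≠ 0 := neg_ne_zero.2 one_ne_zero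
  have h1 : ∀ a : Fin (2 * n), (T * primeNeg K κ T).map (affineHom A (1 : K) (-((a : ℕ) : K))) =
      T.map (affineHom A (1 : K) (-((a : ℕ) : K))) *
        formTranspose K κ (T.map (affineHom A (-1 : K) ((a : ℕ) : K))) := by
    intro a
    rw [Matrix.map_mul, primeNeg_eq, map_formTranspose κ (affineHom_algebraMap _ _),
      matrix_affineHom_affineHom one_ne_zero hneg]
    congr 4 <;> ring
  -- T' is taken at -u_a and T at u_b; the difference -u_a - u_b is precisely the argument of R'_ab.
  have h3 : ∀ a b : Fin (2 * n), a ≠ b →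
      atPos a (formTranspose K κ (T.map (affineHom A (-1 : K) ((a : ℕ) : K)))) *
        rPrime K κ (bracketScalar K) a b * atPos b (T.map (affineHom A (1 : K) (-((b : ℕ) : K)))) =
      atPos b (T.map (affineHom A (1 : K) (-((b : ℕ) : K)))) * rPrime K κ (bracketScalar K) a b *
        atPos a (formTranspose K κ (T.map (affineHom A (-1 : K) ((a : ℕ) : K)))) := by
    intro a b hab
    have h4 := rtt_affineHom h hneg one_ne_zero ((a : ℕ) : K) (-((b : ℕ) : K))
      (c := bracketScalar K a b) (d := 1) (by
        have := bracketScalar_mul h2 a b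
        rw [one_mul, mul_comm]
        convert this using 4
        · ring
        · ring)
    rw [scalarSeries_one] at h4
    have h5 := h4.formTranspose_left (K := K) κ (scalarSeries_commute _) (Commute.one_left) hab
    rwa [one_smul] at h5
  rw [bracket_eq]
  simp only [h1]
  rw [bracketList_mul κ _ _ _ h3 (List.nodup_finRange _)]
  change diagCoeff (_ * (prodPos _ * _ * prodPos _)) = _
  rw [← tensorProduct_eq, mul_assoc, ← mul_assoc (antisymmetrizer _ _ _),
    antisymmetrizer_mul_tensorProduct h2 h, ← mul_assoc, smul_mul_assoc,
    antisymmetrizer_mul_bracket_one κ h2, smul_mul_assoc, smul_mul_assoc,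
    antisymmetrizer_mul_prodPos_formTranspose κ h2 hfac h]
  rw [diagCoeff]
  simp only [Matrix.smul_apply, antisymmetrizer_id_id, smul_eq_mul, mul_one]
  rw [← mul_assoc, (scalarSeries_commute _ _).eq]
  simp only [diagCoeff, Matrix.smul_apply, antisymmetrizer_id_id, smul_eq_mul, mul_one]

theorem map_bracket {A' : Type*} [Ring A'] [Algebra K A'] (φ : A →ₐ[K] A')
    (S : Matrix (Fin (2 * n)) (Fin (2 * n)) A⟦X⟧) :
    (bracket K κ S).map (PowerSeries.map φ.toRingHom) =
      bracket K κ (S.map (PowerSeries.map φ.toRingHom)) := by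
  have h1 : ∀ {ι : Type} (l : List ι) (X : ι → Matrix (Fin (2 * n) → Fin (2 * n))
      (Fin (2 * n) → Fin (2 * n)) A⟦X⟧) (Y : ι → Matrix (Fin (2 * n) → Fin (2 * n))
      (Fin (2 * n) → Fin (2 * n)) A'⟦X⟧),
      (∀ a ∈ l, (X a).map (PowerSeries.map φ.toRingHom) = Y a) →
      ((l.map X).prod).map (PowerSeries.map φ.toRingHom) = (l.map Y).prod := by
    intro ι l X Y hXY
    induction l with
    | nil => simpa using map_one_tensor _
    | cons b l ih =>
      rw [List.map_cons, List.prod_cons, Matrix.map_mul, ih fun a ha => hXY a (by simp [ha]),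
        hXY b (by simp), List.map_cons, List.prod_cons]
  rw [bracket, bracket]
  refine h1 _ _ _ fun a _ => ?_
  rw [Matrix.map_mul, map_atPos, map_affineSubst]
  congr 1
  refine h1 _ _ _ fun b hb => ?_
  have hab : a ≠ b := ne_of_lt (by simpa using (List.mem_filter.1 hb).2)
  rw [rMatrixPrime_eq κ hab, rMatrixPrime_eq κ hab, map_sub_tensor, map_smul_tensor,
    map_smul_tensor, map_one_tensor, map_qOp κ (map_algebraMap_series φ), map_one, map_scalarSeries]

end SklyaninDeterminant

end

end YangianDet

namespace YangianDet

noncomputable section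

/-! ### Filtrations by words in weighted generators -/

section Filtration

variable {K : Type*} [Field K] {A : Type*} [Ring A] [Algebra K A] {Λ : Type*} (s : Λ → A)
  (wt : Λ → ℕ)

/-- The span of the words in the generators `s` whose weight is at most `e - k`. -/
def wordSpan (K : Type*) [Field K] {A : Type*} [Ring A] [Algebra K A] {Λ : Type*} (s : Λ → A)
    (wt : Λ → ℕ) (k e : ℕ) : Submodule K A :=
  Submodule.span K {x | ∃ l : List Λ, (l.map wt).sum + k ≤ e ∧ (l.map s).prod = x}

variable {s wt}

theorem word_mem_wordSpan {k e : ℕ} {l : List Λ} (h : (l.map wt).sum + k ≤ e) :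
    (l.map s).prod ∈ wordSpan K s wt k e :=
  Submodule.subset_span ⟨l, h, rfl⟩

theorem wordSpan_mono {k e k' e' : ℕ} (h : e + k' ≤ e' + k) :
    wordSpan K s wt k e ≤ wordSpan K s wt k' e' := by
  refine Submodule.span_mono ?_
  rintro _ ⟨l, hl, rfl⟩
  exact ⟨l, by omega, rfl⟩

theorem mul_mem_wordSpan {k e k' e' : ℕ} {x y : A} (hx : x ∈ wordSpan K s wt k e)
    (hy : y ∈ wordSpan K s wt k' e') : x * y ∈ wordSpan K s wt (k + k') (e + e') := by
  have h := Submodule.mul_mem_mul hx hy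
  rw [wordSpan, wordSpan, Submodule.span_mul_span] at h
  refine Submodule.span_mono ?_ h
  rintro _ ⟨_, ⟨l, hl, rfl⟩, _, ⟨l', hl', rfl⟩, rfl⟩
  refine ⟨l ++ l', ?_, by simp⟩
  rw [List.map_append, List.sum_append]
  omega

theorem one_mem_wordSpan (e : ℕ) : (1 : A) ∈ wordSpan K s wt 0 e :=
  word_mem_wordSpan (l := []) (by simp)

theorem algebraMap_mem_wordSpan (c : K) (e : ℕ) : algebraMap K A c ∈ wordSpan K s wt 0 e := by
  rw [Algebra.algebraMap_eq_smul_one]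
  exact Submodule.smul_mem _ _ (one_mem_wordSpan e)

/-- There are no words of negative weight, and the bound is written without subtraction so that this
space is zero. The descent on weights ends here. -/
theorem wordSpan_one_zero : wordSpan K s wt 1 0 = ⊥ := by
  rw [wordSpan, Submodule.span_eq_bot]
  rintro _ ⟨l, hl, -⟩
  omega

theorem gen_mem_wordSpan (a : Λ) : s a ∈ wordSpan K s wt 0 (wt a) := by
  simpa using word_mem_wordSpan (K := K) (s := s) (wt := wt) (k := 0) (l := [a]) (e := wt a)
    (by simp)

variable (K s wt)

/-- The pairs of a polynomial and an element that agree up to words of weight less than `d`. -/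
def symbolPairs (d : ℕ) : Submodule K (MvPolynomial Λ K × A) :=
  Submodule.span K ({z | ∃ l : List Λ, (l.map wt).sum = d ∧
    ((l.map MvPolynomial.X).prod, (l.map s).prod) = z} ∪
    {z | z.1 = 0 ∧ z.2 ∈ wordSpan K s wt 1 d})

variable {K s wt}

theorem word_mem_symbolPairs (l : List Λ) :
    ((l.map MvPolynomial.X).prod, (l.map s).prod) ∈ symbolPairs K s wt (l.map wt).sum :=
  Submodule.subset_span (Or.inl ⟨l, rfl, rfl⟩)

theorem lower_mem_symbolPairs {d : ℕ} {y : A} (h : y ∈ wordSpan K s wt 1 d) :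
    (0, y) ∈ symbolPairs K s wt d :=
  Submodule.subset_span (Or.inr ⟨rfl, h⟩)

theorem snd_mem_wordSpan {d : ℕ} {z : MvPolynomial Λ K × A} (h : z ∈ symbolPairs K s wt d) :
    z.2 ∈ wordSpan K s wt 0 d := by
  induction h using Submodule.span_induction with
  | mem z hz =>
    rcases hz with ⟨l, hl, rfl⟩ | ⟨-, hz⟩
    · exact word_mem_wordSpan (by omega)
    · exact wordSpan_mono (by omega) hz
  | zero => exact Submodule.zero_mem _
  | add z z' _ _ h h' => exact Submodule.add_mem _ h h'
  | smul c z _ h => exact Submodule.smul_mem _ c h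

/-- Symbols multiply. They form a relation instead of a map because no PBW theorem is assumed: a
priori one element may have several symbols. -/
theorem mul_mem_symbolPairs {d d' : ℕ} {z z' : MvPolynomial Λ K × A}
    (h : z ∈ symbolPairs K s wt d) (h' : z' ∈ symbolPairs K s wt d') :
    z * z' ∈ symbolPairs K s wt (d + d') := by
  have hz0 := snd_mem_wordSpan h
  have key := Submodule.mul_mem_mul h h'
  rw [symbolPairs, symbolPairs, Submodule.span_mul_span] at key
  refine Submodule.span_le.2 ?_ key
  rintro _ ⟨x, hx, y, hy, rfl⟩
  have hx2 := snd_mem_wordSpan (Submodule.subset_span hx : x ∈ symbolPairs K s wt d)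
  have hy2 := snd_mem_wordSpan (Submodule.subset_span hy : y ∈ symbolPairs K s wt d')
  rcases hx with ⟨l, hl, rfl⟩ | ⟨hx, hx'⟩
  · rcases hy with ⟨l', hl', rfl⟩ | ⟨hy, hy'⟩
    · have := word_mem_symbolPairs (K := K) (s := s) (wt := wt) (l ++ l')
      rwa [List.map_append, List.map_append, List.map_append, List.sum_append, List.prod_append,
        List.prod_append, hl, hl'] at this
    · refine Submodule.subset_span (Or.inr ⟨by simp [hy], ?_⟩)
      exact wordSpan_mono (by omega) (mul_mem_wordSpan hx2 hy')
  · refine Submodule.subset_span (Or.inr ⟨by simp [hx], ?_⟩)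
    exact wordSpan_mono (by omega) (mul_mem_wordSpan hx' hy2)

/-- A permutation of a word is reached by adjacent exchanges, each costing a commutator of lower
weight. -/
theorem list_prod_sub_mem_wordSpan
    (hcomm : ∀ a b, s a * s b - s b * s a ∈ wordSpan K s wt 1 (wt a + wt b)) {l l' : List Λ}
    (h : l.Perm l') : (l.map s).prod - (l'.map s).prod ∈ wordSpan K s wt 1 (l.map wt).sum := by
  induction h with
  | nil => simp
  | cons a h ih =>
    simp only [List.map_cons, List.prod_cons, List.sum_cons, ← mul_sub]
    exact wordSpan_mono (by omega) (mul_mem_wordSpan (gen_mem_wordSpan a) ih)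
  | swap a b l =>
    simp only [List.map_cons, List.prod_cons, List.sum_cons]
    rw [← mul_assoc, ← mul_assoc, ← sub_mul]
    exact wordSpan_mono (by omega) (mul_mem_wordSpan (hcomm b a)
      (word_mem_wordSpan (k := 0) (l := l) le_rfl))
  | trans h₁ h₂ ih₁ ih₂ =>
    rw [← (h₁.map wt).sum_eq] at ih₂
    simpa using Submodule.add_mem _ ih₁ ih₂

/-- A linear section from polynomials to words. -/
def wordMap (K : Type*) [Field K] {A : Type*} [Ring A] [Algebra K A] {Λ : Type*} (s : Λ → A) :
    MvPolynomial Λ K →ₗ[K] A :=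
  (MvPolynomial.basisMonomials Λ K).constr K fun m =>
    ((Finsupp.toMultiset m).toList.map s).prod

theorem prod_X_eq_monomial [DecidableEq Λ] (l : List Λ) :
    (l.map (MvPolynomial.X : Λ → MvPolynomial Λ K)).prod =
      MvPolynomial.monomial (Multiset.toFinsupp (l : Multiset Λ)) 1 := by
  induction l with
  | nil => simp
  | cons a l ih =>
    rw [List.map_cons, List.prod_cons, ih, ← Multiset.cons_coe, ← Multiset.singleton_add, map_add,
      Multiset.toFinsupp_singleton, MvPolynomial.X, MvPolynomial.monomial_mul, one_mul]

/-- The ordering of letters chosen in `wordMap` is immaterial modulo lower weight. Consequently an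
element with symbol zero has lower weight. -/
theorem sub_wordMap_mem_wordSpan
    (hcomm : ∀ a b, s a * s b - s b * s a ∈ wordSpan K s wt 1 (wt a + wt b)) {d : ℕ}
    {z : MvPolynomial Λ K × A} (h : z ∈ symbolPairs K s wt d) :
    z.2 - wordMap K s z.1 ∈ wordSpan K s wt 1 d := by
  classical
  induction h using Submodule.span_induction with
  | mem z hz =>
    rcases hz with ⟨l, rfl, rfl⟩ | ⟨hz, hz'⟩
    · have h1 : wordMap K s (l.map MvPolynomial.X).prod =
          (((l : Multiset Λ).toList).map s).prod := by
        have h3 := (MvPolynomial.basisMonomials Λ K).constr_basis K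
          (fun m => ((Finsupp.toMultiset m).toList.map s).prod) (Multiset.toFinsupp (l : Multiset Λ))
        rw [MvPolynomial.coe_basisMonomials, Multiset.toFinsupp_toMultiset] at h3
        rw [prod_X_eq_monomial, ← h3]
        rfl
      rw [h1]
      refine list_prod_sub_mem_wordSpan hcomm ?_
      rw [← Multiset.coe_eq_coe, Multiset.coe_toList]
    · rwa [hz, map_zero, sub_zero]
  | zero => simp
  | add z z' _ _ h h' =>
    rw [Prod.fst_add, Prod.snd_add, map_add, add_sub_add_comm]
    exact Submodule.add_mem _ h h'
  | smul c z _ h =>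
    rw [Prod.smul_fst, Prod.smul_snd, map_smul, ← smul_sub]
    exact Submodule.smul_mem _ c h

variable (K) in
/-- The variables, symmetrized under an involution with signs `ε`. -/
def symVar (star : Λ → Λ) (ε : Λ → K) (a : Λ) : MvPolynomial Λ K :=
  (2⁻¹ : K) • (MvPolynomial.X a + ε a • MvPolynomial.X (star a))

/-- Modulo lower weight s_a equals ε_a s_a*, hence also the average of the two. -/
theorem symVar_mem_symbolPairs (h2 : (2 : K) ≠ 0) {star : Λ → Λ} {ε : Λ → K}
    (hwt : ∀ a, wt (star a) = wt a)
    (hsym : ∀ a, s a - ε a • s (star a) ∈ wordSpan K s wt 1 (wt a)) (a : Λ) :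
    (symVar K star ε a, s a) ∈ symbolPairs K s wt (wt a) := by
  have h1 : ∀ b, (MvPolynomial.X b, s b) ∈ symbolPairs K s wt (wt b) := by
    intro b
    simpa using word_mem_symbolPairs (K := K) (s := s) (wt := wt) [b]
  have h3 := h1 (star a)
  rw [hwt] at h3
  have h4 := Submodule.smul_mem _ (2⁻¹ : K) (Submodule.add_mem _ (Submodule.add_mem _ (h1 a)
    (Submodule.smul_mem _ (ε a) h3)) (lower_mem_symbolPairs (hsym a)))
  convert h4 using 1
  ext1
  · simp [symVar]
  · simp only [Prod.snd_add, Prod.smul_snd, add_sub_cancel, add_add_sub_cancel, ← two_smul K (s a),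
      smul_smul, inv_mul_cancel₀ h2, one_smul]

theorem exists_symVar_mem_symbolPairs (h2 : (2 : K) ≠ 0) {star : Λ → Λ} {ε : Λ → K}
    (hwt : ∀ a, wt (star a) = wt a)
    (hsym : ∀ a, s a - ε a • s (star a) ∈ wordSpan K s wt 1 (wt a)) {d : ℕ} {y : A}
    (hy : y ∈ wordSpan K s wt 0 d) : ∃ f : MvPolynomial Λ K,
      (MvPolynomial.aeval (symVar K star ε) f, y) ∈ symbolPairs K s wt d := by
  induction hy using Submodule.span_induction with
  | mem y hy =>
    obtain ⟨l, hl, rfl⟩ := hy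
    rcases lt_or_eq_of_le hl with h | h
    · exact ⟨0, by
        rw [map_zero]
        exact lower_mem_symbolPairs (word_mem_wordSpan (by omega))⟩
    · refine ⟨(l.map MvPolynomial.X).prod, ?_⟩
      rw [← h, add_zero, map_list_prod, List.map_map]
      clear hl h
      induction l with
      | nil => simpa using word_mem_symbolPairs (K := K) (s := s) (wt := wt) []
      | cons a l ih =>
        have := mul_mem_symbolPairs (symVar_mem_symbolPairs h2 hwt hsym a) ih
        simpa using this
  | zero => exact ⟨0, by rw [map_zero]; exact Submodule.zero_mem _⟩
  | add y y' _ _ h h' =>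
    obtain ⟨f, hf⟩ := h
    obtain ⟨f', hf'⟩ := h'
    exact ⟨f + f', by rw [map_add]; exact Submodule.add_mem _ hf hf'⟩
  | smul c y _ h =>
    obtain ⟨f, hf⟩ := h
    exact ⟨c • f, by rw [map_smul]; exact Submodule.smul_mem _ c hf⟩

/-- A criterion for the injectivity of a homomorphism: it suffices that it detects symbols. -/
theorem injective_of_symbols (h2 : (2 : K) ≠ 0) {star : Λ → Λ} {ε : Λ → K}
    (hwt : ∀ a, wt (star a) = wt a)
    (hcomm : ∀ a b, s a * s b - s b * s a ∈ wordSpan K s wt 1 (wt a + wt b))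
    (hsym : ∀ a, s a - ε a • s (star a) ∈ wordSpan K s wt 1 (wt a))
    (hspan : ∀ y, ∃ d, y ∈ wordSpan K s wt 0 d) {A' : Type*} [Ring A'] [Algebra K A']
    (φ : A →ₐ[K] A')
    (hφ : ∀ d y (f : MvPolynomial Λ K),
      (MvPolynomial.aeval (symVar K star ε) f, y) ∈ symbolPairs K s wt d → φ y = 0 →
      MvPolynomial.aeval (symVar K star ε) f = 0) : Function.Injective φ := by
  rw [injective_iff_map_eq_zero]
  intro y hy
  have hd : ∀ d, y ∈ wordSpan K s wt 0 d → y ∈ wordSpan K s wt 1 d := by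
    intro d h
    obtain ⟨f, hf⟩ := exists_symVar_mem_symbolPairs h2 hwt hsym h
    have h1 := sub_wordMap_mem_wordSpan hcomm hf
    rwa [hφ d y f hf hy, map_zero, sub_zero] at h1
  obtain ⟨d, h⟩ := hspan y
  induction d with
  | zero =>
    have h1 := hd 0 h
    rwa [wordSpan_one_zero, Submodule.mem_bot] at h1
  | succ d ih => exact ih (wordSpan_mono (by omega) (hd _ h))

/-! ### Weights of series in two variables -/

variable (K s wt) in
/-- The coefficient of `u⁻ʳ v⁻ᑫ` has weight at most `r + q - k`. -/
def HasWeight (k : ℕ) (F : A⟦X⟧⟦X⟧) : Prop :=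
  ∀ r q, PowerSeries.coeff r (PowerSeries.coeff q F) ∈ wordSpan K s wt k (r + q)

theorem HasWeight.mono {k k' : ℕ} (hk : k' ≤ k) {F : A⟦X⟧⟦X⟧} (h : HasWeight K s wt k F) :
    HasWeight K s wt k' F :=
  fun r q => wordSpan_mono (by omega) (h r q)

theorem HasWeight.zero (k : ℕ) : HasWeight K s wt k 0 := fun r q => by simp

theorem HasWeight.add {k : ℕ} {F G : A⟦X⟧⟦X⟧} (hF : HasWeight K s wt k F)
    (hG : HasWeight K s wt k G) : HasWeight K s wt k (F + G) := fun r q => by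
  rw [map_add, map_add]
  exact Submodule.add_mem _ (hF r q) (hG r q)

theorem HasWeight.sub {k : ℕ} {F G : A⟦X⟧⟦X⟧} (hF : HasWeight K s wt k F)
    (hG : HasWeight K s wt k G) : HasWeight K s wt k (F - G) := fun r q => by
  rw [map_sub, map_sub]
  exact Submodule.sub_mem _ (hF r q) (hG r q)

theorem HasWeight.sum {ι : Type*} (t : Finset ι) {k : ℕ} {F : ι → A⟦X⟧⟦X⟧}
    (hF : ∀ i ∈ t, HasWeight K s wt k (F i)) : HasWeight K s wt k (∑ i ∈ t, F i) := fun r q => by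
  rw [map_sum, map_sum]
  exact Submodule.sum_mem _ fun i hi => hF i hi r q

theorem HasWeight.mul {k k' : ℕ} {F G : A⟦X⟧⟦X⟧} (hF : HasWeight K s wt k F)
    (hG : HasWeight K s wt k' G) : HasWeight K s wt (k + k') (F * G) := fun r q => by
  rw [PowerSeries.coeff_mul, map_sum]
  refine Submodule.sum_mem _ fun i hi => ?_
  rw [PowerSeries.coeff_mul]
  refine Submodule.sum_mem _ fun j hj => ?_
  rw [Finset.HasAntidiagonal.mem_antidiagonal] at hi hj
  exact wordSpan_mono (by omega) (mul_mem_wordSpan (hF _ _) (hG _ _))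

theorem hasWeight_inU {f : A⟦X⟧} {k : ℕ}
    (h : ∀ r, PowerSeries.coeff r f ∈ wordSpan K s wt k r) : HasWeight K s wt k (inU f) :=
  fun r q => by
    rw [inU, PowerSeries.coeff_C]
    split_ifs with hq
    · rw [hq]
      exact h r
    · simp

theorem hasWeight_inV {f : A⟦X⟧} {k : ℕ}
    (h : ∀ r, PowerSeries.coeff r f ∈ wordSpan K s wt k r) : HasWeight K s wt k (inV f) :=
  fun r q => by
    rw [inV, PowerSeries.coeff_map, PowerSeries.coeff_C]
    split_ifs with hr
    · rw [hr, zero_add]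
      exact h q
    · simp

theorem coeff_X_mem_wordSpan (r : ℕ) :
    PowerSeries.coeff r (PowerSeries.X : A⟦X⟧) ∈ wordSpan K s wt 1 r := by
  rw [PowerSeries.coeff_X]
  split_ifs with h
  · rw [h]
    exact wordSpan_mono (by omega) (one_mem_wordSpan 0)
  · simp

theorem hasWeight_uInv : HasWeight K s wt 1 (uInv : A⟦X⟧⟦X⟧) := hasWeight_inU coeff_X_mem_wordSpan

theorem hasWeight_vInv : HasWeight K s wt 1 (vInv : A⟦X⟧⟦X⟧) := hasWeight_inV coeff_X_mem_wordSpan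

theorem hasWeight_algebraMap (c : K) : HasWeight K s wt 0 (algebraMap K A⟦X⟧⟦X⟧ c) := by
  rw [← inU_algebraMap]
  refine hasWeight_inU fun r => ?_
  rw [PowerSeries.algebraMap_apply, PowerSeries.coeff_C]
  split_ifs
  · exact algebraMap_mem_wordSpan c r
  · simp

/-- The coefficient of u⁻ʳ⁻² v⁻ᑫ in the product is F_{r,q} - F_{r+2,q-2}, both of the same total
degree; induction on q peels off the second term. -/
theorem HasWeight.of_sq_sub_sq_mul {F : A⟦X⟧⟦X⟧}
    (h : HasWeight K s wt 3 ((uInv ^ 2 - vInv ^ 2) * F)) : HasWeight K s wt 1 F := by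
  intro r q
  induction q using Nat.strong_induction_on generalizing r with
  | _ q ih =>
    have h1 := h (r + 2) q
    rw [sub_mul, map_sub, map_sub, uInv, vInv, inU, inV, PowerSeries.map_X, ← map_pow,
      PowerSeries.coeff_C_mul, PowerSeries.coeff_X_pow_mul, PowerSeries.coeff_X_pow_mul'] at h1
    have h3 : PowerSeries.coeff (r + 2) (if 2 ≤ q then PowerSeries.coeff (q - 2) F else 0) ∈
        wordSpan K s wt 1 (r + q) := by
      split_ifs with hq
      · have := ih (q - 2) (by omega) (r + 2)
        rwa [show r + 2 + (q - 2) = r + q by omega] at this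
      · simp
    have h4 := Submodule.add_mem _ (wordSpan_mono (k' := 1) (e' := r + q) (by omega) h1) h3
    rwa [sub_add_cancel] at h4

end Filtration

/-! ### The filtration of the twisted Yangian -/

section MatrixWeights

variable {K : Type*} [Field K] {A : Type*} [Ring A] [Algebra K A] {Λ : Type*} {s : Λ → A}
  {wt : Λ → ℕ} {m n : ℕ} (κ : FormType)

variable (K s wt) in
/-- A matrix whose entries have the given weight. -/
def MatHasWeight (k : ℕ) {ι : Type*} (M : Matrix ι ι A⟦X⟧⟦X⟧) : Prop :=
  ∀ i j, HasWeight K s wt k (M i j)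

theorem MatHasWeight.mul {k k' : ℕ} {ι : Type*} [Fintype ι] {M M' : Matrix ι ι A⟦X⟧⟦X⟧}
    (h : MatHasWeight K s wt k M) (h' : MatHasWeight K s wt k' M') :
    MatHasWeight K s wt (k + k') (M * M') := fun i j =>
  HasWeight.sum _ fun l _ => (h i l).mul (h' l j)

theorem MatHasWeight.smul {k k' : ℕ} {ι : Type*} {c : A⟦X⟧⟦X⟧} {M : Matrix ι ι A⟦X⟧⟦X⟧}
    (hc : HasWeight K s wt k c) (h : MatHasWeight K s wt k' M) :
    MatHasWeight K s wt (k + k') (c • M) := fun i j => hc.mul (h i j)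

theorem matHasWeight_one {ι : Type*} [DecidableEq ι] :
    MatHasWeight K s wt 0 (1 : Matrix ι ι A⟦X⟧⟦X⟧) := fun i j => by
  rw [Matrix.one_apply]
  split_ifs
  · simpa using hasWeight_algebraMap (A := A) (s := s) (wt := wt) (1 : K)
  · exact HasWeight.zero 0

theorem matHasWeight_flip (a b : Fin m) : MatHasWeight K s wt 0 (flip n A⟦X⟧⟦X⟧ a b) :=
  fun f g => by
    rw [flip, Matrix.of_apply]
    split_ifs
    · simpa using hasWeight_algebraMap (A := A) (s := s) (wt := wt) (1 : K)
    · exact HasWeight.zero 0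

theorem matHasWeight_qOp (a b : Fin m) :
    MatHasWeight K s wt 0 (qOp K (n := n) κ A⟦X⟧⟦X⟧ a b) := fun f g => by
  rw [qOp, Matrix.of_apply]
  split_ifs
  · exact hasWeight_algebraMap _
  · exact HasWeight.zero 0

theorem matHasWeight_atPos {N k : ℕ} (a : Fin m) {M : Matrix (Fin N) (Fin N) A⟦X⟧⟦X⟧}
    (h : MatHasWeight K s wt k M) : MatHasWeight K s wt k (atPos a M) := fun f g => by
  rw [atPos, Matrix.of_apply]
  split_ifs
  · exact h _ _
  · exact HasWeight.zero k

theorem MatHasWeight.sub {k : ℕ} {ι : Type*} {M M' : Matrix ι ι A⟦X⟧⟦X⟧}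
    (h : MatHasWeight K s wt k M) (h' : MatHasWeight K s wt k M') :
    MatHasWeight K s wt k (M - M') := fun i j => (h i j).sub (h' i j)

theorem MatHasWeight.add {k : ℕ} {ι : Type*} {M M' : Matrix ι ι A⟦X⟧⟦X⟧}
    (h : MatHasWeight K s wt k M) (h' : MatHasWeight K s wt k M') :
    MatHasWeight K s wt k (M + M') := fun i j => (h i j).add (h' i j)

theorem MatHasWeight.mono {k k' : ℕ} (hk : k' ≤ k) {ι : Type*} {M : Matrix ι ι A⟦X⟧⟦X⟧}
    (h : MatHasWeight K s wt k M) : MatHasWeight K s wt k' M := fun i j => (h i j).mono hk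

/-- The relation solved for the commutator: every other term carries a factor c. -/
theorem Reflection.commutator {m : ℕ} {B : Type*} [Ring B] [Algebra K B] {c d₁ d₂ : B}
    {S S' : Matrix (Fin (2 * n)) (Fin (2 * n)) B} {a b : Fin m}
    (h : Reflection K κ c d₁ d₂ S S' a b) (hc : ∀ x, Commute c x) (hd₁ : ∀ x, Commute d₁ x)
    (hd₂ : ∀ x, Commute d₂ x) :
    (d₁ * d₂) • (atPos a S * atPos b S' - atPos b S' * atPos a S) =
      (d₁ • (c • (atPos a S * qOp K κ B a b * atPos b S')) + c • (flip (2 * n) B a b *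
        (atPos a S * (d₂ • (1 : Matrix _ _ B) - c • qOp K κ B a b) * atPos b S'))) -
      (d₁ • (c • (atPos b S' * qOp K κ B a b * atPos a S)) + c • (atPos b S' *
        (d₂ • (1 : Matrix _ _ B) - c • qOp K κ B a b) * atPos a S * flip (2 * n) B a b)) := by
  rw [Reflection, rMatrix] at h
  generalize atPos a S = S₁ at *
  generalize atPos b S' = S₂ at *
  generalize qOp K κ B a b = Q at *
  generalize flip (2 * n) B a b = P at *
  have e1 : S₁ * (d₂ • (1 : Matrix (Fin m → Fin (2 * n)) _ B) - c • Q) * S₂ =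
      d₂ • (S₁ * S₂) - c • (S₁ * Q * S₂) := by
    rw [mul_sub, mul_smul_of_central hd₂, mul_smul_of_central hc, mul_one, sub_mul, smul_mul_assoc,
      smul_mul_assoc]
  have e2 : S₂ * (d₂ • (1 : Matrix (Fin m → Fin (2 * n)) _ B) - c • Q) * S₁ =
      d₂ • (S₂ * S₁) - c • (S₂ * Q * S₁) := by
    rw [mul_sub, mul_smul_of_central hd₂, mul_smul_of_central hc, mul_one, sub_mul, smul_mul_assoc,
      smul_mul_assoc]
  generalize d₂ • (1 : Matrix (Fin m → Fin (2 * n)) _ B) - c • Q = R at *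
  rw [mul_sub (S₂ * R * S₁), mul_smul_of_central hd₁, mul_smul_of_central hc, mul_one, sub_mul,
    sub_mul, sub_mul] at h
  simp only [smul_mul_assoc, one_mul] at h
  rw [mul_assoc P, mul_assoc P, e1, e2, smul_sub, smul_sub] at h
  rw [e1, e2, smul_sub, mul_smul, mul_smul]
  linear_combination (norm := abel) h

/-- With c = u⁻¹v⁻¹ of weight drop 2 and d₁, d₂ of drop 1, each term on the right drops by 3; the
factor d₁d₂ = u⁻² - v⁻² in front of the commutator is divided out at the price of 2. -/
theorem commutator_hasWeight {S : Matrix (Fin (2 * n)) (Fin (2 * n)) A⟦X⟧}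
    (hS : ∀ i j r, PowerSeries.coeff r (S i j) ∈ wordSpan K s wt 0 r)
    (h : Reflection K κ (uInv * vInv) (vInv - uInv) (-vInv - uInv) (S.map inU) (S.map inV)
      (0 : Fin 2) 1) (i j k l : Fin (2 * n)) :
    HasWeight K s wt 1 (inU (S i j) * inV (S k l) - inV (S k l) * inU (S i j)) := by
  have h01 : (0 : Fin 2) ≠ 1 := by decide
  have hc := commute_uInv_mul_vInv (A := A)
  have hd₁ := commute_vInv_sub_uInv (A := A)
  have hd₂ := commute_neg_vInv_sub_uInv (A := A)
  have wc : HasWeight K s wt 2 (uInv * vInv : A⟦X⟧⟦X⟧) :=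
    (hasWeight_uInv.mul hasWeight_vInv).mono (k := 1 + 1) le_rfl
  have wd₁ : HasWeight K s wt 1 (vInv - uInv : A⟦X⟧⟦X⟧) := hasWeight_vInv.sub hasWeight_uInv
  have wd₂ : HasWeight K s wt 1 (-vInv - uInv : A⟦X⟧⟦X⟧) := by
    rw [← zero_sub vInv]
    exact ((HasWeight.zero 1).sub hasWeight_vInv).sub hasWeight_uInv
  have hdd : (vInv - uInv) * (-vInv - uInv) = (uInv ^ 2 - vInv ^ 2 : A⟦X⟧⟦X⟧) := by
    have := (commute_uInv (vInv : A⟦X⟧⟦X⟧)).eq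
    simp only [sub_mul, mul_sub, mul_neg, sq, this]
    abel
  have hent : (atPos (0 : Fin 2) (S.map inU) * atPos 1 (S.map inV) -
      atPos 1 (S.map inV) * atPos 0 (S.map inU) : Matrix (Fin 2 → Fin (2 * n))
        (Fin 2 → Fin (2 * n)) A⟦X⟧⟦X⟧) ![i, k] ![j, l] =
      inU (S i j) * inV (S k l) - inV (S k l) * inU (S i j) := by
    have hA : AgreeOff (0 : Fin 2) 1 ![i, k] ![j, l] := by
      intro c h0 h1
      fin_cases c
      · exact absurd rfl h0
      · exact absurd rfl h1
    rw [Matrix.sub_apply, atPos_mul_atPos_apply h01, atPos_mul_atPos_apply h01.symm, if_pos hA,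
      if_pos ((agreeOff_comm _ _ _ _).1 hA)]
    simp only [Matrix.map_apply, Matrix.cons_val_zero, Matrix.cons_val_one]
  have w₁ : MatHasWeight K s wt 0 (atPos (0 : Fin 2) (S.map inU)) :=
    matHasWeight_atPos _ fun i j => hasWeight_inU (hS i j)
  have w₂ : MatHasWeight K s wt 0 (atPos (1 : Fin 2) (S.map inV)) :=
    matHasWeight_atPos _ fun i j => hasWeight_inV (hS i j)
  have wP : MatHasWeight K s wt 0 (flip (2 * n) A⟦X⟧⟦X⟧ (0 : Fin 2) 1) := matHasWeight_flip _ _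
  have wQ : MatHasWeight K s wt 0 (qOp K (n := n) κ A⟦X⟧⟦X⟧ (0 : Fin 2) 1) :=
    matHasWeight_qOp κ _ _
  refine HasWeight.of_sq_sub_sq_mul ?_
  rw [← hdd, ← hent]
  have key := h.commutator κ hc hd₁ hd₂
  clear h hc hd₁ hd₂ hdd hent
  generalize atPos (0 : Fin 2) (S.map inU) = S₁ at *
  generalize atPos (1 : Fin 2) (S.map inV) = S₂ at *
  generalize qOp K (n := n) κ A⟦X⟧⟦X⟧ (0 : Fin 2) 1 = Q at *
  generalize flip (2 * n) A⟦X⟧⟦X⟧ (0 : Fin 2) 1 = P at *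
  generalize (uInv * vInv : A⟦X⟧⟦X⟧) = c at *
  generalize (vInv - uInv : A⟦X⟧⟦X⟧) = d₁ at *
  generalize (-vInv - uInv : A⟦X⟧⟦X⟧) = d₂ at *
  have wI : MatHasWeight K s wt 0
      (1 : Matrix (Fin 2 → Fin (2 * n)) (Fin 2 → Fin (2 * n)) A⟦X⟧⟦X⟧) := matHasWeight_one
  have wR : MatHasWeight K s wt 1 (d₂ • 1 - c • Q) :=
    ((MatHasWeight.smul wd₂ wI).mono (by omega)).sub ((MatHasWeight.smul wc wQ).mono (by omega))
  have w3 : MatHasWeight K s wt 3 ((d₁ * d₂) • (S₁ * S₂ - S₂ * S₁)) := by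
    rw [key]
    refine (MatHasWeight.add ?_ ?_).sub (MatHasWeight.add ?_ ?_)
    · exact (MatHasWeight.smul wd₁ (MatHasWeight.smul wc ((w₁.mul wQ).mul w₂))).mono (by omega)
    · exact (MatHasWeight.smul wc (wP.mul ((w₁.mul wR).mul w₂))).mono (by omega)
    · exact (MatHasWeight.smul wd₁ (MatHasWeight.smul wc ((w₂.mul wQ).mul w₁))).mono (by omega)
    · exact (MatHasWeight.smul wc (((w₂.mul wR).mul w₁).mul wP)).mono (by omega)
  have w4 := w3 ![i, k] ![j, l]
  rwa [Matrix.smul_apply, smul_eq_mul] at w4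

end MatrixWeights

end

end YangianDet

namespace YangianDet

noncomputable section

/-! ### Generators of the twisted Yangian modulo lower weight. -/

section TwistedGenerators

variable {K : Type*} [Field K] {n : ℕ} (κ : FormType)

theorem coeff_primeNeg {A : Type*} [Ring A] [Algebra K A]
    (M : Matrix (Fin (2 * n)) (Fin (2 * n)) A⟦X⟧) (i j : Fin (2 * n)) (r : ℕ) :
    PowerSeries.coeff r (primeNeg K κ M i j) =
      ((-1) ^ r * (formSgn K κ i * formSgn K κ j)) •
        PowerSeries.coeff r (M (Fin.rev j) (Fin.rev i)) := by
  rw [primeNeg_eq, formTranspose_apply, Matrix.map_apply, PowerSeries.coeff_smul,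
    coeff_affineHom_neg, smul_smul, mul_comm]

/-- The generators of the twisted Yangian. -/
def twistedGen (K : Type*) [Field K] {n : ℕ} (κ : FormType)
    (a : Fin (2 * n) × Fin (2 * n) × ℕ) : TwistedYangian K n κ :=
  RingQuot.mkAlgHom K (TwistedRel K n κ) (FreeAlgebra.ι K a)

/-- The weight of a generator, its superscript. -/
def genWeight {N : ℕ} (a : Fin N × Fin N × ℕ) : ℕ := a.2.2 + 1

/-- The involution of the generators given by the symmetry relation. -/
def genStar {N : ℕ} (a : Fin N × Fin N × ℕ) : Fin N × Fin N × ℕ :=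
  (Fin.rev a.2.1, Fin.rev a.1, a.2.2)

/-- The sign in the symmetry relation. -/
def genSgn (K : Type*) [Field K] {n : ℕ} (κ : FormType) (a : Fin (2 * n) × Fin (2 * n) × ℕ) : K :=
  (-1) ^ (a.2.2 + 1) * (formSgn K κ a.1 * formSgn K κ a.2.1)

theorem coeff_matS_succ (i j : Fin (2 * n)) (r : ℕ) :
    PowerSeries.coeff (r + 1) (matS K n κ i j) = twistedGen K κ (i, j, r) := by
  simp [matS, genMatrix, twistedGen]

theorem coeff_matS_mem (i j : Fin (2 * n)) (r : ℕ) :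
    PowerSeries.coeff r (matS K n κ i j) ∈ wordSpan K (twistedGen K κ) genWeight 0 r := by
  rcases r with _ | r
  · have : PowerSeries.coeff 0 (matS K n κ i j) = algebraMap K _ (if i = j then 1 else 0) := by
      simp [matS, genMatrix]
    rw [this]
    exact algebraMap_mem_wordSpan _ _
  · rw [coeff_matS_succ]
    exact gen_mem_wordSpan (K := K) (wt := genWeight) (i, j, r)

theorem coeff_inU_mul_inV {A : Type*} [Ring A] (f g : A⟦X⟧) (r q : ℕ) :
    PowerSeries.coeff r (PowerSeries.coeff q (inU f * inV g)) =
      PowerSeries.coeff r f * PowerSeries.coeff q g := by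
  rw [inU, inV, PowerSeries.coeff_C_mul, PowerSeries.coeff_map, PowerSeries.coeff_mul_C]

theorem coeff_inV_mul_inU {A : Type*} [Ring A] (f g : A⟦X⟧) (r q : ℕ) :
    PowerSeries.coeff r (PowerSeries.coeff q (inV g * inU f)) =
      PowerSeries.coeff q g * PowerSeries.coeff r f := by
  rw [inU, inV, PowerSeries.coeff_mul_C, PowerSeries.coeff_map, PowerSeries.coeff_C_mul]

theorem twistedGen_commutator (a b : Fin (2 * n) × Fin (2 * n) × ℕ) :
    twistedGen K κ a * twistedGen K κ b - twistedGen K κ b * twistedGen K κ a ∈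
      wordSpan K (twistedGen K κ) genWeight 1 (genWeight a + genWeight b) := by
  have h := commutator_hasWeight κ (coeff_matS_mem (K := K) κ) (reflection_matS κ) a.1 a.2.1 b.1
    b.2.1 (a.2.2 + 1) (b.2.2 + 1)
  rw [map_sub, map_sub, coeff_inU_mul_inV, coeff_inV_mul_inU, coeff_matS_succ,
    coeff_matS_succ] at h
  exact h

/-- The correction (S(u) - S(-u))/(2u) carries an extra u⁻¹, so it has lower weight and only S'(-u)
= S(u) remains. -/
theorem twistedGen_symmetric (a : Fin (2 * n) × Fin (2 * n) × ℕ) :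
    twistedGen K κ a - genSgn K κ a • twistedGen K κ (genStar a) ∈
      wordSpan K (twistedGen K κ) genWeight 1 (genWeight a) := by
  have h := congrArg (PowerSeries.coeff (a.2.2 + 1))
    (congrFun (congrFun (symmetry_matS (K := K) κ) a.1) a.2.1)
  rw [coeff_primeNeg, coeff_matS_succ, symmetryRight, Matrix.add_apply, map_add, coeff_matS_succ]
    at h
  change genSgn K κ a • twistedGen K κ (genStar a) = twistedGen K κ a + _ at h
  rw [h, sub_add_cancel_left]
  refine Submodule.neg_mem _ ?_
  rw [Matrix.smul_apply, PowerSeries.coeff_smul]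
  refine Submodule.smul_mem _ _ ?_
  rw [Matrix.smul_apply, smul_eq_mul, PowerSeries.coeff_mul]
  refine Submodule.sum_mem _ fun i hi => ?_
  rw [Finset.HasAntidiagonal.mem_antidiagonal] at hi
  have h1 : PowerSeries.coeff i.1 (scalarSeries (TwistedYangian K n κ) (affineInv (2 : K) 0)) ∈
      wordSpan K (twistedGen K κ) genWeight 1 i.1 := by
    rw [scalarSeries, PowerSeries.coeff_map]
    rcases Nat.eq_zero_or_pos i.1 with h0 | h0
    · rw [h0, PowerSeries.coeff_zero_eq_constantCoeff_apply, constantCoeff_affineInv, map_zero]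
      exact Submodule.zero_mem _
    · exact wordSpan_mono (by omega) (algebraMap_mem_wordSpan _ 0)
  have h3 : PowerSeries.coeff i.2 ((matS K n κ - (matS K n κ).map (affineSubst (-1 : K) 0)) a.1
      a.2.1) ∈ wordSpan K (twistedGen K κ) genWeight 0 i.2 := by
    rw [Matrix.sub_apply, map_sub, Matrix.map_apply, affineSubst_eq, coeff_affineHom_neg]
    exact Submodule.sub_mem _ (coeff_matS_mem κ _ _ _)
      (Submodule.smul_mem _ _ (coeff_matS_mem κ _ _ _))
  exact wordSpan_mono (by rw [genWeight]; omega) (mul_mem_wordSpan h1 h3)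

theorem exists_map_mem_wordSpan {A Λ : Type*} [Ring A] [Algebra K A]
    (φ : FreeAlgebra K Λ →ₐ[K] A) (wt : Λ → ℕ) (z : FreeAlgebra K Λ) :
    ∃ d, φ z ∈ wordSpan K (fun a => φ (FreeAlgebra.ι K a)) wt 0 d := by
  induction z using FreeAlgebra.induction with
  | grade0 c => exact ⟨0, by rw [AlgHom.commutes]; exact algebraMap_mem_wordSpan c 0⟩
  | grade1 a => exact ⟨_, gen_mem_wordSpan a⟩
  | mul x y hx hy =>
    obtain ⟨d, hd⟩ := hx
    obtain ⟨d', hd'⟩ := hy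
    have h := mul_mem_wordSpan hd hd'
    rw [← map_mul] at h
    exact ⟨d + d', wordSpan_mono (by omega) h⟩
  | add x y hx hy =>
    obtain ⟨d, hd⟩ := hx
    obtain ⟨d', hd'⟩ := hy
    exact ⟨d + d', by
      rw [map_add]
      exact Submodule.add_mem _ (wordSpan_mono (by omega) hd) (wordSpan_mono (by omega) hd')⟩

theorem exists_mem_wordSpan (y : TwistedYangian K n κ) :
    ∃ d, y ∈ wordSpan K (twistedGen K κ) genWeight 0 d := by
  obtain ⟨z, rfl⟩ := RingQuot.mkAlgHom_surjective K (TwistedRel K n κ) y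
  exact exists_map_mem_wordSpan (RingQuot.mkAlgHom K (TwistedRel K n κ)) genWeight z

end TwistedGenerators

/-! ### Representations of the Yangian by differential operators -/

section Sites

variable {N : ℕ}

/-- The coproduct of the Yangian in matrix form: solutions whose entries commute with each other can
be multiplied. -/
theorem RTT.mul {B : Type*} [Ring B] {c d : B} {T T' U U' : Matrix (Fin N) (Fin N) B}
    (hc : ∀ x, Commute c x) (hd : ∀ x, Commute d x) (h : RTT c d T T') (h' : RTT c d U U')
    (h₁ : ∀ i j k l, Commute (U i j) (T' k l)) (h₂ : ∀ i j k l, Commute (T i j) (U' k l)) :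
    RTT c d (T * U) (T' * U') := by
  refine rtt_of_rMatrix_mul hc hd ?_
  have h01 : (0 : Fin 2) ≠ 1 := by decide
  have e1 := h.rMatrix_mul hc hd h01
  have e2 := h'.rMatrix_mul hc hd h01
  have e3 := (YangianDet.atPos_commute h01 h₁).eq
  have e4 := (YangianDet.atPos_commute h01 h₂).eq
  rw [← atPos_mul, ← atPos_mul]
  generalize rMatrix N c d (0 : Fin 2) 1 = R at *
  generalize YangianDet.atPos (0 : Fin 2) T = T₁ at *
  generalize YangianDet.atPos (0 : Fin 2) U = U₁ at *
  generalize YangianDet.atPos (1 : Fin 2) T' = T₂ at *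
  generalize YangianDet.atPos (1 : Fin 2) U' = U₂ at *
  calc R * (T₁ * U₁) * (T₂ * U₂) = R * T₁ * (U₁ * T₂) * U₂ := by simp only [mul_assoc]
    _ = R * (T₁ * T₂) * (U₁ * U₂) := by rw [e3]; simp only [mul_assoc]
    _ = T₂ * T₁ * (R * (U₁ * U₂)) := by rw [e1]; simp only [mul_assoc]
    _ = T₂ * (T₁ * U₂) * U₁ * R := by rw [e2]; simp only [mul_assoc]
    _ = _ := by rw [e4]; simp only [mul_assoc]

/-- The matrix `1 + E u⁻¹`. -/
def linearSeries {A : Type*} [Ring A] (E : Matrix (Fin N) (Fin N) A) :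
    Matrix (Fin N) (Fin N) A⟦X⟧ :=
  1 + Matrix.of fun i j => PowerSeries.C (E i j) * PowerSeries.X

theorem linearSeries_apply {A : Type*} [Ring A] (E : Matrix (Fin N) (Fin N) A) (i j : Fin N) :
    linearSeries E i j = (if i = j then 1 else 0) + PowerSeries.C (E i j) * PowerSeries.X := by
  rw [linearSeries, Matrix.add_apply, Matrix.one_apply, Matrix.of_apply]

theorem rtt_linear_aux {Z B : Type*} [CommRing Z] [Ring B] [Algebra Z B] (u v a b p q : Z)
    {e₁ e₂ e₃ e₄ : B} (h : e₁ * e₂ - e₂ * e₁ = p • e₄ - q • e₃) :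
    (v - u) • ((a • 1 + u • e₁) * (b • 1 + v • e₂) - (b • 1 + v • e₂) * (a • 1 + u • e₁)) =
      (u * v) • ((p • 1 + u • e₃) * (q • 1 + v • e₄) - (p • 1 + v • e₃) * (q • 1 + u • e₄)) := by
  simp only [add_mul, mul_add, smul_mul_smul_comm, one_mul, mul_one]
  linear_combination (norm := module) ((v - u) * (u * v)) • h

/-- The evaluation homomorphism: for 1 + E u⁻¹ the ternary relation reduces to the commutation
relations of 𝔤𝔩_N. -/
theorem rtt_linearSeries {A : Type*} [Ring A] {E : Matrix (Fin N) (Fin N) A}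
    (hE : ∀ i j k l, E i j * E k l - E k l * E i j =
      (if k = j then E i l else 0) - (if i = l then E k j else 0)) :
    RTT (uInv * vInv) (vInv - uInv) ((linearSeries E).map inU) ((linearSeries E).map inV) := by
  intro i j k l
  let γ : A →+* A⟦X⟧⟦X⟧ := inU.comp PowerSeries.C
  -- Viewing u⁻¹, v⁻¹ and the Kronecker symbols in the centre supplies a commutative ring of
  -- coefficients for the computation.
  let u : Subring.center A⟦X⟧⟦X⟧ :=
    ⟨uInv, Subring.mem_center_iff.2 fun g => (commute_uInv g).eq.symm⟩
  let v : Subring.center A⟦X⟧⟦X⟧ :=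
    ⟨vInv, Subring.mem_center_iff.2 fun g => (commute_vInv g).eq.symm⟩
  let δ : Fin N → Fin N → Subring.center A⟦X⟧⟦X⟧ := fun i j => if i = j then 1 else 0
  have hU : ∀ i j, inU (linearSeries E i j) = δ i j • 1 + u • γ (E i j) := by
    intro i j
    rw [linearSeries_apply, map_add, map_mul, Subring.smul_def, Subring.smul_def]
    change _ = _ + uInv * γ (E i j)
    rw [(commute_uInv _).eq]
    simp only [δ]
    split_ifs <;> simp [γ, uInv]
  have hV : ∀ i j, inV (linearSeries E i j) = δ i j • 1 + v • γ (E i j) := by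
    intro i j
    have h1 : inV (PowerSeries.C (E i j)) = γ (E i j) := by
      simp [γ, inV, inU]
    rw [linearSeries_apply, map_add, map_mul, h1, Subring.smul_def, Subring.smul_def]
    change _ = _ + vInv * γ (E i j)
    rw [(commute_vInv _).eq]
    simp only [δ]
    split_ifs <;> simp [vInv]
  have h1 : γ (E i j) * γ (E k l) - γ (E k l) * γ (E i j) =
      δ k j • γ (E i l) - δ i l • γ (E k j) := by
    rw [← map_mul, ← map_mul, ← map_sub, hE]
    simp only [δ]
    split_ifs <;> simp
  have h3 := rtt_linear_aux u v (δ i j) (δ k l) (δ k j) (δ i l) h1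
  simp only [← hU, ← hV] at h3
  exact h3

/-- The relations of the Weyl algebra of the functions `a_{k,i}` and the derivations `b_{k,i}`. -/
structure IsWeyl {A σ : Type*} [Ring A] [DecidableEq σ] (a b : σ → A) : Prop where
  commute_left : ∀ x y, Commute (a x) (a y)
  commute_right : ∀ x y, Commute (b x) (b y)
  commutator : ∀ x y, b x * a y - a y * b x = if x = y then 1 else 0

variable {A : Type*} [Ring A] {a b : ℕ × Fin N → A}

theorem IsWeyl.commute (h : IsWeyl a b) {x y : ℕ × Fin N} (hxy : x ≠ y) : Commute (b x) (a y) := by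
  have h1 := h.commutator x y
  rwa [if_neg hxy, sub_eq_zero] at h1

/-- The matrix `E_{ij} = a_i b_j` of the site `k`. -/
def siteMatrix (a b : ℕ × Fin N → A) (k : ℕ) : Matrix (Fin N) (Fin N) A :=
  Matrix.of fun i j => a (k, i) * b (k, j)

theorem siteMatrix_commutator (h : IsWeyl a b) (q : ℕ) (i j k l : Fin N) :
    siteMatrix a b q i j * siteMatrix a b q k l - siteMatrix a b q k l * siteMatrix a b q i j =
      (if k = j then siteMatrix a b q i l else 0) - (if i = l then siteMatrix a b q k j else 0) := by
  simp only [siteMatrix, Matrix.of_apply]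
  have h1 := h.commutator (q, j) (q, k)
  have h3 := h.commutator (q, l) (q, i)
  have h4 := (h.commute_left (q, i) (q, k)).eq
  have h5 := (h.commute_right (q, j) (q, l)).eq
  rw [sub_eq_iff_eq_add] at h1 h3
  have e1 : a (q, i) * b (q, j) * (a (q, k) * b (q, l)) =
      a (q, i) * (b (q, j) * a (q, k)) * b (q, l) := by simp only [mul_assoc]
  have e2 : a (q, k) * b (q, l) * (a (q, i) * b (q, j)) =
      a (q, k) * (b (q, l) * a (q, i)) * b (q, j) := by simp only [mul_assoc]
  have e3 : a (q, i) * (a (q, k) * b (q, j)) * b (q, l) =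
      a (q, k) * (a (q, i) * b (q, l)) * b (q, j) := by
    rw [← mul_assoc, h4, mul_assoc, h5]
    simp only [mul_assoc]
  rw [e1, e2, h1, h3, mul_add, mul_add, add_mul, add_mul, e3, add_sub_add_right_eq_sub]
  simp only [Prod.mk.injEq, true_and, eq_comm (a := j), eq_comm (a := l)]
  split_ifs <;> simp

theorem siteMatrix_commute (h : IsWeyl a b) {p q : ℕ} (hpq : p ≠ q) (i j k l : Fin N) :
    Commute (siteMatrix a b p i j) (siteMatrix a b q k l) := by
  have h1 : ∀ i j : Fin N, (p, i) ≠ (q, j) := fun i j h => hpq (Prod.ext_iff.1 h).1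
  exact ((h.commute_left _ _).mul_right (h.commute (h1 _ _).symm).symm).mul_left
    ((h.commute (h1 _ _)).mul_right (h.commute_right _ _))

/-- The product of the matrices `1 + E^{(k)} u⁻¹` over a list of sites `k`. -/
def siteProduct (a b : ℕ × Fin N → A) (l : List ℕ) : Matrix (Fin N) (Fin N) A⟦X⟧ :=
  (l.map fun k => linearSeries (siteMatrix a b k)).prod

theorem linearSeries_coeff_commute {E : Matrix (Fin N) (Fin N) A} {x : A}
    (h : ∀ i j, Commute (E i j) x) (i j : Fin N) (r : ℕ) :
    Commute (PowerSeries.coeff r (linearSeries E i j)) x := by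
  rw [linearSeries_apply, map_add, PowerSeries.coeff_C_mul, PowerSeries.coeff_X]
  refine Commute.add_left ?_ ?_
  · split_ifs
    · rw [PowerSeries.coeff_one]
      split_ifs <;> simp
    · simp
  · split_ifs
    · rw [mul_one]
      exact h i j
    · simp

theorem siteProduct_coeff_commute (h : IsWeyl a b) {q : ℕ} {l : List ℕ} (hq : q ∉ l)
    (i j i' j' : Fin N) (r : ℕ) :
    Commute (PowerSeries.coeff r (siteProduct a b l i j)) (siteMatrix a b q i' j') := by
  induction l generalizing i j r with
  | nil =>
    simp only [siteProduct, List.map_nil, List.prod_nil, Matrix.one_apply]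
    split_ifs
    · rw [PowerSeries.coeff_one]
      split_ifs <;> simp
    · simp
  | cons p l ih =>
    rw [List.mem_cons, not_or] at hq
    rw [siteProduct, List.map_cons, List.prod_cons, Matrix.mul_apply, map_sum]
    refine Commute.sum_left _ _ _ fun k _ => ?_
    rw [PowerSeries.coeff_mul]
    refine Commute.sum_left _ _ _ fun x _ => ?_
    exact (linearSeries_coeff_commute (fun i j => siteMatrix_commute h (Ne.symm hq.1) _ _ _ _)
      _ _ _).mul_left (ih hq.2 _ _ _)

theorem commute_inU_inV {f g : A⟦X⟧}
    (h : ∀ r q, Commute (PowerSeries.coeff r f) (PowerSeries.coeff q g)) :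
    Commute (inU f) (inV g) := by
  ext q r
  rw [coeff_inU_mul_inV, coeff_inV_mul_inU]
  exact h r q

/-- Operators at distinct sites commute, so the evaluation solutions of the sites multiply. -/
theorem rtt_siteProduct (h : IsWeyl a b) {l : List ℕ} (hl : l.Nodup) :
    RTT (uInv * vInv) (vInv - uInv) ((siteProduct a b l).map inU)
      ((siteProduct a b l).map inV) := by
  induction l with
  | nil =>
    intro i j k l
    simp only [siteProduct, List.map_nil, List.prod_nil, Matrix.map_apply, Matrix.one_apply]
    split_ifs <;> simp
  | cons q l ih =>
    rw [List.nodup_cons] at hl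
    have h1 : ∀ i j i' j' r s, Commute (PowerSeries.coeff r (siteProduct a b l i j))
        (PowerSeries.coeff s (linearSeries (siteMatrix a b q) i' j')) := by
      intro i j i' j' r s
      exact (linearSeries_coeff_commute (fun i' j' =>
        (siteProduct_coeff_commute h hl.1 i j i' j' r).symm) i' j' s).symm
    rw [siteProduct, List.map_cons, List.prod_cons, Matrix.map_mul, Matrix.map_mul]
    refine RTT.mul commute_uInv_mul_vInv commute_vInv_sub_uInv
      (rtt_linearSeries (siteMatrix_commutator h q)) (ih hl.2) ?_ ?_
    · exact fun i j k l => commute_inU_inV fun r s => h1 _ _ _ _ _ _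
    · exact fun i j k l => commute_inU_inV fun r s => (h1 _ _ _ _ _ _).symm

theorem constantCoeff_siteProduct (l : List ℕ) :
    (siteProduct a b l).map PowerSeries.constantCoeff = 1 := by
  induction l with
  | nil => exact Matrix.map_one _ (map_zero _) (map_one _)
  | cons q l ih =>
    rw [siteProduct, List.map_cons, List.prod_cons, Matrix.map_mul]
    change _ * (siteProduct a b l).map _ = 1
    rw [ih, mul_one]
    ext i j
    rw [Matrix.map_apply, linearSeries_apply, Matrix.one_apply]
    split_ifs <;> simp

end Sites

end

end YangianDet

namespace YangianDet

noncomputable section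

/-! ### Symbols of differential operators depending on a large parameter -/

section Operators

variable (K : Type*) {L : Type*} [Field K] [Field L] [Algebra K L] {σ : Type*}

variable (L σ) in
/-- The polynomials whose degree in the parameter is less than `d`. -/
def lowDegree (d : ℕ) : Submodule K (MvPolynomial σ (Polynomial L)) where
  carrier := {f | ∀ m, f.coeff m ∈ Polynomial.degreeLT L d}
  add_mem' hf hg m := by
    rw [MvPolynomial.coeff_add]
    exact Submodule.add_mem _ (hf m) (hg m)
  zero_mem' m := by simp
  smul_mem' c f hf m := by
    rw [MvPolynomial.coeff_smul, ← algebraMap_smul L c]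
    exact Submodule.smul_mem _ _ (hf m)

variable {K}

theorem lowDegree_mono {d e : ℕ} (h : d ≤ e) : lowDegree K L σ d ≤ lowDegree K L σ e :=
  fun _ hf m => Polynomial.degreeLT_mono h (hf m)

theorem C_mul_mem_lowDegree {d e : ℕ} {q : Polynomial L} (hq : q.degree ≤ e)
    {f : MvPolynomial σ (Polynomial L)} (hf : f ∈ lowDegree K L σ d) :
    MvPolynomial.C q * f ∈ lowDegree K L σ (d + e) := fun m => by
  have h := hf m
  rw [Polynomial.mem_degreeLT] at h
  rw [MvPolynomial.coeff_C_mul, Polynomial.mem_degreeLT]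
  rcases eq_or_ne q 0 with rfl | hq0
  · rw [zero_mul, Polynomial.degree_zero]
    exact WithBot.bot_lt_coe _
  · rw [Polynomial.degree_mul, Nat.cast_add, add_comm]
    exact WithBot.add_lt_add_of_lt_of_le (by rwa [Ne, Polynomial.degree_eq_bot]) h hq

theorem X_mul_mem_lowDegree {d : ℕ} (s : σ) {f : MvPolynomial σ (Polynomial L)}
    (hf : f ∈ lowDegree K L σ d) : MvPolynomial.X s * f ∈ lowDegree K L σ d := fun m => by
  classical
  rw [MvPolynomial.coeff_X_mul']
  split_ifs
  · exact hf _
  · exact Submodule.zero_mem _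

theorem C_mem_lowDegree {d : ℕ} {q : Polynomial L} (hq : q.degree < d) :
    MvPolynomial.C q ∈ lowDegree K L σ d := fun m => by
  classical
  rw [MvPolynomial.coeff_C]
  split_ifs
  · rwa [Polynomial.mem_degreeLT]
  · exact Submodule.zero_mem _

theorem pderiv_mem_lowDegree {d : ℕ} (s : σ) {f : MvPolynomial σ (Polynomial L)}
    (hf : f ∈ lowDegree K L σ d) : MvPolynomial.pderiv s f ∈ lowDegree K L σ d := by
  rw [f.as_sum, map_sum]
  refine Submodule.sum_mem _ fun m _ => ?_
  rw [MvPolynomial.pderiv_monomial]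
  intro m'
  classical
  rw [MvPolynomial.coeff_monomial]
  split_ifs
  · have := Submodule.smul_mem _ ((m s : ℕ) : L) (hf m)
    rwa [Polynomial.smul_eq_C_mul, mul_comm, map_natCast] at this
  · exact Submodule.zero_mem _

variable (K) in
/-- The operator `Φ` multiplies the leading term in the parameter by `β` times its `r`-th power. -/
def HasSymbol (r : ℕ) (β : L) (Φ : Module.End K (MvPolynomial σ (Polynomial L))) : Prop :=
  ∀ d a f, f - MvPolynomial.C (Polynomial.monomial d a) ∈ lowDegree K L σ d →
    Φ f - MvPolynomial.C (Polynomial.monomial (d + r) (β * a)) ∈ lowDegree K L σ (d + r)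

variable {r r' : ℕ} {β β' : L} {Φ Φ' : Module.End K (MvPolynomial σ (Polynomial L))}

theorem C_monomial_mem_lowDegree {d e : ℕ} (a : L) (h : d < e) :
    MvPolynomial.C (Polynomial.monomial d a) ∈ lowDegree K L σ e :=
  C_mem_lowDegree ((Polynomial.degree_monomial_le _ _).trans_lt (by exact_mod_cast h))

theorem mem_lowDegree_succ {d : ℕ} {a : L} {f : MvPolynomial σ (Polynomial L)}
    (h : f - MvPolynomial.C (Polynomial.monomial d a) ∈ lowDegree K L σ d) :
    f ∈ lowDegree K L σ (d + 1) := by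
  have := Submodule.add_mem _ (lowDegree_mono d.le_succ h)
    (C_monomial_mem_lowDegree a (Nat.lt_succ_self d))
  rwa [sub_add_cancel] at this

theorem HasSymbol.add (h : HasSymbol K r β Φ) (h' : HasSymbol K r β' Φ') :
    HasSymbol K r (β + β') (Φ + Φ') := fun d a f hf => by
  rw [LinearMap.add_apply, add_mul, map_add, map_add, add_sub_add_comm]
  exact Submodule.add_mem _ (h d a f hf) (h' d a f hf)

variable (K L σ) in
theorem HasSymbol.zero (r : ℕ) :
    HasSymbol K r (0 : L) (0 : Module.End K (MvPolynomial σ (Polynomial L))) := fun d a f hf => by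
  simp

theorem HasSymbol.sum {ι : Type*} (t : Finset ι) {β : ι → L}
    {Φ : ι → Module.End K (MvPolynomial σ (Polynomial L))}
    (h : ∀ i ∈ t, HasSymbol K r (β i) (Φ i)) :
    HasSymbol K r (∑ i ∈ t, β i) (∑ i ∈ t, Φ i) := by
  classical
  induction t using Finset.induction_on with
  | empty => simpa using HasSymbol.zero K L σ r
  | insert i t hi ih =>
    rw [Finset.sum_insert hi, Finset.sum_insert hi]
    exact (h i (Finset.mem_insert_self _ _)).add
      (ih fun j hj => h j (Finset.mem_insert_of_mem hj))

theorem HasSymbol.mul (h : HasSymbol K r β Φ) (h' : HasSymbol K r' β' Φ') :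
    HasSymbol K (r + r') (β * β') (Φ * Φ') := fun d a f hf => by
  have := h _ _ _ (h' d a f hf)
  rwa [add_assoc, add_comm r' r, ← mul_assoc] at this

theorem HasSymbol.smul (c : K) (h : HasSymbol K r β Φ) : HasSymbol K r (c • β) (c • Φ) :=
  fun d a f hf => by
    have h1 : c • MvPolynomial.C (σ := σ) (Polynomial.monomial (d + r) (β * a)) =
        MvPolynomial.C (Polynomial.monomial (d + r) (c • β * a)) := by
      classical
      ext1 m
      rw [MvPolynomial.coeff_smul, MvPolynomial.coeff_C, MvPolynomial.coeff_C]
      split_ifs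
      · rw [Polynomial.smul_monomial, smul_mul_assoc]
      · rw [smul_zero]
    have := Submodule.smul_mem _ c (h d a f hf)
    rwa [smul_sub, h1] at this

variable (K L σ) in
theorem HasSymbol.one :
    HasSymbol K 0 (1 : L) (1 : Module.End K (MvPolynomial σ (Polynomial L))) := fun d a f hf => by
  simpa using hf

/-- Operators of smaller order are invisible in the leading term, which is how words of lower weight
drop out. -/
theorem HasSymbol.of_lt (h : HasSymbol K r' β Φ) (hr : r' < r) : HasSymbol K r 0 Φ :=
  fun d a f hf => by
    rw [zero_mul, map_zero, map_zero, sub_zero]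
    exact lowDegree_mono (by omega) (mem_lowDegree_succ (h d a f hf))

/-- Applied to the constant 1, the zero operator would have leading term β times a power of the
parameter. -/
theorem HasSymbol.eq_zero (h : HasSymbol K r β (0 : Module.End K (MvPolynomial σ (Polynomial L)))) :
    β = 0 := by
  classical
  have h1 := h 0 1 1 (by simp) 0
  rw [LinearMap.zero_apply, zero_sub, MvPolynomial.coeff_neg, MvPolynomial.coeff_C, if_pos rfl,
    mul_one, zero_add, neg_mem_iff, Polynomial.mem_degreeLT] at h1
  by_contra hβ
  rw [Polynomial.degree_monomial _ hβ] at h1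
  exact lt_irrefl _ h1

theorem pderiv_comm {R : Type*} [CommRing R] (s t : σ) (f : MvPolynomial σ R) :
    MvPolynomial.pderiv s (MvPolynomial.pderiv t f) =
      MvPolynomial.pderiv t (MvPolynomial.pderiv s f) := by
  classical
  have h : ⁅MvPolynomial.pderiv (R := R) s, MvPolynomial.pderiv (R := R) t⁆ = 0 := by
    refine MvPolynomial.derivation_ext fun i => ?_
    rw [Derivation.commutator_apply, MvPolynomial.pderiv_X, MvPolynomial.pderiv_X, Pi.single_apply,
      Pi.single_apply]
    split_ifs <;> simp
  rw [← sub_eq_zero, ← Derivation.commutator_apply, h, Derivation.zero_apply]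

variable (K) in
/-- Multiplication by the variable `s` translated by `x` times the parameter. -/
def shiftedVar (x : σ → L) (s : σ) : Module.End K (MvPolynomial σ (Polynomial L)) :=
  LinearMap.mulLeft K (MvPolynomial.C (Polynomial.monomial 1 (x s)) + MvPolynomial.X s)

variable (K) in
/-- The derivation in the variable `s` translated by `p`. -/
def shiftedDeriv (p : σ → L) (s : σ) : Module.End K (MvPolynomial σ (Polynomial L)) :=
  LinearMap.mulLeft K (MvPolynomial.C (Polynomial.C (p s))) +
    ((MvPolynomial.pderiv s).toLinearMap.restrictScalars K)

/-- Translating the variables and derivations by central terms does not affect their commutators. -/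
theorem isWeyl_shifted [DecidableEq σ] (x p : σ → L) :
    IsWeyl (shiftedVar K x) (shiftedDeriv K p) where
  commute_left s t := by
    refine LinearMap.ext fun f => ?_
    simp only [Module.End.mul_apply, shiftedVar, LinearMap.mulLeft_apply]
    ring
  commute_right s t := by
    refine LinearMap.ext fun f => ?_
    have h1 := pderiv_comm s t f
    simp only [Module.End.mul_apply, shiftedDeriv, LinearMap.add_apply, LinearMap.mulLeft_apply,
      LinearMap.restrictScalars_apply, Derivation.coeFn_coe, map_add, MvPolynomial.pderiv_C_mul, h1]
    ring
  commutator s t := by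
    refine LinearMap.ext fun f => ?_
    simp only [Module.End.mul_apply, shiftedDeriv, shiftedVar, LinearMap.add_apply,
      LinearMap.sub_apply, LinearMap.mulLeft_apply, LinearMap.restrictScalars_apply,
      Derivation.coeFn_coe, Derivation.leibniz, map_add, MvPolynomial.pderiv_C,
      MvPolynomial.pderiv_X, smul_eq_mul]
    rcases eq_or_ne s t with rfl | h
    · simp
      ring
    · simp [h]
      ring

/-- Multiplication by the variable itself does not raise the degree in the parameter, so only the
translation contributes to the leading term. -/
theorem hasSymbol_shiftedVar (x : σ → L) (s : σ) : HasSymbol K 1 (x s) (shiftedVar K x s) :=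
  fun d a f hf => by
    have h1 : shiftedVar K x s f - MvPolynomial.C (Polynomial.monomial (d + 1) (x s * a)) =
        MvPolynomial.C (Polynomial.monomial 1 (x s)) *
          (f - MvPolynomial.C (Polynomial.monomial d a)) + MvPolynomial.X s * f := by
      rw [mul_sub, ← MvPolynomial.C_mul, Polynomial.monomial_mul_monomial, add_comm 1 d,
        shiftedVar, LinearMap.mulLeft_apply]
      ring
    rw [h1]
    exact Submodule.add_mem _ (C_mul_mem_lowDegree (Polynomial.degree_monomial_le _ _) hf)
      (X_mul_mem_lowDegree s (mem_lowDegree_succ hf))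

/-- The leading term is constant in the variables, so the derivation kills it and only the
translation p remains. -/
theorem hasSymbol_shiftedDeriv (p : σ → L) (s : σ) : HasSymbol K 0 (p s) (shiftedDeriv K p s) :=
  fun d a f hf => by
    have h1 : shiftedDeriv K p s f - MvPolynomial.C (Polynomial.monomial (d + 0) (p s * a)) =
        MvPolynomial.C (Polynomial.C (p s)) * (f - MvPolynomial.C (Polynomial.monomial d a)) +
          MvPolynomial.pderiv s (f - MvPolynomial.C (Polynomial.monomial d a)) := by
      rw [mul_sub, ← MvPolynomial.C_mul, Polynomial.C_mul_monomial, map_sub,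
        MvPolynomial.pderiv_C, sub_zero, add_zero, shiftedDeriv, LinearMap.add_apply,
        LinearMap.mulLeft_apply, LinearMap.restrictScalars_apply, Derivation.coeFn_coe]
      ring
    rw [h1]
    exact Submodule.add_mem _ (C_mul_mem_lowDegree Polynomial.degree_C_le hf)
      (pderiv_mem_lowDegree s hf)

theorem hasSymbol_of_mem_symbolPairs {A Λ : Type*} [Ring A] [Algebra K A] {s : Λ → A} {wt : Λ → ℕ}
    (ρ : A →ₐ[K] Module.End K (MvPolynomial σ (Polynomial L))) {v : Λ → L}
    (hv : ∀ a, HasSymbol K (wt a) (v a) (ρ (s a))) {d : ℕ} {z : MvPolynomial Λ K × A}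
    (hz : z ∈ symbolPairs K s wt d) : HasSymbol K d (MvPolynomial.aeval v z.1) (ρ z.2) := by
  have hw : ∀ l : List Λ, HasSymbol K (l.map wt).sum
      (MvPolynomial.aeval v (l.map (MvPolynomial.X : Λ → MvPolynomial Λ K)).prod)
      (ρ (l.map s).prod) := by
    intro l
    induction l with
    | nil => simpa using HasSymbol.one K L σ
    | cons a l ih => simpa using (hv a).mul ih
  have hlow : ∀ y ∈ wordSpan K s wt 1 d, HasSymbol K d 0 (ρ y) := by
    intro y hy
    induction hy using Submodule.span_induction with
    | mem y hy =>
      obtain ⟨l, hl, rfl⟩ := hy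
      exact (hw l).of_lt (by omega)
    | zero => simpa using HasSymbol.zero K L σ d
    | add y y' _ _ h h' => simpa using h.add h'
    | smul c y _ h => simpa using h.smul c
  induction hz using Submodule.span_induction with
  | mem z hz =>
    rcases hz with ⟨l, rfl, rfl⟩ | ⟨hz, hz'⟩
    · exact hw l
    · rw [hz, map_zero]
      exact hlow _ hz'
  | zero => simpa using HasSymbol.zero K L σ d
  | add y y' _ _ h h' => simpa using h.add h'
  | smul c y _ h => simpa using h.smul c

end Operators

/-! ### Symbols of matrices of series -/

section SymbolMatrices

variable {K L : Type*} [Field K] [Field L] [Algebra K L] {σ A : Type*} [Ring A] [Algebra K A]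
  (π : A →ₐ[K] Module.End K (MvPolynomial σ (Polynomial L)))

/-- The coefficient of `u⁻ʳ` in each entry has a symbol of degree `r`. -/
def MatHasSymbol {N : ℕ} (g : Matrix (Fin N) (Fin N) L⟦X⟧)
    (F : Matrix (Fin N) (Fin N) A⟦X⟧) : Prop :=
  ∀ i j r, HasSymbol K r (PowerSeries.coeff r (g i j)) (π (PowerSeries.coeff r (F i j)))

variable {π} {N : ℕ} {g g' : Matrix (Fin N) (Fin N) L⟦X⟧}
  {F F' : Matrix (Fin N) (Fin N) A⟦X⟧}

theorem MatHasSymbol.mul (h : MatHasSymbol π g F) (h' : MatHasSymbol π g' F') :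
    MatHasSymbol π (g * g') (F * F') := fun i j r => by
  rw [Matrix.mul_apply, Matrix.mul_apply, map_sum, map_sum, map_sum]
  refine HasSymbol.sum _ fun k _ => ?_
  rw [PowerSeries.coeff_mul, PowerSeries.coeff_mul, map_sum]
  refine HasSymbol.sum _ fun q hq => ?_
  rw [Finset.HasAntidiagonal.mem_antidiagonal] at hq
  have := (h i k q.1).mul (h' k j q.2)
  rwa [hq, ← map_mul] at this

theorem matHasSymbol_one : MatHasSymbol π (1 : Matrix (Fin N) (Fin N) L⟦X⟧)
    (1 : Matrix (Fin N) (Fin N) A⟦X⟧) :=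
  fun i j r => by
    rw [Matrix.one_apply, Matrix.one_apply]
    split_ifs
    · rw [PowerSeries.coeff_one, PowerSeries.coeff_one]
      split_ifs with h
      · rw [h, map_one]
        exact HasSymbol.one K L σ
      · rw [map_zero]
        exact HasSymbol.zero K L σ r
    · rw [map_zero, map_zero, map_zero]
      exact HasSymbol.zero K L σ r

theorem MatHasSymbol.add (h : MatHasSymbol π g F) (h' : MatHasSymbol π g' F') :
    MatHasSymbol π (g + g') (F + F') := fun i j r => by
  rw [Matrix.add_apply, Matrix.add_apply, map_add, map_add, map_add]
  exact (h i j r).add (h' i j r)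

theorem matHasSymbol_linearSeries {E : Matrix (Fin N) (Fin N) L}
    {E' : Matrix (Fin N) (Fin N) A}
    (h : ∀ i j, HasSymbol K 1 (E i j) (π (E' i j))) :
    MatHasSymbol π (linearSeries E) (linearSeries E') := by
  refine matHasSymbol_one.add fun i j r => ?_
  rw [Matrix.of_apply, Matrix.of_apply, PowerSeries.coeff_C_mul, PowerSeries.coeff_C_mul,
    PowerSeries.coeff_X, PowerSeries.coeff_X]
  split_ifs with hr
  · rw [hr, mul_one, mul_one]
    exact h i j
  · rw [mul_zero, mul_zero, map_zero]
    exact HasSymbol.zero K L σ r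

theorem MatHasSymbol.primeNeg {n : ℕ} (κ : FormType)
    {g : Matrix (Fin (2 * n)) (Fin (2 * n)) L⟦X⟧}
    {F : Matrix (Fin (2 * n)) (Fin (2 * n)) A⟦X⟧}
    (h : MatHasSymbol π g F) : MatHasSymbol π (primeNeg K κ g) (primeNeg K κ F) :=
  fun i j r => by
    rw [coeff_primeNeg, coeff_primeNeg, map_smul]
    exact (h _ _ r).smul _

theorem matHasSymbol_siteProduct {x p : ℕ × Fin N → L} {a b : ℕ × Fin N → A}
    (ha : ∀ s, HasSymbol K 1 (x s) (π (a s))) (hb : ∀ s, HasSymbol K 0 (p s) (π (b s)))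
    (l : List ℕ) : MatHasSymbol π (siteProduct x p l) (siteProduct a b l) := by
  induction l with
  | nil => exact matHasSymbol_one
  | cons q l ih =>
    rw [siteProduct, siteProduct, List.map_cons, List.map_cons, List.prod_cons, List.prod_cons]
    refine (matHasSymbol_linearSeries fun i j => ?_).mul ih
    have := (ha (q, i)).mul (hb (q, j))
    rwa [← map_mul] at this

/-- The image of y acts by zero, whereas its leading term in the parameter is f evaluated at
g(u)g'(-u); that value must vanish. -/
theorem aeval_eq_zero_of_isWeyl {n : ℕ} (κ : FormType)
    (ι : TwistedYangian K n κ →ₐ[K] Yangian K (2 * n))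
    (hι : (matS K n κ).map (PowerSeries.map ι.toRingHom) =
      matT K (2 * n) * primeNeg K κ (matT K (2 * n)))
    {x p : ℕ × Fin (2 * n) → L} {a b : ℕ × Fin (2 * n) → A} (hab : IsWeyl a b)
    (ha : ∀ s, HasSymbol K 1 (x s) (π (a s))) (hb : ∀ s, HasSymbol K 0 (p s) (π (b s)))
    {l : List ℕ} (hl : l.Nodup) {d : ℕ}
    {f : MvPolynomial (Fin (2 * n) × Fin (2 * n) × ℕ) K} {y : TwistedYangian K n κ}
    (hf : (f, y) ∈ symbolPairs K (twistedGen K κ) genWeight d) (hy : ι y = 0) :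
    MvPolynomial.aeval (fun a => PowerSeries.coeff (genWeight a)
      ((siteProduct x p l * primeNeg K κ (siteProduct x p l)) a.1 a.2.1)) f = 0 := by
  obtain ⟨ρ, hρ⟩ := exists_yangian_hom (K := K) (siteProduct a b l) (constantCoeff_siteProduct l)
    (rtt_siteProduct hab hl)
  have h1 := (matHasSymbol_siteProduct ha hb l).mul ((matHasSymbol_siteProduct ha hb l).primeNeg κ)
  rw [← hρ, ← map_primeNeg, ← Matrix.map_mul, ← hι] at h1
  have h3 := hasSymbol_of_mem_symbolPairs (π.comp (ρ.comp ι)) (v := fun a =>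
    PowerSeries.coeff (genWeight a)
      ((siteProduct x p l * primeNeg K κ (siteProduct x p l)) a.1 a.2.1)) (fun a => by
    have h4 := h1 a.1 a.2.1 (genWeight a)
    rw [Matrix.map_apply, Matrix.map_apply, PowerSeries.coeff_map, PowerSeries.coeff_map, genWeight,
      coeff_matS_succ] at h4
    exact h4) hf
  rw [AlgHom.comp_apply, AlgHom.comp_apply, hy, map_zero, map_zero] at h3
  exact h3.eq_zero

end SymbolMatrices

theorem exists_isWeyl.{u, v, w} (K : Type u) {L : Type v} [Field K] [Field L] [Algebra K L]
    {σ : Type w} [DecidableEq σ] (x p : σ → L) :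
    ∃ (A : Type max v w) (_ : Ring A) (_ : Algebra K A)
      (π : A →ₐ[K] Module.End K (MvPolynomial σ (Polynomial L))) (a b : σ → A), IsWeyl a b ∧
      (∀ s, HasSymbol K 1 (x s) (π (a s))) ∧ ∀ s, HasSymbol K 0 (p s) (π (b s)) :=
  ⟨Module.End K (MvPolynomial σ (Polynomial L)), inferInstance, inferInstance, AlgHom.id K _,
    shiftedVar K x, shiftedDeriv K p, isWeyl_shifted x p, hasSymbol_shiftedVar x,
    hasSymbol_shiftedDeriv p⟩

/-- A homomorphism sending `S(u)` to `T(u) T'(-u)` detects symbols at the points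
`g(u) g'(-u)`, for `g(u)` a product of matrices `1 + E u⁻¹` with `E` of rank one. -/
theorem aeval_eq_zero_of_map_eq_zero {K L : Type*} [Field K] [Field L] [Algebra K L] {n : ℕ}
    (κ : FormType) (ι : TwistedYangian K n κ →ₐ[K] Yangian K (2 * n))
    (hι : (matS K n κ).map (PowerSeries.map ι.toRingHom) =
      matT K (2 * n) * primeNeg K κ (matT K (2 * n)))
    (x p : ℕ × Fin (2 * n) → L) {l : List ℕ} (hl : l.Nodup) {d : ℕ}
    {f : MvPolynomial (Fin (2 * n) × Fin (2 * n) × ℕ) K} {y : TwistedYangian K n κ}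
    (hf : (f, y) ∈ symbolPairs K (twistedGen K κ) genWeight d) (hy : ι y = 0) :
    MvPolynomial.aeval (fun a => PowerSeries.coeff (genWeight a)
      ((siteProduct x p l * primeNeg K κ (siteProduct x p l)) a.1 a.2.1)) f = 0 := by
  obtain ⟨A, _, _, π, a, b, h, ha, hb⟩ := exists_isWeyl K x p
  exact aeval_eq_zero_of_isWeyl κ ι hι h ha hb hl hf hy

end

end YangianDet

namespace YangianDet

noncomputable section

/-! ### Factorization of symmetric matrix series -/

section Points

variable {N : ℕ}

/-- The coefficients of `u⁻ʳ` with `r < d` vanish. -/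
def OrderGE {A : Type*} [Ring A] (d : ℕ) (M : Matrix (Fin N) (Fin N) A⟦X⟧) : Prop :=
  ∀ r < d, ∀ i j, PowerSeries.coeff r (M i j) = 0

theorem OrderGE.mul {A : Type*} [Ring A] {d e : ℕ} {M M' : Matrix (Fin N) (Fin N) A⟦X⟧}
    (h : OrderGE d M) (h' : OrderGE e M') : OrderGE (d + e) (M * M') := fun r hr i j => by
  rw [Matrix.mul_apply, map_sum]
  refine Finset.sum_eq_zero fun k _ => ?_
  rw [PowerSeries.coeff_mul]
  refine Finset.sum_eq_zero fun q hq => ?_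
  rw [Finset.HasAntidiagonal.mem_antidiagonal] at hq
  rcases lt_or_ge q.1 d with h1 | h1
  · rw [h _ h1, zero_mul]
  · rw [h' _ (by omega), mul_zero]

theorem orderGE_one_iff {A : Type*} [Ring A] {M : Matrix (Fin N) (Fin N) A⟦X⟧} :
    OrderGE 1 (M - 1) ↔ M.map PowerSeries.constantCoeff = 1 := by
  rw [← sub_eq_zero, ← Matrix.ext_iff]
  simp only [OrderGE, Nat.lt_one_iff, forall_eq, PowerSeries.coeff_zero_eq_constantCoeff_apply,
    Matrix.sub_apply, Matrix.map_apply, Matrix.zero_apply, map_sub, Matrix.one_apply]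
  refine forall_congr' fun i => forall_congr' fun j => ?_
  split_ifs <;> simp

theorem OrderGE.mul_sub_one {A : Type*} [Ring A] {M M' : Matrix (Fin N) (Fin N) A⟦X⟧}
    (h : OrderGE 1 (M - 1)) (h' : OrderGE 1 (M' - 1)) : OrderGE 1 (M * M' - 1) := by
  rw [orderGE_one_iff] at h h' ⊢
  rw [Matrix.map_mul, h, h', one_mul]

/-- Multiplication by a series congruent to `1` modulo `u⁻ᵈ`. -/
theorem coeff_mul_of_orderGE {A : Type*} [Ring A] {d e : ℕ} {M M' : Matrix (Fin N) (Fin N) A⟦X⟧}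
    (h : OrderGE d (M - 1)) (h' : OrderGE e (M' - 1)) {r : ℕ} (hr : r < d + e) (i j : Fin N) :
    PowerSeries.coeff r ((M * M') i j) = PowerSeries.coeff r (M i j) +
      PowerSeries.coeff r (M' i j) -
      PowerSeries.coeff r ((1 : Matrix (Fin N) (Fin N) A⟦X⟧) i j) := by
  have h1 : M * M' = M + M' - 1 + (M - 1) * (M' - 1) := by noncomm_ring
  rw [h1, Matrix.add_apply, map_add, h.mul h' r hr, add_zero, Matrix.sub_apply, Matrix.add_apply,
    map_sub, map_add]

variable {L : Type*} [Field L]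

variable (N L) in
/-- The products of matrices `1 + E u⁻¹` with `E` of rank at most one. -/
def rankOneProducts : Submonoid (Matrix (Fin N) (Fin N) L⟦X⟧) :=
  Submonoid.closure {M | ∃ x p : Fin N → L, linearSeries (Matrix.vecMulVec x p) = M}

theorem exists_siteProduct_eq {g : Matrix (Fin N) (Fin N) L⟦X⟧} (hg : g ∈ rankOneProducts N L) :
    ∃ (x p : ℕ × Fin N → L) (l : List ℕ), l.Nodup ∧ siteProduct x p l = g := by
  obtain ⟨l, hl, rfl⟩ := Submonoid.exists_list_of_mem_closure hg
  choose! x p hxp using hl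
  -- Sites are labelled by positions in the list, so repeated factors occupy distinct sites. The
  -- default value 1 is never used on the chosen sites.
  refine ⟨fun k => x (l.getD k.1 1) k.2, fun k => p (l.getD k.1 1) k.2, List.range l.length,
    List.nodup_range, ?_⟩
  rw [siteProduct]
  congr 1
  refine List.ext_getElem (by simp) fun k h1 h3 => ?_
  rw [List.getElem_map, List.getElem_range, ← hxp _ (List.getElem_mem h3)]
  congr 1
  ext i j
  simp [siteMatrix, Matrix.vecMulVec_apply, h3]

theorem orderGE_of_mem_rankOneProducts {g : Matrix (Fin N) (Fin N) L⟦X⟧}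
    (hg : g ∈ rankOneProducts N L) : OrderGE 1 (g - 1) := by
  obtain ⟨x, p, l, -, rfl⟩ := exists_siteProduct_eq hg
  exact orderGE_one_iff.2 (constantCoeff_siteProduct l)

/-- The matrix `1 + (P(u⁻¹) - 1) e`. -/
def idempotentSeries (e : Matrix (Fin N) (Fin N) L) (P : Polynomial L) :
    Matrix (Fin N) (Fin N) L⟦X⟧ :=
  1 + ((P : L⟦X⟧) - 1) • e.map PowerSeries.C

theorem idempotentSeries_mul {e : Matrix (Fin N) (Fin N) L} (he : e * e = e) (P Q : Polynomial L) :
    idempotentSeries e (P * Q) = idempotentSeries e P * idempotentSeries e Q := by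
  have h : e.map (PowerSeries.C (R := L)) * e.map PowerSeries.C = e.map PowerSeries.C := by
    rw [← Matrix.map_mul, he]
  rw [idempotentSeries, idempotentSeries, idempotentSeries, add_mul, mul_add, mul_add, one_mul,
    mul_one, one_mul, smul_mul_smul_comm, h, Polynomial.coe_mul, ← add_assoc, add_assoc 1, add_assoc 1,
    ← add_smul, ← add_smul]
  congr 2
  ring

/-- For an idempotent e the series is multiplicative in P, and P splits into factors 1 - c⁻¹X; each
gives 1 - c⁻¹e u⁻¹ with e of rank one. -/
theorem idempotentSeries_mem [IsAlgClosed L] {x p : Fin N → L} (h : x ⬝ᵥ p = 1)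
    {P : Polynomial L} (hP : P.coeff 0 = 1) :
    idempotentSeries (Matrix.vecMulVec x p) P ∈ rankOneProducts N L := by
  have he : Matrix.vecMulVec x p * Matrix.vecMulVec x p = Matrix.vecMulVec x p := by
    rw [Matrix.vecMulVec_mul_vecMulVec, dotProduct_comm, h, one_smul]
  induction hd : P.natDegree generalizing P with
  | zero =>
    rw [Polynomial.eq_C_of_natDegree_eq_zero hd, hP, idempotentSeries]
    simpa using Submonoid.one_mem _
  | succ d ih =>
    have hP0 : P ≠ 0 := by rintro rfl; simp at hP
    obtain ⟨c, hc⟩ := IsAlgClosed.exists_root P (by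
      rw [Polynomial.degree_eq_natDegree hP0, hd]
      exact_mod_cast d.succ_ne_zero)
    obtain ⟨Q, rfl⟩ := Polynomial.dvd_iff_isRoot.2 hc
    rw [Polynomial.mul_coeff_zero, Polynomial.coeff_sub, Polynomial.coeff_X_zero,
      Polynomial.coeff_C_zero, zero_sub] at hP
    have hc0 : c ≠ 0 := by rintro rfl; simp at hP
    -- The root c is nonzero since P(0) = 1, so the linear factor can be normalized to constant term
    -- 1.
    have hQ : (Polynomial.X - Polynomial.C c) * Q =
        (1 + Polynomial.C (-c⁻¹) * Polynomial.X) * (Polynomial.C (-c) * Q) := by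
      rw [← mul_assoc, add_mul, one_mul, mul_right_comm, ← Polynomial.C_mul, neg_mul_neg,
        inv_mul_cancel₀ hc0, Polynomial.C_1, Polynomial.C_neg]
      ring
    rw [hQ, idempotentSeries_mul he]
    refine Submonoid.mul_mem _ (Submonoid.subset_closure ⟨(-c⁻¹) • x, p, ?_⟩) (ih ?_ ?_)
    · ext1 i j
      rw [linearSeries, idempotentSeries, Matrix.add_apply, Matrix.add_apply, Matrix.of_apply,
        Matrix.smul_vecMulVec, Matrix.smul_apply, Matrix.smul_apply, Matrix.map_apply]
      simp
      ring
    · rw [Polynomial.mul_coeff_zero, Polynomial.coeff_C_zero, hP]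
    · rw [Polynomial.natDegree_C_mul (neg_ne_zero.2 hc0)]
      rw [Polynomial.natDegree_mul (Polynomial.X_sub_C_ne_zero c) (right_ne_zero_of_mul hP0),
        Polynomial.natDegree_X_sub_C] at hd
      omega

variable (N L) in
/-- The matrices `E` such that some product of rank one factors is `1 + E u⁻ᵈ` modulo
`u⁻ᵈ⁻¹`. -/
def leadingMatrices (d : ℕ) : Set (Matrix (Fin N) (Fin N) L) :=
  {E | ∃ g ∈ rankOneProducts N L, OrderGE d (g - 1) ∧
    ∀ i j, PowerSeries.coeff d (g i j) = E i j}

theorem add_mem_leadingMatrices {d : ℕ} (hd : d ≠ 0) {E E' : Matrix (Fin N) (Fin N) L}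
    (h : E ∈ leadingMatrices N L d) (h' : E' ∈ leadingMatrices N L d) :
    E + E' ∈ leadingMatrices N L d := by
  obtain ⟨g, hg, h1, h3⟩ := h
  obtain ⟨g', hg', h1', h3'⟩ := h'
  refine ⟨g * g', Submonoid.mul_mem _ hg hg', fun r hr i j => ?_, fun i j => ?_⟩
  · have e1 := h1 r hr i j
    have e3 := h1' r hr i j
    rw [Matrix.sub_apply, map_sub] at e1 e3 ⊢
    rw [coeff_mul_of_orderGE h1 h1' (by omega)]
    linear_combination e1 + e3
  · rw [coeff_mul_of_orderGE h1 h1' (by omega), h3, h3', Matrix.one_apply]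
    split_ifs <;> simp [PowerSeries.coeff_one, hd]

/-- Take P = 1 + cXᵈ in the idempotent series. -/
theorem smul_idempotent_mem_leadingMatrices [IsAlgClosed L] {d : ℕ} (hd : d ≠ 0) (c : L)
    {x p : Fin N → L} (h : x ⬝ᵥ p = 1) :
    c • Matrix.vecMulVec x p ∈ leadingMatrices N L d := by
  refine ⟨_, idempotentSeries_mem (P := 1 + Polynomial.C c * Polynomial.X ^ d) h
    (by simp [Polynomial.coeff_X_pow, hd.symm]), fun r hr i j => ?_, fun i j => ?_⟩
  · rw [idempotentSeries, add_sub_cancel_left, Matrix.smul_apply, Matrix.map_apply, smul_eq_mul,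
      PowerSeries.coeff_mul_C]
    simp [PowerSeries.coeff_X_pow, hr.ne]
  · rw [idempotentSeries, Matrix.add_apply, map_add, Matrix.smul_apply, Matrix.map_apply,
      smul_eq_mul, PowerSeries.coeff_mul_C, Matrix.one_apply]
    split_ifs <;> simp [PowerSeries.coeff_one, PowerSeries.coeff_X_pow, hd]

/-- Leading matrices add, so it suffices that rank one idempotents span: E_ij = e_i(e_i + e_j)ᵗ -
e_i e_iᵗ for i ≠ j. -/
theorem mem_leadingMatrices [IsAlgClosed L] {d : ℕ} (hd : d ≠ 0) (E : Matrix (Fin N) (Fin N) L) :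
    E ∈ leadingMatrices N L d := by
  have h0 : (0 : Matrix (Fin N) (Fin N) L) ∈ leadingMatrices N L d := by
    refine ⟨1, Submonoid.one_mem _, fun r _ i j => by simp, fun i j => ?_⟩
    rw [Matrix.one_apply]
    split_ifs <;> simp [PowerSeries.coeff_one, hd]
  rw [Matrix.matrix_eq_sum_single E]
  have hsum : ∀ {ι : Type} (t : Finset ι) (F : ι → Matrix (Fin N) (Fin N) L),
      (∀ i, F i ∈ leadingMatrices N L d) → ∑ i ∈ t, F i ∈ leadingMatrices N L d := by
    intro ι t F hF
    classical
    induction t using Finset.induction_on with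
    | empty => simpa using h0
    | insert i t hi ih =>
      rw [Finset.sum_insert hi]
      exact add_mem_leadingMatrices hd (hF i) ih
  refine hsum _ _ fun i => hsum _ _ fun j => ?_
  have h1 : ∀ (k : Fin N) (c : L), Matrix.single i k c =
      c • Matrix.vecMulVec (Pi.single i 1) (Pi.single k 1) := by
    intro k c
    rw [← Matrix.single_eq_single_vecMulVec_single, Matrix.smul_single, smul_eq_mul, mul_one]
  rcases eq_or_ne i j with rfl | hij
  · rw [h1]
    exact smul_idempotent_mem_leadingMatrices hd _ (by simp)
  · have h3 : Matrix.single i j (E i j) =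
        (E i j) • Matrix.vecMulVec (Pi.single i 1) (Pi.single i 1 + Pi.single j 1) +
          (-E i j) • Matrix.vecMulVec (Pi.single i 1) (Pi.single i 1) := by
      rw [Matrix.vecMulVec_add, smul_add, ← h1, ← h1, ← h1]
      rw [add_right_comm, ← Matrix.single_add, add_neg_cancel, Matrix.single_zero, zero_add]
    rw [h3]
    exact add_mem_leadingMatrices hd (smul_idempotent_mem_leadingMatrices hd _ (by simp [hij]))
      (smul_idempotent_mem_leadingMatrices hd _ (by simp))

end Points

/-! ### Approximation of symmetric series by g(u)g'(-u). -/

section SymmetricSeries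

variable {K L : Type*} [Field K] [Field L] [Algebra K L] {n : ℕ} (κ : FormType)

/-- Reversal of products relies on the commutativity of L. -/
theorem primeNeg_mul (M M' : Matrix (Fin (2 * n)) (Fin (2 * n)) L⟦X⟧) :
    primeNeg K κ (M * M') = primeNeg K κ M' * primeNeg K κ M := by
  ext1 i j
  rw [primeNeg_eq, primeNeg_eq, primeNeg_eq, Matrix.map_mul, formTranspose_apply, Matrix.mul_apply,
    Matrix.mul_apply, ← Equiv.sum_comp Fin.revPerm, Finset.smul_sum]
  refine Finset.sum_congr rfl fun k _ => ?_
  rw [formTranspose_apply, formTranspose_apply, smul_mul_smul_comm, mul_mul_mul_comm,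
    ← mul_assoc, Fin.revPerm_apply, mul_assoc (formSgn K κ i), formSgn_mul_self, mul_one,
    mul_comm (M.map _ _ _)]

theorem primeNeg_primeNeg (M : Matrix (Fin (2 * n)) (Fin (2 * n)) L⟦X⟧) :
    primeNeg K κ (primeNeg K κ M) = M := by
  ext i j r
  rw [coeff_primeNeg, coeff_primeNeg, smul_smul, Fin.rev_rev, Fin.rev_rev, formSgn_rev_mul_rev]
  have h : ((-1) ^ r * (formSgn K κ i * formSgn K κ j)) *
      ((-1) ^ r * (formSgn K κ j * formSgn K κ i)) = 1 := by
    rw [mul_mul_mul_comm, ← mul_pow, neg_mul_neg, one_mul, one_pow, one_mul, mul_mul_mul_comm,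
      mul_comm (formSgn K κ j), ← mul_mul_mul_comm, formSgn_mul_self, formSgn_mul_self, one_mul]
  rw [h, one_smul]

theorem primeNeg_one : primeNeg K κ (1 : Matrix (Fin (2 * n)) (Fin (2 * n)) L⟦X⟧) = 1 := by
  have h := primeNeg_mul (K := K) κ (1 : Matrix (Fin (2 * n)) (Fin (2 * n)) L⟦X⟧)
    (primeNeg K κ (1 : Matrix (Fin (2 * n)) (Fin (2 * n)) L⟦X⟧))
  rwa [one_mul, primeNeg_primeNeg, one_mul, eq_comm] at h

theorem OrderGE.primeNeg {d : ℕ} {M : Matrix (Fin (2 * n)) (Fin (2 * n)) L⟦X⟧}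
    (h : OrderGE d (M - 1)) : OrderGE d (primeNeg K κ M - 1) := fun r hr i j => by
  rw [← primeNeg_one (K := K), Matrix.sub_apply, map_sub, coeff_primeNeg, coeff_primeNeg, ← smul_sub]
  have := h r hr (Fin.rev j) (Fin.rev i)
  rw [Matrix.sub_apply, map_sub] at this
  rw [this, smul_zero]

/-- Over an algebraically closed field, every symmetric series is approximated by the
products `g(u) g'(-u)`. -/
theorem exists_mul_primeNeg_eq [IsAlgClosed L] (h2 : (2 : L) ≠ 0)
    {S : Matrix (Fin (2 * n)) (Fin (2 * n)) L⟦X⟧} (hS : OrderGE 1 (S - 1))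
    (hS' : primeNeg K κ S = S) (d : ℕ) :
    ∃ g ∈ rankOneProducts (2 * n) L, OrderGE (d + 1) (S - g * primeNeg K κ g) := by
  induction d with
  | zero =>
    refine ⟨1, Submonoid.one_mem _, ?_⟩
    rwa [primeNeg_one, mul_one]
  | succ d ih =>
    obtain ⟨g, hg, h⟩ := ih
    have hsym : ∀ q : Matrix (Fin (2 * n)) (Fin (2 * n)) L⟦X⟧,
        primeNeg K κ (q * primeNeg K κ q) = q * primeNeg K κ q := by
      intro q
      rw [primeNeg_mul, primeNeg_primeNeg]
    -- q cancels half of the defect of order d + 1; the transposed factor q'(-u) supplies the other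
    -- half.
    obtain ⟨q, hq, hq1, hq3⟩ := mem_leadingMatrices d.succ_ne_zero (Matrix.of fun i j =>
      2⁻¹ * PowerSeries.coeff (d + 1) ((S - g * primeNeg K κ g) i j) :
        Matrix (Fin (2 * n)) (Fin (2 * n)) L)
    refine ⟨q * g, Submonoid.mul_mem _ hq hg, ?_⟩
    have hg1 := orderGE_of_mem_rankOneProducts hg
    have hh1 := hg1.mul_sub_one (hg1.primeNeg (K := K) κ)
    have hqh := (orderGE_of_mem_rankOneProducts hq).mul_sub_one hh1
    rw [primeNeg_mul, mul_assoc, ← mul_assoc g, ← mul_assoc]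
    intro r hr i j
    rw [Matrix.sub_apply, map_sub, coeff_mul_of_orderGE hqh (hq1.primeNeg (K := K) κ) (by omega),
      coeff_mul_of_orderGE hq1 hh1 (by omega)]
    rcases Nat.lt_succ_iff_lt_or_eq.1 hr with hr | rfl
    · have e1 := h r hr i j
      have e3 := hq1 r hr i j
      have e4 := hq1.primeNeg (K := K) κ r hr i j
      rw [Matrix.sub_apply, map_sub] at e1 e3 e4
      linear_combination e1 - e3 - e4
    · have e5 : ∀ i j, PowerSeries.coeff (d + 1)
          ((1 : Matrix (Fin (2 * n)) (Fin (2 * n)) L⟦X⟧) i j) = 0 := by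
        intro i j
        rw [Matrix.one_apply]
        split_ifs <;> simp [PowerSeries.coeff_one]
      -- The defect is itself symmetric, so the contributions of q and q'(-u) coincide and add up to
      -- it.
      have e6 : primeNeg K κ (S - g * primeNeg K κ g) = S - g * primeNeg K κ g := by
        ext i j r
        rw [coeff_primeNeg, Matrix.sub_apply, Matrix.sub_apply, map_sub, map_sub, smul_sub,
          ← coeff_primeNeg, ← coeff_primeNeg, hS', hsym]
      have e7 := congrArg (PowerSeries.coeff (d + 1)) (congrFun (congrFun e6 i) j)
      rw [coeff_primeNeg] at e7
      rw [coeff_primeNeg, hq3, hq3, e5, Matrix.of_apply, Matrix.of_apply, ← mul_smul_comm, e7,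
        Matrix.sub_apply, map_sub]
      linear_combination (-(PowerSeries.coeff (d + 1) (S i j) -
        PowerSeries.coeff (d + 1) ((g * primeNeg K κ g) i j))) * (mul_inv_cancel₀ h2)

end SymmetricSeries

end

end YangianDet

namespace YangianDet

noncomputable section

/-! ### Vanishing of symbols and injectivity. -/

section Injectivity

variable {K : Type*} [Field K] {n : ℕ} (κ : FormType)

theorem genStar_genStar {N : ℕ} (a : Fin N × Fin N × ℕ) : genStar (genStar a) = a := by
  simp [genStar]

theorem genSgn_mul_genSgn_genStar (a : Fin (2 * n) × Fin (2 * n) × ℕ) :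
    genSgn K κ a * genSgn K κ (genStar a) = 1 := by
  rw [genSgn, genSgn, genStar, formSgn_rev_mul_rev, mul_mul_mul_comm, ← mul_pow, neg_mul_neg,
    one_mul, one_pow, one_mul, mul_comm (formSgn K κ a.2.1), mul_mul_mul_comm, formSgn_mul_self,
    formSgn_mul_self, one_mul]

variable {L : Type*} [Field L] [Algebra K L]

/-- The symmetrized variables take the same value at a symmetric point. -/
theorem aeval_symVar_of_symmetric (h2 : (2 : K) ≠ 0) {v : Fin (2 * n) × Fin (2 * n) × ℕ → L}
    (hv : ∀ a, genSgn K κ a • v (genStar a) = v a)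
    (f : MvPolynomial (Fin (2 * n) × Fin (2 * n) × ℕ) K) :
    MvPolynomial.aeval v (MvPolynomial.aeval (symVar K genStar (genSgn K κ)) f) =
      MvPolynomial.aeval v f := by
  rw [← AlgHom.comp_apply, MvPolynomial.comp_aeval]
  congr 2
  ext1 a
  rw [symVar, map_smul, map_add, map_smul, MvPolynomial.aeval_X, MvPolynomial.aeval_X, hv,
    ← two_smul K, smul_smul, inv_mul_cancel₀ h2, one_smul]

theorem aeval_aeval_symVar (v : Fin (2 * n) × Fin (2 * n) × ℕ → L)
    (f : MvPolynomial (Fin (2 * n) × Fin (2 * n) × ℕ) K) :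
    MvPolynomial.aeval v (MvPolynomial.aeval (symVar K genStar (genSgn K κ)) f) =
      MvPolynomial.aeval (fun a => (2⁻¹ : K) • (v a + genSgn K κ a • v (genStar a))) f := by
  rw [← AlgHom.comp_apply, MvPolynomial.comp_aeval]
  congr 2
  ext1 a
  rw [symVar, map_smul, map_add, map_smul, MvPolynomial.aeval_X, MvPolynomial.aeval_X]

theorem genMatrix_symmetric {v : Fin (2 * n) × Fin (2 * n) × ℕ → L}
    (hv : ∀ a, genSgn K κ a • v (genStar a) = v a) :
    primeNeg K κ (genMatrix fun i j r => v (i, j, r)) = genMatrix fun i j r => v (i, j, r) := by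
  ext i j r
  rw [coeff_primeNeg]
  rcases r with _ | r
  · simp only [genMatrix, Matrix.of_apply, PowerSeries.coeff_mk, Fin.rev_inj, pow_zero, one_mul]
    rcases eq_or_ne i j with rfl | h
    · rw [if_pos rfl, formSgn_mul_self, one_smul]
    · rw [if_neg h.symm, if_neg h, smul_zero]
  · simp only [genMatrix, Matrix.of_apply, PowerSeries.coeff_mk]
    exact hv (i, j, r)

theorem orderGE_genMatrix {N : ℕ} (t : Fin N → Fin N → ℕ → L) : OrderGE 1 (genMatrix t - 1) := by
  rw [orderGE_one_iff]
  ext i j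
  rw [Matrix.map_apply, ← PowerSeries.coeff_zero_eq_constantCoeff_apply]
  simp [genMatrix, Matrix.one_apply]

theorem coeff_symmetric {S : Matrix (Fin (2 * n)) (Fin (2 * n)) L⟦X⟧} (hS : primeNeg K κ S = S)
    (a : Fin (2 * n) × Fin (2 * n) × ℕ) :
    genSgn K κ a • PowerSeries.coeff (genWeight (genStar a)) (S (genStar a).1 (genStar a).2.1) =
      PowerSeries.coeff (genWeight a) (S a.1 a.2.1) := by
  conv_rhs => rw [← hS]
  rw [coeff_primeNeg]
  rfl

/-- Evaluating a symmetrized polynomial at v amounts to evaluating f at a symmetric point w, which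
some g(u)g'(-u) matches in all coefficients that f involves. -/
theorem aeval_symVar_eq_zero [IsAlgClosed L] (h2 : (2 : K) ≠ 0)
    (ι : TwistedYangian K n κ →ₐ[K] Yangian K (2 * n))
    (hι : (matS K n κ).map (PowerSeries.map ι.toRingHom) =
      matT K (2 * n) * primeNeg K κ (matT K (2 * n))) {d : ℕ}
    {f : MvPolynomial (Fin (2 * n) × Fin (2 * n) × ℕ) K} {y : TwistedYangian K n κ}
    (hf : (MvPolynomial.aeval (symVar K genStar (genSgn K κ)) f, y) ∈
      symbolPairs K (twistedGen K κ) genWeight d) (hy : ι y = 0)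
    (v : Fin (2 * n) × Fin (2 * n) × ℕ → L) :
    MvPolynomial.aeval v (MvPolynomial.aeval (symVar K genStar (genSgn K κ)) f) = 0 := by
  have h2L : (2 : L) ≠ 0 := by
    rw [← map_ofNat (algebraMap K L) 2]
    exact (map_ne_zero _).2 h2
  rw [aeval_aeval_symVar]
  have hw : ∀ a, genSgn K κ a • (fun a => (2⁻¹ : K) • (v a + genSgn K κ a • v (genStar a)))
      (genStar a) = (fun a => (2⁻¹ : K) • (v a + genSgn K κ a • v (genStar a))) a := by
    intro a
    simp only [genStar_genStar]
    rw [smul_comm, smul_add, smul_smul, genSgn_mul_genSgn_genStar, one_smul, add_comm]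
  generalize (fun a => (2⁻¹ : K) • (v a + genSgn K κ a • v (genStar a))) = w at hw ⊢
  -- The order of approximation is the largest weight of a variable occurring in f.
  obtain ⟨g, hg, h⟩ := exists_mul_primeNeg_eq κ h2L (orderGE_genMatrix fun i j r => w (i, j, r))
    (genMatrix_symmetric κ hw) (f.vars.sup genWeight)
  obtain ⟨x, p, l, hl, rfl⟩ := exists_siteProduct_eq hg
  have h1 := aeval_eq_zero_of_map_eq_zero κ ι hι x p hl hf hy
  rw [aeval_symVar_of_symmetric κ h2 (coeff_symmetric κ (by
    rw [primeNeg_mul, primeNeg_primeNeg]))] at h1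
  rw [← h1, MvPolynomial.aeval_def, MvPolynomial.aeval_def]
  refine MvPolynomial.eval₂Hom_congr' rfl (fun a ha _ => ?_) rfl
  have h3 := h (genWeight a) (Nat.lt_succ_of_le (Finset.le_sup ha)) a.1 a.2.1
  rw [Matrix.sub_apply, map_sub, sub_eq_zero] at h3
  rw [← h3, genMatrix, Matrix.of_apply, genWeight, PowerSeries.coeff_mk]

/-- The homomorphism `S(u) ↦ T(u) T'(-u)` is injective. -/
theorem twistedYangian_hom_injective (h2 : (2 : K) ≠ 0)
    (ι : TwistedYangian K n κ →ₐ[K] Yangian K (2 * n))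
    (hι : (matS K n κ).map (PowerSeries.map ι.toRingHom) =
      matT K (2 * n) * primeNeg K κ (matT K (2 * n))) : Function.Injective ι := by
  refine injective_of_symbols h2 (star := genStar) (fun _ => rfl) (twistedGen_commutator κ)
    (twistedGen_symmetric κ) (exists_mem_wordSpan κ) ι fun d y f hf hy => ?_
  -- K may be finite; over its algebraic closure, which is infinite, a polynomial vanishing at every
  -- point is zero.
  refine MvPolynomial.map_injective _ (algebraMap K (AlgebraicClosure K)).injective ?_
  rw [map_zero]
  refine MvPolynomial.funext fun v => ?_
  rw [MvPolynomial.eval_map, ← MvPolynomial.aeval_def, map_zero]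
  exact aeval_symVar_eq_zero κ h2 ι hι hf hy v

end Injectivity

end

end YangianDet

open scoped PowerSeries
namespace YangianDet

/-! ### The characteristic hypothesis, constant terms and the conclusion. -/

theorem natCast_ne_zero_of_charP {K : Type*} [Field K] (p : ℕ) [CharP K p] {m : ℕ}
    (hp : p = 0 ∨ m < p) {k : ℕ} (hk : k ≠ 0) (hkm : k ≤ m) : (k : K) ≠ 0 := by
  rw [Ne, CharP.cast_eq_zero_iff K p]
  intro h
  rcases hp with rfl | hp
  · exact hk (Nat.zero_dvd.1 h)
  · exact absurd (Nat.le_of_dvd (Nat.pos_of_ne_zero hk) h) (by omega)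

theorem factorial_ne_zero_of_charP {K : Type*} [Field K] (p : ℕ) [CharP K p] {m : ℕ}
    (hp : p = 0 ∨ m < p) {k : ℕ} (hkm : k ≤ m) : (k.factorial : K) ≠ 0 := by
  induction k with
  | zero => simp
  | succ k ih =>
    rw [Nat.factorial_succ, Nat.cast_mul]
    exact mul_ne_zero (natCast_ne_zero_of_charP p hp k.succ_ne_zero hkm) (ih (by omega))

theorem constantCoeff_matT {K : Type*} [Field K] (N : ℕ) :
    (matT K N).map PowerSeries.constantCoeff = 1 := by
  ext i j
  rw [Matrix.map_apply, ← PowerSeries.coeff_zero_eq_constantCoeff_apply]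
  simp [matT, genMatrix, Matrix.one_apply]

theorem constantCoeff_mul_primeNeg {K : Type*} [Field K] {A : Type*} [Ring A] [Algebra K A] {n : ℕ}
    (κ : FormType) {T : Matrix (Fin (2 * n)) (Fin (2 * n)) A⟦X⟧}
    (hT : T.map PowerSeries.constantCoeff = 1) :
    (T * primeNeg K κ T).map PowerSeries.constantCoeff = 1 := by
  have hc : ∀ c : K, PowerSeries.constantCoeff (algebraMap K A⟦X⟧ c) = algebraMap K A c := by
    intro c
    rw [PowerSeries.algebraMap_apply, PowerSeries.constantCoeff_C]
  have h1 : (T.map (affineHom A (-1 : K) 0)).map PowerSeries.constantCoeff = 1 := by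
    rw [← hT]
    ext i j
    simp only [Matrix.map_apply, ← PowerSeries.coeff_zero_eq_constantCoeff_apply,
      coeff_zero_affineHom]
  rw [Matrix.map_mul, hT, one_mul, primeNeg_eq, map_formTranspose κ hc, h1, formTranspose_one]

end YangianDet

theorem mainTheorem5 {K : Type*} [Field K] (p : ℕ) [CharP K p] (n : ℕ) (hn : 0 < n)
    (hp : p = 0 ∨ 2 * n < p) (κ : YangianDet.FormType) :
    -- the series `qdet T(u)` and `sdet S(u)` have their defining properties
    YangianDet.antisymmetrizer (2 * n) (2 * n) (PowerSeries (YangianDet.Yangian K (2 * n))) *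
          YangianDet.tensorProduct K (YangianDet.matT K (2 * n)) =
        YangianDet.qdet K (2 * n) •
          YangianDet.antisymmetrizer (2 * n) (2 * n)
            (PowerSeries (YangianDet.Yangian K (2 * n))) ∧
    YangianDet.antisymmetrizer (2 * n) (2 * n)
            (PowerSeries (YangianDet.TwistedYangian K n κ)) *
          YangianDet.bracket K κ (YangianDet.matS K n κ) =
        YangianDet.sdet K n κ •
          YangianDet.antisymmetrizer (2 * n) (2 * n)
            (PowerSeries (YangianDet.TwistedYangian K n κ)) ∧
    -- there is exactly one homomorphism `ι` with `S(u) ↦ T(u) T'(-u)`; it is injective and maps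
    -- `sdet S(u)` to `α_N(u) qdet T(u) qdet T(-u+N-1)`
    ∃ ι : YangianDet.TwistedYangian K n κ →ₐ[K] YangianDet.Yangian K (2 * n),
      (YangianDet.matS K n κ).map (PowerSeries.map ι.toRingHom) =
          YangianDet.matT K (2 * n) * YangianDet.primeNeg K κ (YangianDet.matT K (2 * n)) ∧
      (∀ ι' : YangianDet.TwistedYangian K n κ →ₐ[K] YangianDet.Yangian K (2 * n),
        (YangianDet.matS K n κ).map (PowerSeries.map ι'.toRingHom) =
          YangianDet.matT K (2 * n) * YangianDet.primeNeg K κ (YangianDet.matT K (2 * n)) →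
        ι' = ι) ∧
      Function.Injective ι ∧
      PowerSeries.map ι.toRingHom (YangianDet.sdet K n κ) =
        YangianDet.scalarSeries (YangianDet.Yangian K (2 * n)) (YangianDet.alpha K (2 * n) κ) *
          YangianDet.qdet K (2 * n) *
          YangianDet.affineSubst (-1 : K) (((2 * n : ℕ) : K) - 1) (YangianDet.qdet K (2 * n)) := by
  have h2 : (2 : K) ≠ 0 := by
    exact_mod_cast YangianDet.natCast_ne_zero_of_charP p hp two_ne_zero (by omega)
  have hfac : ((2 * n).factorial : K) ≠ 0 := YangianDet.factorial_ne_zero_of_charP p hp le_rfl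
  have hT := YangianDet.rtt_matT (K := K) (2 * n)
  refine ⟨YangianDet.antisymmetrizer_mul_tensorProduct h2 hT,
    YangianDet.antisymmetrizer_mul_bracket κ h2 (YangianDet.reflection_matS κ), ?_⟩
  obtain ⟨ι, hι⟩ := YangianDet.exists_twistedYangian_hom κ _
    (YangianDet.constantCoeff_mul_primeNeg κ (YangianDet.constantCoeff_matT (K := K) (2 * n)))
    (YangianDet.quaternary_mul_primeNeg κ hT) (YangianDet.symmetry_mul_primeNeg κ h2 hT)
  refine ⟨ι, hι, fun ι' hι' => YangianDet.twistedYangian_hom_ext κ (hι'.trans hι.symm),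
    YangianDet.twistedYangian_hom_injective κ h2 ι hι, ?_⟩
  have h1 := YangianDet.diagCoeff_bracket_mul_primeNeg κ h2 hfac hT
  -- By naturality of the antisymmetrizer and the bracket, the image of sdet S(u) is the same
  -- coefficient computed for T(u)T'(-u).
  rw [YangianDet.sdet, YangianDet.qdet, ← h1, ← hι, ← YangianDet.map_bracket,
    ← YangianDet.map_antisymmetrizer (PowerSeries.map ι.toRingHom), ← Matrix.map_mul]
  rfl
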